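/- Fix a smooth function $\chi:\mathbb R\to\mathbb R$ with support in $[0,\infty)$, $\chi(x)=1$ for $x\ge 1$ and $\chi'\ge 0$. Let $E=L^2(\mathbb R)\cap L^\infty(\mathbb R)$ with norm $\|f\|_E=\|f\|_{L^2}+\|f\|_{L^\infty}$, and $$\bar V=L^\infty(\mathbb R)\times E\times L^\infty(\mathbb R)\times E\times E\times E\times E\times L^\infty(\mathbb R).$$ A quadruple $(y,U,h,r)$ is identified with $X=(\zeta,\bar U,c,\zeta_\xi,U_\xi,h,\bar r,k)$, where $c,k\in\mathbb R$ are constants in $\xi$ and $$y(\xi)=\xi+\zeta(\xi),\qquad U=\bar U+c\,\chi\circ y,\qquad r=\bar r+k\,y_\xi .$$ For $x\in\mathbb R^8$ let $g_1(x)=|x_5|+2|x_7x_8|+2x_4$, $g_2(x)=x_4+x_6$, and let $g(x)=g_1(x)$ if $g_1(x)\le g_2(x)$, $x_5\le 0$ and $x_7+x_8x_4=0$, and $g(x)=g_2(x)$ otherwise. The set $\mathcal G$ consists of all $X$ such that (a) $X\in\bar V$; (b) $g(y,\bar U,c,y_\xi,U_\xi,h,\bar r,k)-1\in E$; (c) $y_\xi\ge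 0$ and $h\ge 0$ a.e.; (d) $\lim_{\xi\to-\infty}\zeta(\xi)=0$; (e) $\frac1{y_\xi+h}\in L^\infty(\mathbb R)$; (f) $y_\xi h=U_\xi^2+\bar r^2$ a.e. For a curve $X(t)$, let $\tau(\xi)=0$ if $y_\xi(0,\xi)=0$ and otherwise $\tau(\xi)=\sup\{t\ge 0: y_\xi(t',\xi)>0\text{ for all }0\le t'<t\}$, with $\tau(\xi)=\infty$ if $y_\xi(\cdot,\xi)$ stays positive on the whole time interval considered. The dissipative system (the Lagrangian form of the two-component Camassa–Holm system with $\kappa=0$, $\eta=1$, $u_{-\infty}=0$) is $$\begin{aligned} y_t&=U,\qquad U_t=-Q(X),\\ y_{t,\xi}&=\mathbf 1_{\{\tau(\xi)>t\}}U_\xi,\\ U_{t,\xi}&=\mathbf 1_{\{\tau(\xi)>t\}}\big(\tfrac12h+(U^2+\tfrac12k^2-P(X))y_\xi+k\bar r\big),\\ h_t&=\mathbf 1_{\{\tau(\xi)>t\}}\,2(U^2+\tfrac12k^2-P(X))U_\xi,\\ \bar r_t&=-\mathbf 1_{\{\tau(\xi)>t\}}\,kU_\xi,\qquad c_t=0,\qquad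 k_t=0, \end{aligned}$$ where, with $S=2c(\chi\circ y)\bar Uy_\xi+\bar U^2y_\xi+\tfrac12h+k\bar r$ and $R=2c^2(\chi'^2+\chi\chi'')(y)\,y_\xi$, $$\begin{aligned} P(t,\xi)&=U^2+\tfrac12k^2-2c\chi(y)\bar U-\bar U^2+\tfrac12\int_{\tau(\eta)>t}e^{-|y(t,\xi)-y(t,\eta)|}S(t,\eta)\,d\eta+\tfrac12\int_{\mathbb R}e^{-|y(t,\xi)-y(t,\eta)|}R(t,\eta)\,d\eta,\\ Q(t,\xi)&=2c^2\chi(y)\chi'(y)-\tfrac12\int_{\tau(\eta)>t}\operatorname{sgn}(\xi-\eta)e^{-|y(t,\xi)-y(t,\eta)|}S(t,\eta)\,d\eta-\tfrac12\int_{\mathbb R}\operatorname{sgn}(\xi-\eta)e^{-|y(t,\xi)-y(t,\eta)|}R(t,\eta)\,d\eta . \end{aligned}$$ A solution on $[0,T]$ is a curve $X\in C([0,T],\bar V)$, whose fourth and fifth components are the derivatives $\zeta_\xi$ and $U_\xi$ of $\zeta$ and $U$, that satisfies these equations integrated in time on $[0,T]$ (for every $\xi$ in the first line, for a.e. $\xi$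 in the equations for $y_\xi,U_\xi,h,\bar r$). **Theorem (short time solution).** For any initial data $X_0\in\mathcal G$ there exists a time $T>0$ such that there exists a unique solution $X\in C([0,T],\bar V)$ of the dissipative system with $X(0)=X_0$. Moreover, $X(t)\in\mathcal G$ for all $t\in[0,T]$. -/

import Mathlib

open MeasureTheory Set Filter Topology
open scoped ENNReal ContDiff

noncomputable section

namespace TwoCH

/-- A smooth partition function: support in `[0, ∞)`, equal to `1` on `[1, ∞)`, nondecreasing. -/
structure IsPartitionFunction (χ : ℝ → ℝ) : Prop where
  smooth : ContDiff ℝ ∞ χ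
  support_subset : Function.support χ ⊆ Ici 0
  eq_one : ∀ x, 1 ≤ x → χ x = 1
  deriv_nonneg : ∀ x, 0 ≤ deriv χ x

/-- Membership in `E = L²(ℝ) ∩ L^∞(ℝ)`. -/
def MemE (f : ℝ → ℝ) : Prop := MemLp f 2 volume ∧ MemLp f ∞ volume

/-- The norm `‖f‖_{L²} + ‖f‖_{L^∞}` of `E`. -/
def normE (f : ℝ → ℝ) : ℝ≥0∞ := eLpNorm f 2 volume + eLpNorm f ∞ volume

/-- `f` is locally absolutely continuous with (weak) derivative `f'`. -/
def HasDerivAE (f f' : ℝ → ℝ) : Prop :=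
  ∀ a b : ℝ, IntervalIntegrable f' volume a b ∧ f b - f a = (∫ x in a..b, f' x)

/-- The eight Lagrangian components `(ζ, Ū, c, ζ_ξ, U_ξ, h, r̄, k)` at a fixed time. -/
structure State where
  zeta : ℝ → ℝ
  Ubar : ℝ → ℝ
  c : ℝ
  zetaXi : ℝ → ℝ
  UXi : ℝ → ℝ
  h : ℝ → ℝ
  rbar : ℝ → ℝ
  k : ℝ

namespace State

/-- `y(ξ) = ξ + ζ(ξ)`. -/
def y (X : State) (ξ : ℝ) : ℝ := ξ + X.zeta ξ

/-- `y_ξ = 1 + ζ_ξ`. -/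
def yXi (X : State) (ξ : ℝ) : ℝ := 1 + X.zetaXi ξ

/-- `U = Ū + c χ(y)`. -/
def U (χ : ℝ → ℝ) (X : State) (ξ : ℝ) : ℝ := X.Ubar ξ + X.c * χ (X.y ξ)

/-- `X ∈ V̄ = L^∞ × E × L^∞ × E × E × E × E × L^∞`; the third and the eighth component are
constants, which always lie in `L^∞`. -/
structure MemVbar (X : State) : Prop where
  zeta : MemLp X.zeta ∞ volume
  Ubar : MemE X.Ubar
  zetaXi : MemE X.zetaXi
  UXi : MemE X.UXi
  h : MemE X.h
  rbar : MemE X.rbar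

/-- `‖X - Y‖_{V̄}`. -/
def distVbar (X Y : State) : ℝ≥0∞ :=
  eLpNorm (X.zeta - Y.zeta) ∞ volume + normE (X.Ubar - Y.Ubar) + ENNReal.ofReal |X.c - Y.c|
    + normE (X.zetaXi - Y.zetaXi) + normE (X.UXi - Y.UXi) + normE (X.h - Y.h)
    + normE (X.rbar - Y.rbar) + ENNReal.ofReal |X.k - Y.k|

/-- The fourth and fifth component are the derivatives of the functions `ζ` and `U`. -/
structure Compatible (χ : ℝ → ℝ) (X : State) : Prop where
  zeta : HasDerivAE X.zeta X.zetaXi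
  U : HasDerivAE (X.U χ) X.UXi

/-- Equality as elements of `V̄`: the functions `ζ`, `Ū` (continuous for compatible states) agree
everywhere, the other ones almost everywhere. -/
structure Same (X Y : State) : Prop where
  zeta : X.zeta = Y.zeta
  Ubar : X.Ubar = Y.Ubar
  c : X.c = Y.c
  zetaXi : X.zetaXi =ᵐ[volume] Y.zetaXi
  UXi : X.UXi =ᵐ[volume] Y.UXi
  h : X.h =ᵐ[volume] Y.h
  rbar : X.rbar =ᵐ[volume] Y.rbar
  k : X.k = Y.k

end State

/-! The function `g`, which depends only on the components `x₄, …, x₈` of `x ∈ ℝ⁸`. -/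

/-- `g₁(x) = |x₅| + 2|x₇x₈| + 2x₄`. -/
def g₁ (x₄ x₅ x₇ x₈ : ℝ) : ℝ := |x₅| + 2 * |x₇ * x₈| + 2 * x₄

/-- `g₂(x) = x₄ + x₆`. -/
def g₂ (x₄ x₆ : ℝ) : ℝ := x₄ + x₆

/-- `x ∈ Ω₁`. -/
def InOmega₁ (x₄ x₅ x₆ x₇ x₈ : ℝ) : Prop :=
  g₁ x₄ x₅ x₇ x₈ ≤ g₂ x₄ x₆ ∧ x₅ ≤ 0 ∧ x₇ + x₈ * x₄ = 0

open Classical in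
/-- `g = g₁` on `Ω₁` and `g = g₂` elsewhere. -/
def g (x₄ x₅ x₆ x₇ x₈ : ℝ) : ℝ :=
  if InOmega₁ x₄ x₅ x₆ x₇ x₈ then g₁ x₄ x₅ x₇ x₈ else g₂ x₄ x₆

/-- The set `𝒢` of Lagrangian coordinates. -/
structure MemG (χ : ℝ → ℝ) (X : State) : Prop where
  mem_Vbar : X.MemVbar
  compatible : X.Compatible χ
  g_sub_one : MemE fun ξ => g (X.yXi ξ) (X.UXi ξ) (X.h ξ) (X.rbar ξ) X.k - 1
  yXi_nonneg : ∀ᵐ ξ, 0 ≤ X.yXi ξ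
  h_nonneg : ∀ᵐ ξ, 0 ≤ X.h ξ
  tendsto_zeta : Tendsto X.zeta atBot (𝓝 0)
  /-- `1 / (y_ξ + h) ∈ L^∞`, in particular the denominator does not vanish. -/
  denom_ne_zero : ∀ᵐ ξ, X.yXi ξ + X.h ξ ≠ 0
  inv_bounded : MemLp (fun ξ => 1 / (X.yXi ξ + X.h ξ)) ∞ volume
  identity : ∀ᵐ ξ, X.yXi ξ * X.h ξ = X.UXi ξ ^ 2 + X.rbar ξ ^ 2

def G (χ : ℝ → ℝ) : Set State := {X | MemG χ X}

/-- The wave breaking time `τ(ξ)` of a curve given on `[0, T]`: the supremum of the `t ≥ 0` such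
that `y_ξ(t', ξ) > 0` for all `0 ≤ t' < t` (with `t' ≤ T`). It is `⊤` if there is no breaking on
`[0, T]`. -/
def breakingTime (T : ℝ) (X : ℝ → State) (ξ : ℝ) : EReal :=
  if (X 0).yXi ξ = 0 then 0
  else sSup ((fun t : ℝ => (t : EReal)) ''
    {t : ℝ | 0 ≤ t ∧ ∀ t' ∈ Icc 0 T, t' < t → 0 < (X t').yXi ξ})

/-- `{ξ | τ(ξ) > t}`. -/
def unbroken (T : ℝ) (X : ℝ → State) (t : ℝ) : Set ℝ :=
  {ξ | (t : EReal) < breakingTime T X ξ}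

/-- `2 c χ(y) Ū y_ξ + Ū² y_ξ + h/2 + k r̄`. -/
def source (χ : ℝ → ℝ) (X : State) (η : ℝ) : ℝ :=
  2 * X.c * χ (X.y η) * X.Ubar η * X.yXi η + X.Ubar η ^ 2 * X.yXi η + 1 / 2 * X.h η
    + X.k * X.rbar η

/-- `2 c² (χ'² + χ χ'')(y) y_ξ`. -/
def sourceAsymp (χ : ℝ → ℝ) (X : State) (η : ℝ) : ℝ :=
  2 * X.c ^ 2 * (deriv χ (X.y η) ^ 2 + χ (X.y η) * deriv (deriv χ) (X.y η)) * X.yXi η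

/-- `P(X)(t, ξ)`. -/
def P (χ : ℝ → ℝ) (T : ℝ) (X : ℝ → State) (t ξ : ℝ) : ℝ :=
  (X t).U χ ξ ^ 2 + 1 / 2 * (X t).k ^ 2
    + (-2 * (X t).c * χ ((X t).y ξ) * (X t).Ubar ξ - (X t).Ubar ξ ^ 2
      + 1 / 2 * (∫ η in unbroken T X t,
          Real.exp (-|(X t).y ξ - (X t).y η|) * source χ (X t) η)
      + 1 / 2 * (∫ η, Real.exp (-|(X t).y ξ - (X t).y η|) * sourceAsymp χ (X t) η))

/-- `Q(X)(t, ξ)`. -/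
def Q (χ : ℝ → ℝ) (T : ℝ) (X : ℝ → State) (t ξ : ℝ) : ℝ :=
  2 * (X t).c ^ 2 * χ ((X t).y ξ) * deriv χ ((X t).y ξ)
    - 1 / 2 * (∫ η in unbroken T X t,
        Real.sign (ξ - η) * Real.exp (-|(X t).y ξ - (X t).y η|) * source χ (X t) η)
    - 1 / 2 * (∫ η,
        Real.sign (ξ - η) * Real.exp (-|(X t).y ξ - (X t).y η|) * sourceAsymp χ (X t) η)

/-- `X ∈ C([0, T], V̄)`. -/
structure ContinuousCurve (T : ℝ) (X : ℝ → State) : Prop where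
  mem_Vbar : ∀ t ∈ Icc 0 T, (X t).MemVbar
  continuous : ∀ t ∈ Icc 0 T, Tendsto (fun s => (X s).distVbar (X t)) (𝓝[Icc 0 T] t) (𝓝 0)

/-- `f_t = F` on `[0, T]` in the integrated sense (the right-hand sides of the system jump). -/
def SolvesODE (T : ℝ) (f F : ℝ → ℝ) : Prop :=
  ∀ t ∈ Icc 0 T, IntervalIntegrable F volume 0 t ∧ f t = f 0 + (∫ s in (0 : ℝ)..t, F s)

/-- `X ∈ C([0, T], V̄)` is a solution of the dissipative system on `[0, T]`. -/
structure IsSolution (χ : ℝ → ℝ) (T : ℝ) (X : ℝ → State) : Prop where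
  curve : ContinuousCurve T X
  compatible : ∀ t ∈ Icc 0 T, (X t).Compatible χ
  y_eq : ∀ ξ, SolvesODE T (fun t => (X t).y ξ) (fun t => (X t).U χ ξ)
  U_eq : ∀ ξ, SolvesODE T (fun t => (X t).U χ ξ) (fun t => -Q χ T X t ξ)
  yXi_eq : ∀ᵐ ξ, SolvesODE T (fun t => (X t).yXi ξ)
    (fun t => (unbroken T X t).indicator (fun ξ => (X t).UXi ξ) ξ)
  UXi_eq : ∀ᵐ ξ, SolvesODE T (fun t => (X t).UXi ξ)
    (fun t => (unbroken T X t).indicator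
      (fun ξ => 1 / 2 * (X t).h ξ
        + ((X t).U χ ξ ^ 2 + 1 / 2 * (X t).k ^ 2 - P χ T X t ξ) * (X t).yXi ξ
        + (X t).k * (X t).rbar ξ) ξ)
  h_eq : ∀ᵐ ξ, SolvesODE T (fun t => (X t).h ξ)
    (fun t => (unbroken T X t).indicator
      (fun ξ => 2 * ((X t).U χ ξ ^ 2 + 1 / 2 * (X t).k ^ 2 - P χ T X t ξ) * (X t).UXi ξ) ξ)
  rbar_eq : ∀ᵐ ξ, SolvesODE T (fun t => (X t).rbar ξ)
    (fun t => (unbroken T X t).indicator (fun ξ => -((X t).k * (X t).UXi ξ)) ξ)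
  c_eq : SolvesODE T (fun t => (X t).c) (fun _ => 0)
  k_eq : SolvesODE T (fun t => (X t).k) (fun _ => 0)

end TwoCH

end

open MeasureTheory Set Filter Topology
open scoped ENNReal ContDiff

noncomputable section

namespace TwoCH

/-! ### Calculus of absolutely continuous functions -/

lemma absCont_congr {f g : ℝ → ℝ} {a b : ℝ} (hf : AbsolutelyContinuousOnInterval f a b)
    (h : EqOn f g (uIcc a b)) : AbsolutelyContinuousOnInterval g a b := by
  rw [absolutelyContinuousOnInterval_iff] at hf ⊢
  intro ε hε
  obtain ⟨δ, hδ, H⟩ := hf ε hε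
  refine ⟨δ, hδ, fun E hE hlt => ?_⟩
  have := H E hE hlt
  rwa [Finset.sum_congr rfl fun i hi => by rw [h (hE.1 i hi).1, h (hE.1 i hi).2]] at this

lemma absCont_comp {f φ : ℝ → ℝ} {a b : ℝ} (hf : AbsolutelyContinuousOnInterval f a b)
    (hφ : ContDiff ℝ 1 φ) : AbsolutelyContinuousOnInterval (fun x => φ (f x)) a b := by
  obtain ⟨C, hC⟩ := hf.exists_bound
  obtain ⟨K, hK⟩ := (hφ.contDiffOn (s := Icc (-C) C)).exists_lipschitzOnWith one_ne_zero
    (convex_Icc _ _) isCompact_Icc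
  have hmem : ∀ x ∈ uIcc a b, f x ∈ Icc (-C) C := fun x hx => by
    have := hC x hx
    rw [Real.norm_eq_abs, abs_le] at this
    exact this
  rw [absolutelyContinuousOnInterval_iff] at hf ⊢
  intro ε hε
  have hK0 : (0 : ℝ) < K + 1 := by positivity
  obtain ⟨δ, hδ, H⟩ := hf (ε / (K + 1)) (by positivity)
  refine ⟨δ, hδ, fun E hE hlt => ?_⟩
  have h1 := H E hE hlt
  rw [lt_div_iff₀ hK0] at h1
  refine lt_of_le_of_lt ?_ h1
  rw [Finset.sum_mul]
  refine Finset.sum_le_sum fun i hi => ?_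
  refine (hK.dist_le_mul _ (hmem _ (hE.1 i hi).1) _ (hmem _ (hE.1 i hi).2)).trans ?_
  nlinarith [dist_nonneg (x := f (E.2 i).1) (y := f (E.2 i).2)]

lemma absCont_of_primitive {f f' : ℝ → ℝ} {a b : ℝ} (hab : a ≤ b)
    (hf' : IntervalIntegrable f' volume a b)
    (h : ∀ x ∈ Icc a b, f x = f a + ∫ s in a..x, f' s) :
    AbsolutelyContinuousOnInterval f a b ∧ ∀ᵐ x, x ∈ Ioo a b → HasDerivAt f (f' x) x := by
  constructor
  · have h1 := hf'.absolutelyContinuousOnInterval_intervalIntegral (c := a) (by simp)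
    have h2 : AbsolutelyContinuousOnInterval (fun _ : ℝ => f a) a b :=
      (LipschitzWith.const (f a)).lipschitzOnWith.absolutelyContinuousOnInterval
    refine absCont_congr (h2.add h1) fun x hx => ?_
    rw [uIcc_of_le hab] at hx
    simp [h x hx]
  · filter_upwards [hf'.ae_hasDerivAt_integral] with x hx hxI
    have hx' : x ∈ uIcc a b := by rw [uIcc_of_le hab]; exact Ioo_subset_Icc_self hxI
    refine ((hx hx' a (by simp)).const_add (f a)).congr_of_eventuallyEq ?_
    filter_upwards [Ioo_mem_nhds hxI.1 hxI.2] with z hz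
    exact h z (Ioo_subset_Icc_self hz)

lemma primitive_of_absCont {f f' : ℝ → ℝ} {a b : ℝ} (hab : a ≤ b)
    (hf : AbsolutelyContinuousOnInterval f a b)
    (h : ∀ᵐ x, x ∈ Ioo a b → HasDerivAt f (f' x) x) :
    IntervalIntegrable f' volume a b ∧ f b - f a = ∫ s in a..b, f' s := by
  have hne : ∀ᵐ x : ℝ, x ≠ b := by simp [ae_iff, measure_singleton]
  have hae : ∀ᵐ x, x ∈ uIoc a b → deriv f x = f' x := by
    filter_upwards [h, hne] with x hx hxb hxI
    rw [uIoc_of_le hab] at hxI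
    exact (hx ⟨hxI.1, lt_of_le_of_ne hxI.2 hxb⟩).deriv
  refine ⟨?_, ?_⟩
  · refine hf.intervalIntegrable_deriv.congr_ae ?_
    exact (ae_restrict_iff' measurableSet_uIoc).2 hae
  · rw [← hf.integral_deriv_eq_sub]
    exact intervalIntegral.integral_congr_ae hae

namespace HasDerivAE

variable {f f' g g' φ : ℝ → ℝ}

lemma absCont (hf : HasDerivAE f f') {a b : ℝ} (hab : a ≤ b) :
    AbsolutelyContinuousOnInterval f a b ∧ ∀ᵐ x, x ∈ Ioo a b → HasDerivAt f (f' x) x :=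
  absCont_of_primitive hab (hf a b).1 fun x _ => by linarith [(hf a x).2]

lemma of_absCont (hf : ∀ a b, a ≤ b → AbsolutelyContinuousOnInterval f a b ∧
    ∀ᵐ x, x ∈ Ioo a b → HasDerivAt f (f' x) x) : HasDerivAE f f' := by
  intro a b
  rcases le_total a b with hab | hab
  · exact primitive_of_absCont hab (hf a b hab).1 (hf a b hab).2
  · have := primitive_of_absCont hab (hf b a hab).1 (hf b a hab).2
    refine ⟨this.1.symm, ?_⟩
    rw [intervalIntegral.integral_symm]
    linarith [this.2]

lemma mul (hf : HasDerivAE f f') (hg : HasDerivAE g g') :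
    HasDerivAE (fun x => f x * g x) (fun x => f' x * g x + f x * g' x) := by
  refine of_absCont fun a b hab => ⟨(hf.absCont hab).1.fun_mul (hg.absCont hab).1, ?_⟩
  filter_upwards [(hf.absCont hab).2, (hg.absCont hab).2] with x h1 h2 hx
  exact (h1 hx).mul (h2 hx)

lemma comp (hf : HasDerivAE f f') (hφ : ContDiff ℝ 1 φ) :
    HasDerivAE (fun x => φ (f x)) (fun x => deriv φ (f x) * f' x) := by
  refine of_absCont fun a b hab => ⟨absCont_comp (hf.absCont hab).1 hφ, ?_⟩
  filter_upwards [(hf.absCont hab).2] with x h1 hx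
  exact ((hφ.differentiable one_ne_zero _).hasDerivAt).comp x (h1 hx)

lemma add (hf : HasDerivAE f f') (hg : HasDerivAE g g') :
    HasDerivAE (fun x => f x + g x) (fun x => f' x + g' x) := fun a b =>
  ⟨(hf a b).1.add (hg a b).1, by
    rw [intervalIntegral.integral_add (hf a b).1 (hg a b).1, ← (hf a b).2, ← (hg a b).2]; ring⟩

lemma const_mul (c : ℝ) (hf : HasDerivAE f f') :
    HasDerivAE (fun x => c * f x) (fun x => c * f' x) := fun a b =>
  ⟨(hf a b).1.const_mul c, by
    rw [intervalIntegral.integral_const_mul, ← (hf a b).2]; ring⟩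

lemma sub (hf : HasDerivAE f f') (hg : HasDerivAE g g') :
    HasDerivAE (fun x => f x - g x) (fun x => f' x - g' x) := fun a b =>
  ⟨(hf a b).1.sub (hg a b).1, by
    rw [intervalIntegral.integral_sub (hf a b).1 (hg a b).1, ← (hf a b).2, ← (hg a b).2]; ring⟩

lemma congr (hf : HasDerivAE f f') (hfg : ∀ x, f x = g x) (h : f' =ᵐ[volume] g') :
    HasDerivAE g g' := fun a b => by
  refine ⟨(hf a b).1.congr_ae (ae_restrict_of_ae h), ?_⟩
  rw [← hfg, ← hfg, (hf a b).2]
  exact intervalIntegral.integral_congr_ae (by filter_upwards [h] with x hx _ using hx)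

lemma id_one : HasDerivAE (fun x => x) (fun _ => 1) := fun a b =>
  ⟨intervalIntegrable_const, by simp⟩

lemma continuous (hf : HasDerivAE f f') : Continuous f := by
  have h : f = fun x => f 0 + ∫ s in (0 : ℝ)..x, f' s := by
    funext x
    linarith [(hf 0 x).2]
  rw [h]
  exact continuous_const.add
    (intervalIntegral.continuous_primitive (fun a b => (hf a b).1) 0)

lemma abs_sub_le (hf : HasDerivAE f f') {C : ℝ} (hC : ∀ᵐ x, |f' x| ≤ C) (a b : ℝ) :
    |f b - f a| ≤ C * |b - a| := by
  rw [(hf a b).2]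
  exact intervalIntegral.norm_integral_le_of_norm_le_const_ae (f := f') (C := C)
    (by filter_upwards [hC] with x hx _ using hx)

end HasDerivAE

namespace SolvesODE

variable {T : ℝ} {f F g G φ : ℝ → ℝ}

lemma absCont (hf : SolvesODE T f F) {t : ℝ} (ht : t ∈ Icc 0 T) :
    AbsolutelyContinuousOnInterval f 0 t ∧ ∀ᵐ x, x ∈ Ioo 0 t → HasDerivAt f (F x) x :=
  absCont_of_primitive ht.1 (hf t ht).1 fun x hx => (hf x ⟨hx.1, hx.2.trans ht.2⟩).2

lemma of_absCont (hf : ∀ t ∈ Icc 0 T, AbsolutelyContinuousOnInterval f 0 t ∧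
    ∀ᵐ x, x ∈ Ioo 0 t → HasDerivAt f (F x) x) : SolvesODE T f F := fun t ht => by
  have := primitive_of_absCont ht.1 (hf t ht).1 (hf t ht).2
  exact ⟨this.1, by linarith [this.2]⟩

lemma mul (hf : SolvesODE T f F) (hg : SolvesODE T g G) :
    SolvesODE T (fun x => f x * g x) (fun x => F x * g x + f x * G x) := by
  refine of_absCont fun t ht => ⟨(hf.absCont ht).1.fun_mul (hg.absCont ht).1, ?_⟩
  filter_upwards [(hf.absCont ht).2, (hg.absCont ht).2] with x h1 h2 hx
  exact (h1 hx).mul (h2 hx)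

lemma add (hf : SolvesODE T f F) (hg : SolvesODE T g G) :
    SolvesODE T (fun x => f x + g x) (fun x => F x + G x) := fun t ht =>
  ⟨(hf t ht).1.add (hg t ht).1, by
    beta_reduce
    rw [intervalIntegral.integral_add (hf t ht).1 (hg t ht).1, (hf t ht).2, (hg t ht).2]; ring⟩

lemma sub (hf : SolvesODE T f F) (hg : SolvesODE T g G) :
    SolvesODE T (fun x => f x - g x) (fun x => F x - G x) := fun t ht =>
  ⟨(hf t ht).1.sub (hg t ht).1, by
    beta_reduce
    rw [intervalIntegral.integral_sub (hf t ht).1 (hg t ht).1, (hf t ht).2, (hg t ht).2]; ring⟩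

lemma const_mul (c : ℝ) (hf : SolvesODE T f F) :
    SolvesODE T (fun x => c * f x) (fun x => c * F x) := fun t ht =>
  ⟨(hf t ht).1.const_mul c, by
    beta_reduce
    rw [intervalIntegral.integral_const_mul, (hf t ht).2]; ring⟩

lemma congr (hf : SolvesODE T f F) (hfg : ∀ t ∈ Icc 0 T, f t = g t)
    (h : ∀ t ∈ Icc 0 T, F t = G t) : SolvesODE T g G := fun t ht => by
  have hE : EqOn F G (uIoc 0 t) := fun x hx => by
    rw [uIoc_of_le ht.1] at hx
    exact h x ⟨hx.1.le, hx.2.trans ht.2⟩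
  refine ⟨(hf t ht).1.congr hE, ?_⟩
  rw [← hfg t ht, ← hfg 0 ⟨le_rfl, ht.1.trans ht.2⟩, (hf t ht).2]
  exact congrArg _ (intervalIntegral.integral_congr_ae (Eventually.of_forall hE))

lemma continuousOn (hf : SolvesODE T f F) : ContinuousOn f (Icc 0 T) := by
  rcases le_or_gt 0 T with hT | hT
  · have := (hf.absCont (t := T) ⟨hT, le_rfl⟩).1.continuousOn
    rwa [uIcc_of_le hT] at this
  · simp [Icc_eq_empty (not_le.2 hT)]

lemma sub_eq (hf : SolvesODE T f F) {s t : ℝ} (hs : s ∈ Icc 0 T) (ht : t ∈ Icc 0 T) :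
    f t - f s = ∫ x in s..t, F x := by
  rw [(hf t ht).2, (hf s hs).2,
    ← intervalIntegral.integral_interval_sub_left (hf t ht).1 (hf s hs).1]
  ring

lemma const_of_zero (hf : SolvesODE T f F) (h : ∀ t ∈ Icc 0 T, F t = 0) :
    ∀ t ∈ Icc 0 T, f t = f 0 := fun t ht => by
  rw [(hf t ht).2, intervalIntegral.integral_congr (g := fun _ => 0)]
  · simp
  · intro x hx
    rw [uIcc_of_le ht.1] at hx
    exact h x ⟨hx.1, hx.2.trans ht.2⟩

end SolvesODE

/-- A solution stays constant on intervals where its right-hand side vanishes. -/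
lemma SolvesODE.eq_of_zero {T : ℝ} {f F : ℝ → ℝ} (hf : SolvesODE T f F) {s t : ℝ}
    (hs : s ∈ Icc 0 T) (ht : t ∈ Icc 0 T) (hst : s ≤ t) (h : ∀ x ∈ Ioc s t, F x = 0) :
    f t = f s := by
  have h1 := hf.sub_eq hs ht
  rw [intervalIntegral.integral_of_le hst, setIntegral_congr_fun measurableSet_Ioc h] at h1
  simp at h1
  linarith

/-! ### Exponential kernels -/

lemma integrable_exp_neg_mul_abs {a : ℝ} (ha : 0 < a) :
    Integrable fun x : ℝ => Real.exp (-(a * |x|)) := by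
  have h1 : IntegrableOn (fun x : ℝ => Real.exp (-(a * |x|))) (Ioi 0) := by
    refine (integrableOn_exp_mul_Ioi (a := -a) (by linarith) 0).congr_fun (fun x hx => ?_)
      measurableSet_Ioi
    simp only [abs_of_pos (mem_Ioi.1 hx), neg_mul]
  have h2 : IntegrableOn (fun x : ℝ => Real.exp (-(a * |x|))) (Iic 0) := by
    refine (integrableOn_exp_mul_Iic (a := a) ha 0).congr_fun (fun x hx => ?_)
      measurableSet_Iic
    simp only [abs_of_nonpos (mem_Iic.1 hx), mul_neg, neg_neg]
  have := h2.union h1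
  rwa [Iic_union_Ioi, integrableOn_univ] at this

lemma integrable_exp_neg_mul_abs_sub {a : ℝ} (ha : 0 < a) (ξ : ℝ) :
    Integrable fun η : ℝ => Real.exp (-(a * |ξ - η|)) :=
  (integrable_exp_neg_mul_abs ha).comp_sub_left ξ

lemma integral_exp_neg_mul_abs_sub (a ξ : ℝ) :
    ∫ η : ℝ, Real.exp (-(a * |ξ - η|)) = ∫ x : ℝ, Real.exp (-(a * |x|)) :=
  integral_sub_left_eq_self (fun x => Real.exp (-(a * |x|))) volume ξ

/-- The kernel `e^{-a|x|}` with values in `[0, ∞]`. -/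
def expKernel (a x : ℝ) : ℝ≥0∞ := ENNReal.ofReal (Real.exp (-(a * |x|)))

lemma measurable_expKernel (a : ℝ) : Measurable (expKernel a) := by
  unfold expKernel
  fun_prop

lemma lintegral_expKernel_sub (a ξ : ℝ) :
    ∫⁻ η, expKernel a (ξ - η) = ∫⁻ x, expKernel a x :=
  lintegral_sub_left_eq_self (expKernel a) ξ

lemma lintegral_expKernel_lt_top {a : ℝ} (ha : 0 < a) : ∫⁻ x, expKernel a x < ⊤ := by
  unfold expKernel
  rw [← ofReal_integral_eq_lintegral_ofReal (integrable_exp_neg_mul_abs ha)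
    (Eventually.of_forall fun x => (Real.exp_pos _).le)]
  exact ENNReal.ofReal_lt_top

/-- Convolution with `e^{-a|x|}`. -/
def expConv (a : ℝ) (f : ℝ → ℝ≥0∞) (ξ : ℝ) : ℝ≥0∞ := ∫⁻ η, expKernel a (ξ - η) * f η

lemma measurable_expConv (a : ℝ) {f : ℝ → ℝ≥0∞} (hf : Measurable f) :
    Measurable (expConv a f) := by
  unfold expConv
  refine Measurable.lintegral_prod_right' (f := fun p : ℝ × ℝ => expKernel a (p.1 - p.2) * f p.2) ?_
  exact ((measurable_expKernel a).comp (measurable_fst.sub measurable_snd)).mul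
    (hf.comp measurable_snd)

lemma expConv_mono_kernel {a b : ℝ} (hab : b ≤ a) (f : ℝ → ℝ≥0∞) (ξ : ℝ) :
    expConv a f ξ ≤ expConv b f ξ := by
  refine lintegral_mono fun η => mul_le_mul_left ?_ _
  refine ENNReal.ofReal_le_ofReal (Real.exp_le_exp.2 (neg_le_neg ?_))
  exact mul_le_mul_of_nonneg_right hab (abs_nonneg _)

lemma expConv_le_const {a : ℝ} {f : ℝ → ℝ≥0∞} {B : ℝ≥0∞} (hf : ∀ x, f x ≤ B) (ξ : ℝ) :
    expConv a f ξ ≤ (∫⁻ x, expKernel a x) * B := by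
  rw [← lintegral_expKernel_sub a ξ, ← lintegral_mul_const]
  · exact lintegral_mono fun η => mul_le_mul_right (hf η) _
  · exact (measurable_expKernel a).comp (measurable_const.sub measurable_id)

lemma expConv_sq_le {a : ℝ} {f : ℝ → ℝ≥0∞} (hf : Measurable f) (ξ : ℝ) :
    expConv a f ξ ^ 2 ≤ (∫⁻ x, expKernel a x) * expConv a (fun x => f x ^ 2) ξ := by
  have hk : Measurable fun η => expKernel (a / 2) (ξ - η) :=
    (measurable_expKernel _).comp (measurable_const.sub measurable_id)
  have hsq : ∀ x, expKernel (a / 2) x ^ 2 = expKernel a x := fun x => by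
    unfold expKernel
    rw [← ENNReal.ofReal_pow (Real.exp_pos _).le, ← Real.exp_nat_mul]
    congr 2
    push_cast
    ring
  have h := ENNReal.lintegral_mul_le_Lp_mul_Lq volume (p := 2) (q := 2)
    (Real.HolderConjugate.two_two) hk.aemeasurable (hk.mul hf).aemeasurable
  simp only [Pi.mul_apply, ENNReal.rpow_two] at h
  have e1 : ∀ η, expKernel (a / 2) (ξ - η) * (expKernel (a / 2) (ξ - η) * f η)
      = expKernel a (ξ - η) * f η := fun η => by rw [← hsq]; ring
  have e2 : ∀ η, (expKernel (a / 2) (ξ - η) * f η) ^ 2 = expKernel a (ξ - η) * f η ^ 2 :=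
    fun η => by rw [mul_pow, hsq]
  simp only [e1, e2, hsq] at h
  rw [lintegral_expKernel_sub] at h
  change expConv a f ξ ≤ _ * (expConv a (fun x => f x ^ 2) ξ) ^ _ at h
  calc expConv a f ξ ^ 2 ≤ (_) ^ 2 := pow_le_pow_left' h 2
    _ = _ := by
      rw [mul_pow, ← ENNReal.rpow_two, ← ENNReal.rpow_two, ← ENNReal.rpow_mul, ← ENNReal.rpow_mul]
      norm_num

lemma lintegral_expConv {a : ℝ} {f : ℝ → ℝ≥0∞} (hf : Measurable f) :
    ∫⁻ ξ, expConv a f ξ = (∫⁻ x, expKernel a x) * ∫⁻ x, f x := by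
  unfold expConv
  rw [lintegral_lintegral_swap]
  · have : ∀ η, ∫⁻ ξ, expKernel a (ξ - η) * f η = (∫⁻ x, expKernel a x) * f η := fun η => by
      have hm : Measurable fun ξ => expKernel a (ξ - η) :=
        (measurable_expKernel a).comp (measurable_id.sub_const η)
      rw [lintegral_mul_const _ hm]
      rw [lintegral_sub_right_eq_self (expKernel a) η]
    simp only [this]
    rw [lintegral_const_mul _ hf]
  · exact (((measurable_expKernel a).comp (measurable_fst.sub measurable_snd)).mul
      (hf.comp measurable_snd)).aemeasurable

lemma expConv_expConv_le {f : ℝ → ℝ≥0∞} (hf : Measurable f) (ξ : ℝ) :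
    expConv (1 / 2) (expConv (1 / 4) f) ξ ≤ (∫⁻ x, expKernel (1 / 4) x) * expConv (1 / 4) f ξ := by
  have hm : Measurable fun p : ℝ × ℝ =>
      expKernel (1 / 2) (ξ - p.1) * (expKernel (1 / 4) (p.1 - p.2) * f p.2) :=
    ((measurable_expKernel _).comp (measurable_const.sub measurable_fst)).mul
      (((measurable_expKernel _).comp (measurable_fst.sub measurable_snd)).mul
        (hf.comp measurable_snd))
  have h1 : expConv (1 / 2) (expConv (1 / 4) f) ξ
      = ∫⁻ ζ, ∫⁻ η, expKernel (1 / 2) (ξ - η) * (expKernel (1 / 4) (η - ζ) * f ζ) := by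
    rw [← lintegral_lintegral_swap hm.aemeasurable]
    refine lintegral_congr fun η => ?_
    rw [lintegral_const_mul]
    · rfl
    · exact ((measurable_expKernel _).comp (measurable_const.sub measurable_id)).mul hf
  rw [h1]
  unfold expConv
  rw [← lintegral_const_mul]
  · refine lintegral_mono fun ζ => ?_
    rw [← lintegral_expKernel_sub _ ξ, ← lintegral_mul_const]
    · refine lintegral_mono fun η => ?_
      rw [← mul_assoc, ← mul_assoc]
      refine mul_le_mul_left ?_ _
      unfold expKernel
      rw [← ENNReal.ofReal_mul (Real.exp_pos _).le, ← ENNReal.ofReal_mul (Real.exp_pos _).le,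
        ← Real.exp_add, ← Real.exp_add]
      refine ENNReal.ofReal_le_ofReal (Real.exp_le_exp.2 ?_)
      have := abs_sub_le ξ η ζ
      linarith
    · exact (measurable_expKernel _).comp (measurable_const.sub measurable_id)
  · exact ((measurable_expKernel _).comp (measurable_const.sub measurable_id)).mul hf

/-- A bounded weight `m` that controls its convolution with `e^{-|x|/2}`. -/
structure Envelope (m : ℝ → ℝ) (B C : ℝ) : Prop where
  measurable : Measurable m
  nonneg : ∀ ξ, 0 ≤ m ξ
  le_bound : ∀ ξ, m ξ ≤ B
  conv_le : ∀ ξ, ∫ η, Real.exp (-(1 / 2 * |ξ - η|)) * m η ≤ C * m ξ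

namespace Envelope

lemma const {B : ℝ} (hB : 0 ≤ B) :
    Envelope (fun _ => B) B (∫ x : ℝ, Real.exp (-(1 / 2 * |x|))) where
  measurable := measurable_const
  nonneg _ := hB
  le_bound _ := le_rfl
  conv_le ξ := by rw [integral_mul_const, integral_exp_neg_mul_abs_sub]

variable {m : ℝ → ℝ} {B C : ℝ}

lemma integrable (hm : Envelope m B C) (ξ : ℝ) :
    Integrable fun η => Real.exp (-(1 / 2 * |ξ - η|)) * m η := by
  refine (integrable_exp_neg_mul_abs_sub (a := 1 / 2) (by norm_num) ξ).mul_bdd (c := B)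
    hm.measurable.aestronglyMeasurable (Eventually.of_forall fun η => ?_)
  rw [Real.norm_of_nonneg (hm.nonneg η)]
  exact hm.le_bound η

end Envelope

/-- Every nonnegative bounded square integrable function lies below a square integrable
envelope. -/
lemma exists_envelope {m₀ : ℝ → ℝ} {B : ℝ} (hm : Measurable m₀) (h0 : ∀ ξ, 0 ≤ m₀ ξ)
    (hB : ∀ ξ, m₀ ξ ≤ B) (h2 : MemLp m₀ 2 volume) :
    ∃ m : ℝ → ℝ, ∃ B' C : ℝ, Envelope m B' C ∧ (∀ ξ, m₀ ξ ≤ m ξ) ∧ MemLp m 2 volume := by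
  set f : ℝ → ℝ≥0∞ := fun x => ENNReal.ofReal (m₀ x) with hf
  have hfm : Measurable f := hm.ennreal_ofReal
  set Λ := ∫⁻ x, expKernel (1 / 4) x with hΛ
  have hΛt : Λ < ⊤ := lintegral_expKernel_lt_top (by norm_num)
  have hbd : ∀ ξ, expConv (1 / 4) f ξ ≤ Λ * ENNReal.ofReal B := fun ξ =>
    expConv_le_const (fun x => ENNReal.ofReal_le_ofReal (hB x)) ξ
  have hBt : Λ * ENNReal.ofReal B < ⊤ := ENNReal.mul_lt_top hΛt ENNReal.ofReal_lt_top
  have hfin : ∀ ξ, expConv (1 / 4) f ξ ≠ ⊤ := fun ξ => ((hbd ξ).trans_lt hBt).ne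
  set n : ℝ → ℝ≥0∞ := fun ξ => f ξ + expConv (1 / 4) f ξ with hn
  have hnm : Measurable n := hfm.add (measurable_expConv _ hfm)
  have hnfin : ∀ ξ, n ξ ≠ ⊤ := fun ξ => ENNReal.add_ne_top.2 ⟨ENNReal.ofReal_ne_top, hfin ξ⟩
  have hconv : ∀ ξ, expConv (1 / 2) n ξ ≤ (1 + Λ) * n ξ := fun ξ => by
    have : expConv (1 / 2) n ξ
        = expConv (1 / 2) f ξ + expConv (1 / 2) (expConv (1 / 4) f) ξ := by
      unfold expConv
      rw [← lintegral_add_left]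
      · refine lintegral_congr fun η => ?_
        simp only [hn, mul_add]
        rfl
      · exact ((measurable_expKernel _).comp (measurable_const.sub measurable_id)).mul hfm
    rw [this]
    calc _ ≤ expConv (1 / 4) f ξ + Λ * expConv (1 / 4) f ξ :=
          add_le_add (expConv_mono_kernel (by norm_num) f ξ) (expConv_expConv_le hfm ξ)
      _ = (1 + Λ) * expConv (1 / 4) f ξ := by ring
      _ ≤ (1 + Λ) * n ξ := mul_le_mul_right le_add_self _
  have hf2 : ∫⁻ x, f x ^ 2 < ⊤ := by
    have := (memLp_two_iff_integrable_sq_norm hm.aestronglyMeasurable).1 h2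
    have h3 := this.lintegral_lt_top
    refine lt_of_le_of_lt (lintegral_mono fun x => ?_) h3
    simp only [hf, Real.norm_eq_abs, sq_abs]
    rw [ENNReal.ofReal_pow (h0 x)]
  have hn2 : ∫⁻ x, n x ^ 2 < ⊤ := by
    have hle : ∀ x, n x ^ 2 ≤ 2 * f x ^ 2 + 2 * (Λ * expConv (1 / 4) (fun x => f x ^ 2) x) :=
      fun x => by
        have h1 : n x ^ 2 ≤ 2 * f x ^ 2 + 2 * expConv (1 / 4) f x ^ 2 := by
          have ha : f x ≠ ⊤ := ENNReal.ofReal_ne_top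
          have hb := hfin x
          simp only [hn]
          lift f x to NNReal using ha with u
          lift expConv (1 / 4) f x to NNReal using hb with v
          norm_cast
          have : ((u + v : NNReal) : ℝ) ^ 2 ≤ 2 * (u : ℝ) ^ 2 + 2 * (v : ℝ) ^ 2 := by
            push_cast
            nlinarith [sq_nonneg ((u : ℝ) - v)]
          exact_mod_cast this
        refine h1.trans (add_le_add le_rfl (mul_le_mul_right (expConv_sq_le hfm x) _))
    refine lt_of_le_of_lt (lintegral_mono hle) ?_
    rw [lintegral_add_left ((hfm.pow_const 2).const_mul 2),
      lintegral_const_mul _ (hfm.pow_const 2), lintegral_const_mul, lintegral_const_mul,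
      lintegral_expConv (hfm.pow_const 2)]
    · refine ENNReal.add_lt_top.2 ⟨ENNReal.mul_lt_top (by simp) hf2, ?_⟩
      exact ENNReal.mul_lt_top (by simp) (ENNReal.mul_lt_top hΛt (ENNReal.mul_lt_top hΛt hf2))
    · exact measurable_expConv _ (hfm.pow_const 2)
    · exact (measurable_expConv _ (hfm.pow_const 2)).const_mul _
  have hnB : ∀ ξ, n ξ ≤ ENNReal.ofReal B + Λ * ENNReal.ofReal B := fun ξ =>
    add_le_add (ENNReal.ofReal_le_ofReal (hB ξ)) (hbd ξ)
  have hBt' : ENNReal.ofReal B + Λ * ENNReal.ofReal B ≠ ⊤ :=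
    ENNReal.add_ne_top.2 ⟨ENNReal.ofReal_ne_top, hBt.ne⟩
  refine ⟨fun ξ => (n ξ).toReal, (ENNReal.ofReal B + Λ * ENNReal.ofReal B).toReal,
    (1 + Λ).toReal, ⟨hnm.ennreal_toReal, fun _ => ENNReal.toReal_nonneg,
    fun ξ => ENNReal.toReal_mono hBt' (hnB ξ), fun ξ => ?_⟩, fun ξ => ?_, ?_⟩
  · rw [integral_eq_lintegral_of_nonneg_ae
      (Eventually.of_forall fun η => mul_nonneg (Real.exp_pos _).le ENNReal.toReal_nonneg)]
    · rw [← ENNReal.toReal_mul]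
      refine ENNReal.toReal_mono (ENNReal.mul_ne_top
        (ENNReal.add_ne_top.2 ⟨ENNReal.one_ne_top, hΛt.ne⟩) (hnfin ξ)) ?_
      refine le_trans (le_of_eq (lintegral_congr fun η => ?_)) (hconv ξ)
      rw [ENNReal.ofReal_mul (Real.exp_pos _).le, ENNReal.ofReal_toReal (hnfin η)]
      rfl
    · exact (Measurable.mul (by fun_prop) hnm.ennreal_toReal).aestronglyMeasurable
  · have : (f ξ).toReal ≤ (n ξ).toReal := ENNReal.toReal_mono (hnfin ξ) le_self_add
    rwa [hf, ENNReal.toReal_ofReal (h0 ξ)] at this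
  · rw [memLp_two_iff_integrable_sq_norm hnm.ennreal_toReal.aestronglyMeasurable]
    refine ⟨(hnm.ennreal_toReal.norm.pow_const 2).aestronglyMeasurable, ?_⟩
    rw [hasFiniteIntegral_iff_enorm]
    refine lt_of_eq_of_lt (lintegral_congr fun x => ?_) hn2
    rw [Real.enorm_eq_ofReal (by positivity), Real.norm_of_nonneg ENNReal.toReal_nonneg,
      ENNReal.ofReal_pow ENNReal.toReal_nonneg, ENNReal.ofReal_toReal (hnfin x)]

/-! ### Decay of Lipschitz square integrable functions -/

lemma tendsto_zero_atBot_of_lipschitz {f : ℝ → ℝ} {C : ℝ} (hC : 0 < C)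
    (hf : ∀ a b, |f b - f a| ≤ C * |b - a|) (h2 : MemLp f 2 volume) :
    Tendsto f atBot (𝓝 0) := by
  have hint := (memLp_two_iff_integrable_sq_norm h2.1).1 h2
  rw [Metric.tendsto_nhds]
  intro ε hε
  set δ := ε / (2 * C) with hδ
  have hδ0 : 0 < δ := by positivity
  have htail : Tendsto (fun x : ℝ => ∫ y in Iic x, ‖f y‖ ^ 2) atBot (𝓝 0) :=
    tendsto_integral_Iic_zero tendsto_id
  have hev := (Metric.tendsto_nhds.1 htail) ((ε / 2) ^ 2 * δ) (by positivity)
  filter_upwards [hev] with x hx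
  rw [dist_zero_right, Real.norm_eq_abs]
  by_contra! hge
  rw [dist_zero_right, Real.norm_eq_abs, abs_lt] at hx
  have h1 : ∫ y in Ioc (x - δ) x, (ε / 2) ^ 2 ≤ ∫ y in Ioc (x - δ) x, ‖f y‖ ^ 2 := by
    refine setIntegral_mono_on (by simp) hint.integrableOn measurableSet_Ioc fun y hy => ?_
    refine pow_le_pow_left₀ (by positivity) ?_ 2
    have h3 := hf x y
    have h4 : C * |y - x| ≤ ε / 2 := by
      have : |y - x| ≤ δ := by rw [abs_le]; constructor <;> linarith [hy.1, hy.2]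
      calc C * |y - x| ≤ C * δ := mul_le_mul_of_nonneg_left this hC.le
        _ = ε / 2 := by rw [hδ]; field_simp
    rw [Real.norm_eq_abs]
    have := abs_sub_abs_le_abs_sub (f x) (f y)
    rw [abs_sub_comm] at h3
    linarith
  have h2 : ∫ y in Ioc (x - δ) x, ‖f y‖ ^ 2 ≤ ∫ y in Iic x, ‖f y‖ ^ 2 :=
    setIntegral_mono_set hint.integrableOn (Eventually.of_forall fun y => by positivity)
      (Eventually.of_forall fun y hy => hy.2)
  have h5 : ∫ y in Ioc (x - δ) x, (ε / 2) ^ 2 = (ε / 2) ^ 2 * δ := by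
    simp [hδ0.le, mul_comm]
  linarith [hx.2]

/-! ### Fixed points -/

/-- A nonnegative quantity with the self-improving bound `P d → P (d / 2)` vanishes. -/
lemma le_zero_of_halving {P : ℝ → Prop} {d₀ x : ℝ} (h0 : P d₀) (hP : ∀ d, P d → P (d / 2))
    (hx : ∀ d, P d → x ≤ d) : x ≤ 0 := by
  have h : ∀ n : ℕ, P (d₀ * (1 / 2) ^ n) := fun n => by
    induction n with
    | zero => simpa using h0
    | succ n ih => convert hP _ ih using 1; ring
  have h1 : Tendsto (fun n : ℕ => d₀ * (1 / 2 : ℝ) ^ n) atTop (𝓝 (d₀ * 0)) :=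
    (tendsto_pow_atTop_nhds_zero_of_lt_one (by norm_num) (by norm_num)).const_mul _
  rw [mul_zero] at h1
  exact ge_of_tendsto' h1 fun n => hx _ (h n)

/-- The contraction principle for maps on a set of functions with the uniform distance. -/
lemma exists_fixedPoint {α E : Type*} [MetricSpace E] [CompleteSpace E]
    (K : Set (α → E)) (Φ : (α → E) → α → E) (z₀ : α → E) (hz₀ : z₀ ∈ K)
    (hmaps : ∀ z ∈ K, Φ z ∈ K)
    (hclosed : ∀ (u : ℕ → α → E) (z : α → E), (∀ n, u n ∈ K) →
      (∀ a, Tendsto (fun n => u n a) atTop (𝓝 (z a))) → z ∈ K)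
    (D : ℝ) (hD : ∀ a, dist (z₀ a) (Φ z₀ a) ≤ D)
    (hcontr : ∀ z ∈ K, ∀ w ∈ K, ∀ d, (∀ a, dist (z a) (w a) ≤ d) →
      ∀ a, dist (Φ z a) (Φ w a) ≤ d / 2) :
    ∃ z ∈ K, Φ z = z := by
  set u : ℕ → α → E := fun n => Φ^[n] z₀ with hu
  have huK : ∀ n, u n ∈ K := fun n => by
    induction n with
    | zero => exact hz₀
    | succ n ih => simp only [hu, Function.iterate_succ_apply']; exact hmaps _ ih
  have hsucc : ∀ n, u (n + 1) = Φ (u n) := fun n => Function.iterate_succ_apply' _ _ _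
  have hdist : ∀ n a, dist (u n a) (u (n + 1) a) ≤ 2 * D / 2 / 2 ^ n := fun n => by
    induction n with
    | zero => intro a; simpa [hu] using hD a
    | succ n ih =>
      intro a
      rw [hsucc n, hsucc (n + 1)]
      refine (hcontr _ (huK n) _ (huK (n + 1)) _ ih a).trans (le_of_eq ?_)
      rw [pow_succ]
      ring
  have hlim : ∀ a, ∃ l, Tendsto (fun n => u n a) atTop (𝓝 l) := fun a =>
    cauchySeq_tendsto_of_complete (cauchySeq_of_le_geometric_two fun n => hdist n a)
  choose z hz using hlim
  have hzK := hclosed u z huK hz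
  refine ⟨z, hzK, funext fun a => ?_⟩
  have hclose : ∀ n a, dist (u n a) (z a) ≤ 2 * D / 2 ^ n := fun n a =>
    dist_le_of_le_geometric_two_of_tendsto (fun n => hdist n a) (hz a) n
  have h1 : ∀ n, dist (u (n + 1) a) (Φ z a) ≤ 2 * D / 2 ^ n / 2 := fun n => by
    rw [hsucc]
    exact hcontr _ (huK n) _ hzK _ (hclose n) a
  have h2 : Tendsto (fun n : ℕ => 2 * D / 2 ^ n / 2) atTop (𝓝 0) := by
    have h3 : Tendsto (fun n : ℕ => D * (1 / 2 : ℝ) ^ n) atTop (𝓝 (D * 0)) :=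
      (tendsto_pow_atTop_nhds_zero_of_lt_one (by norm_num) (by norm_num)).const_mul _
    rw [mul_zero] at h3
    refine h3.congr fun n => ?_
    rw [one_div, inv_pow]
    ring
  have h4 : Tendsto (fun n => u (n + 1) a) atTop (𝓝 (Φ z a)) :=
    tendsto_iff_dist_tendsto_zero.2 (squeeze_zero (fun _ => dist_nonneg) h1 h2)
  exact tendsto_nhds_unique h4 ((hz a).comp (tendsto_add_atTop_nat 1))

/-! ### Bounded Lipschitz functions -/

/-- Bounded Lipschitz functions on the line. -/
def BddLip (φ : ℝ → ℝ) : Prop :=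
  ∃ C, 0 ≤ C ∧ (∀ x, |φ x| ≤ C) ∧ ∀ x y, |φ x - φ y| ≤ C * |x - y|

lemma BddLip.of_support {φ : ℝ → ℝ} (hφ : ContDiff ℝ 1 φ) (hs : ∀ x, x ∉ Icc (0 : ℝ) 1 → φ x = 0) :
    BddLip φ := by
  have hc : HasCompactSupport φ := HasCompactSupport.intro isCompact_Icc hs
  obtain ⟨C, hC⟩ := hφ.lipschitzWith_of_hasCompactSupport hc one_ne_zero
  obtain ⟨B, hB⟩ := hc.exists_bound_of_continuous hφ.continuous
  refine ⟨max C B, le_max_of_le_left C.2, fun x => (hB x).trans (le_max_right _ _), fun x y => ?_⟩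
  have := hC.dist_le_mul x y
  rw [Real.dist_eq, Real.dist_eq] at this
  exact this.trans (mul_le_mul_of_nonneg_right (le_max_left _ _) (abs_nonneg _))

namespace IsPartitionFunction

variable {χ : ℝ → ℝ} (hχ : IsPartitionFunction χ)

include hχ

lemma eq_zero {x : ℝ} (hx : x < 0) : χ x = 0 := by
  by_contra h
  exact absurd (hχ.support_subset h) (not_le.2 hx)

lemma deriv_eq_zero {x : ℝ} (hx : x ∉ Icc (0 : ℝ) 1) : deriv χ x = 0 := by
  rw [mem_Icc, not_and_or, not_le, not_le] at hx
  rcases hx with hx | hx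
  · have : χ =ᶠ[𝓝 x] fun _ => 0 := by
      filter_upwards [Iio_mem_nhds hx] with y hy using hχ.eq_zero hy
    rw [this.deriv_eq, deriv_const]
  · have : χ =ᶠ[𝓝 x] fun _ => 1 := by
      filter_upwards [Ioi_mem_nhds hx] with y hy using hχ.eq_one y (le_of_lt hy)
    rw [this.deriv_eq, deriv_const]

lemma differentiable : Differentiable ℝ χ := hχ.smooth.differentiable (by simp)

lemma contDiff_deriv : ContDiff ℝ ∞ (deriv χ) :=
  (contDiff_infty_iff_deriv.1 hχ.smooth).2

lemma contDiff_deriv_deriv : ContDiff ℝ ∞ (deriv (deriv χ)) :=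
  (contDiff_infty_iff_deriv.1 hχ.contDiff_deriv).2

lemma mono : Monotone χ := monotone_of_deriv_nonneg hχ.differentiable hχ.deriv_nonneg

lemma nonneg (x : ℝ) : 0 ≤ χ x := by
  have h1 : χ (min x (-1)) = 0 := hχ.eq_zero (by linarith [min_le_right x (-1)])
  rw [← h1]
  exact hχ.mono (min_le_left _ _)

lemma le_one (x : ℝ) : χ x ≤ 1 := by
  rw [← hχ.eq_one (max x 1) (le_max_right _ _)]
  exact hχ.mono (le_max_left _ _)

lemma bddLip_deriv : BddLip (deriv χ) :=
  .of_support (hχ.contDiff_deriv.of_le (by simp)) fun _ hx => hχ.deriv_eq_zero hx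

lemma bddLip : BddLip χ := by
  obtain ⟨C, hC0, hC, -⟩ := hχ.bddLip_deriv
  refine ⟨max C 1, le_max_of_le_right zero_le_one, fun x => ?_, fun x y => ?_⟩
  · rw [abs_of_nonneg (hχ.nonneg x)]
    exact (hχ.le_one x).trans (le_max_right _ _)
  · have := Convex.norm_image_sub_le_of_norm_deriv_le (s := univ) (f := χ) (C := C) (x := y) (y := x)
      (fun z _ => hχ.differentiable z) (fun z _ => hC z) convex_univ trivial trivial
    exact this.trans (mul_le_mul_of_nonneg_right (le_max_left _ _) (abs_nonneg _))

lemma contDiff_flux : ContDiff ℝ 1 fun x => χ x * deriv χ x :=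
  (hχ.smooth.mul hχ.contDiff_deriv).of_le (by simp)

lemma deriv_flux (x : ℝ) :
    deriv (fun x => χ x * deriv χ x) x = deriv χ x ^ 2 + χ x * deriv (deriv χ) x := by
  have h2 : DifferentiableAt ℝ (deriv χ) x := (hχ.contDiff_deriv.differentiable (by simp)) x
  have := ((hχ.differentiable x).hasDerivAt.mul h2.hasDerivAt).deriv
  rw [sq]
  exact this

lemma bddLip_flux : BddLip fun x => χ x * deriv χ x :=
  .of_support hχ.contDiff_flux fun x hx => by simp [hχ.deriv_eq_zero hx]

lemma contDiff_deriv_flux : ContDiff ℝ ∞ fun x => deriv χ x ^ 2 + χ x * deriv (deriv χ) x :=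
  (hχ.contDiff_deriv.pow 2).add (hχ.smooth.mul hχ.contDiff_deriv_deriv)

lemma deriv_flux_eq_zero {x : ℝ} (hx : x ∉ Icc (0 : ℝ) 1) :
    deriv χ x ^ 2 + χ x * deriv (deriv χ) x = 0 := by
  have h : deriv (deriv χ) x = 0 := by
    have : deriv χ =ᶠ[𝓝 x] fun _ => 0 := by
      filter_upwards [isClosed_Icc.isOpen_compl.mem_nhds hx] with y hy using hχ.deriv_eq_zero hy
    rw [this.deriv_eq, deriv_const]
  rw [hχ.deriv_eq_zero hx, h]
  ring

lemma bddLip_deriv_flux : BddLip fun x => deriv χ x ^ 2 + χ x * deriv (deriv χ) x :=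
  .of_support (hχ.contDiff_deriv_flux.of_le (by simp)) fun _ hx => hχ.deriv_flux_eq_zero hx

end IsPartitionFunction

/-! ### The local part of the system -/

/-- Values `(ζ, U, y_ξ, U_ξ, h, r̄)` of the Lagrangian variables at a point. -/
abbrev Vals := Fin 6 → ℝ

lemma abs_le_norm (z : Vals) (i : Fin 6) : |z i| ≤ ‖z‖ := norm_le_pi_norm z i

lemma abs_sub_le_norm (z w : Vals) (i : Fin 6) : |z i - w i| ≤ ‖z - w‖ := norm_le_pi_norm (z - w) i

/-- Functions of `(ξ, z)` that are bounded and Lipschitz for `‖z‖ ≤ M`, uniformly in `ξ`. -/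
def LocLip (M : ℝ) (f : ℝ → Vals → ℝ) : Prop :=
  ∃ C, 0 ≤ C ∧ (∀ ξ z, ‖z‖ ≤ M → |f ξ z| ≤ C) ∧
    ∀ ξ z w, ‖z‖ ≤ M → ‖w‖ ≤ M → |f ξ z - f ξ w| ≤ C * ‖z - w‖

namespace LocLip

variable {M : ℝ} {f g : ℝ → Vals → ℝ}

lemma const (c : ℝ) : LocLip M fun _ _ => c :=
  ⟨|c|, abs_nonneg _, fun _ _ _ => le_rfl, fun _ z w _ _ => by simp; positivity⟩

lemma coord (i : Fin 6) : LocLip M fun _ z => z i :=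
  ⟨max M 1, le_max_of_le_right zero_le_one,
    fun _ z hz => ((abs_le_norm z i).trans hz).trans (le_max_left _ _), fun _ z w _ _ =>
      (abs_sub_le_norm z w i).trans (le_mul_of_one_le_left (norm_nonneg _) (le_max_right _ _))⟩

lemma comp_pos {φ : ℝ → ℝ} (hφ : BddLip φ) : LocLip M fun ξ z => φ (ξ + z 0) := by
  obtain ⟨C, hC, h1, h2⟩ := hφ
  refine ⟨C, hC, fun ξ z _ => h1 _, fun ξ z w _ _ => (h2 _ _).trans ?_⟩
  rw [add_sub_add_left_eq_sub]
  exact mul_le_mul_of_nonneg_left (abs_sub_le_norm z w 0) hC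

lemma add (hf : LocLip M f) (hg : LocLip M g) : LocLip M fun ξ z => f ξ z + g ξ z := by
  obtain ⟨C, hC, h1, h2⟩ := hf
  obtain ⟨C', hC', h1', h2'⟩ := hg
  refine ⟨C + C', by positivity, fun ξ z hz => (abs_add_le _ _).trans
    (add_le_add (h1 ξ z hz) (h1' ξ z hz)), fun ξ z w hz hw => ?_⟩
  rw [add_sub_add_comm, add_mul]
  exact (abs_add_le _ _).trans (add_le_add (h2 ξ z w hz hw) (h2' ξ z w hz hw))

lemma mul (hf : LocLip M f) (hg : LocLip M g) : LocLip M fun ξ z => f ξ z * g ξ z := by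
  obtain ⟨C, hC, h1, h2⟩ := hf
  obtain ⟨C', hC', h1', h2'⟩ := hg
  refine ⟨C * C' + C * C', by positivity, fun ξ z hz => ?_, fun ξ z w hz hw => ?_⟩
  · rw [abs_mul]
    have := mul_le_mul (h1 ξ z hz) (h1' ξ z hz) (abs_nonneg _) hC
    have : 0 ≤ C * C' := by positivity
    linarith
  · have e : f ξ z * g ξ z - f ξ w * g ξ w
        = (f ξ z - f ξ w) * g ξ z + f ξ w * (g ξ z - g ξ w) := by ring
    rw [e]
    refine (abs_add_le _ _).trans ?_
    rw [abs_mul, abs_mul]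
    have a1 := mul_le_mul (h2 ξ z w hz hw) (h1' ξ z hz) (abs_nonneg _) (by positivity)
    have a2 := mul_le_mul (h1 ξ w hw) (h2' ξ z w hz hw) (abs_nonneg _) hC
    calc _ ≤ _ := add_le_add a1 a2
      _ = _ := by ring

lemma neg (hf : LocLip M f) : LocLip M fun ξ z => -f ξ z := by
  simpa using (const (M := M) (-1)).mul hf

lemma sub (hf : LocLip M f) (hg : LocLip M g) : LocLip M fun ξ z => f ξ z - g ξ z := by
  simpa [sub_eq_add_neg] using hf.add hg.neg

end LocLip

/-- Parameters of the system in Lagrangian variables: the partition function, the two constants,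
and the set of points where wave breaking may occur. -/
structure Params where
  χ : ℝ → ℝ
  c : ℝ
  k : ℝ
  N : Set ℝ

namespace Params

variable (D : Params)

/-- The same parameters with another set of breaking candidates. -/
def withN (N : Set ℝ) : Params := { D with N := N }

/-- `Ū = U - c χ(y)`. -/
def ub (ξ : ℝ) (z : Vals) : ℝ := z 1 - D.c * D.χ (ξ + z 0)

/-- `2 c χ(y) Ū + Ū²`. -/
def loc (ξ : ℝ) (z : Vals) : ℝ := 2 * D.c * D.χ (ξ + z 0) * D.ub ξ z + D.ub ξ z * D.ub ξ z

/-- `(2 c χ(y) Ū + Ū²) y_ξ + h / 2 + k r̄`. -/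
def src (ξ : ℝ) (z : Vals) : ℝ := D.loc ξ z * z 2 + 1 / 2 * z 4 + D.k * z 5

/-- `2 c² χ(y) χ'(y)`. -/
def flux (ξ : ℝ) (z : Vals) : ℝ := 2 * D.c ^ 2 * (D.χ (ξ + z 0) * deriv D.χ (ξ + z 0))

/-- `2 c² (χ χ')'(y) y_ξ`. -/
def srcA (ξ : ℝ) (z : Vals) : ℝ :=
  2 * D.c ^ 2 * (deriv D.χ (ξ + z 0) ^ 2 + D.χ (ξ + z 0) * deriv (deriv D.χ) (ξ + z 0)) * z 2

open Classical in
/-- `U_ξ`, cut off at wave breaking. -/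
def trunc (ξ : ℝ) (z : Vals) : ℝ := if ξ ∈ D.N then min (z 3) 0 else z 3

/-- Wave breaking has occurred. -/
def Broken (ξ : ℝ) (z : Vals) : Prop := ξ ∈ D.N ∧ 0 ≤ z 3

open Classical in
/-- The total source of the nonlocal terms. -/
def tot (ξ : ℝ) (z : Vals) : ℝ := (if D.Broken ξ z then 0 else D.src ξ z) + D.srcA ξ z

/-- The right-hand side of the system for given values `I`, `J` of the nonlocal terms. -/
def rhs (ξ : ℝ) (z : Vals) (I J : ℝ) : Vals :=
  ![z 1, -D.flux ξ z + J, D.trunc ξ z, 1 / 2 * z 4 + (D.loc ξ z - I) * z 2 + D.k * z 5,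
    2 * (D.loc ξ z - I) * D.trunc ξ z, -(D.k * D.trunc ξ z)]

variable {D} (hχ : IsPartitionFunction D.χ) (M : ℝ)

lemma abs_trunc_le (ξ : ℝ) (z : Vals) : |D.trunc ξ z| ≤ |z 3| := by
  unfold trunc
  split_ifs
  · rcases le_total (z 3) 0 with h | h
    · rw [min_eq_left h]
    · rw [min_eq_right h, abs_zero]; exact abs_nonneg _
  · exact le_rfl

lemma abs_trunc_sub_le (ξ : ℝ) (z w : Vals) : |D.trunc ξ z - D.trunc ξ w| ≤ |z 3 - w 3| := by
  unfold trunc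
  split_ifs
  · simpa using abs_min_sub_min_le_max (z 3) 0 (w 3) 0
  · exact le_rfl

include hχ

lemma locLip_ub : LocLip M D.ub :=
  (LocLip.coord 1).sub ((LocLip.const D.c).mul (.comp_pos hχ.bddLip))

lemma locLip_loc : LocLip M D.loc :=
  ((((LocLip.const 2).mul (.const D.c)).mul (.comp_pos hχ.bddLip)).mul (locLip_ub hχ M)).add
    ((locLip_ub hχ M).mul (locLip_ub hχ M))

lemma locLip_src : LocLip M D.src :=
  (((locLip_loc hχ M).mul (.coord 2)).add ((LocLip.const (1 / 2)).mul (.coord 4))).add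
    ((LocLip.const D.k).mul (.coord 5))

lemma locLip_flux : LocLip M D.flux :=
  (LocLip.const (2 * D.c ^ 2)).mul (.comp_pos hχ.bddLip_flux)

lemma locLip_srcA : LocLip M D.srcA :=
  ((LocLip.const (2 * D.c ^ 2)).mul (.comp_pos hχ.bddLip_deriv_flux)).mul (.coord 2)

/-- The right-hand side depends on the state and on the nonlocal terms in a Lipschitz way. -/
lemma exists_rhs_sub_le (B : ℝ) : ∃ C, 0 ≤ C ∧ ∀ N ξ z w I J I' J', ‖z‖ ≤ M → ‖w‖ ≤ M →
    |I| ≤ B → ‖(D.withN N).rhs ξ z I J - (D.withN N).rhs ξ w I' J'‖ ≤ C * (‖z - w‖ + |I - I'| + |J - J'|) := by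
  obtain ⟨A0, hA0, a0, b0⟩ := locLip_flux hχ M
  obtain ⟨A2, hA2, a2, b2⟩ := locLip_loc hχ M
  obtain ⟨A3, hA3, a3, b3⟩ := (((LocLip.const (1 / 2)).mul (.coord 4)).add
    ((locLip_loc hχ M).mul (.coord 2))).add ((LocLip.const (M := M) D.k).mul (.coord 5))
  by_cases hM : 0 ≤ M
  swap
  · exact ⟨0, le_rfl, fun N ξ z w I J I' J' hz => absurd ((norm_nonneg z).trans hz) hM⟩
  by_cases hB : 0 ≤ B
  swap
  · exact ⟨0, le_rfl, fun N ξ z w I J I' J' _ _ hI => absurd ((abs_nonneg I).trans hI) hB⟩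
  set C := 1 + A0 + 1 + (A3 + B + M) + (2 * A2 * M + 2 * A2 + 2 * B + 2 * M) + |D.k| with hC
  have hk := abs_nonneg D.k
  have p1 := mul_nonneg hA2 hM
  have hC0 : 0 ≤ C := by positivity
  refine ⟨C, hC0, fun N ξ z w I J I' J' hz hw hI => ?_⟩
  set n := ‖z - w‖ with hn
  have hn0 : 0 ≤ n := norm_nonneg _
  set dI := |I - I'| with hdI
  set dJ := |J - J'| with hdJ
  have hdI0 : 0 ≤ dI := abs_nonneg _
  have hdJ0 : 0 ≤ dJ := abs_nonneg _
  have key : ∀ {x a b e : ℝ}, |x| ≤ a * n + b * dI + e * dJ → a ≤ C → b ≤ C → e ≤ C →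
      |x| ≤ C * (n + dI + dJ) := by
    intro x a b e h h1 h2 h3
    have := mul_le_mul_of_nonneg_right h1 hn0
    have := mul_le_mul_of_nonneg_right h2 hdI0
    have := mul_le_mul_of_nonneg_right h3 hdJ0
    nlinarith
  rw [pi_norm_le_iff_of_nonneg (by positivity)]
  have hw2 : |w 2| ≤ M := (abs_le_norm w 2).trans hw
  have hz2 : |z 2 - w 2| ≤ n := abs_sub_le_norm z w 2
  set tz := (D.withN N).trunc ξ z with htz
  set tw := (D.withN N).trunc ξ w with htw
  have ht : |tw| ≤ M := (abs_trunc_le ξ w).trans ((abs_le_norm w 3).trans hw)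
  have ht' : |tz| ≤ M := (abs_trunc_le ξ z).trans ((abs_le_norm z 3).trans hz)
  have hT : |tz - tw| ≤ n := (abs_trunc_sub_le ξ z w).trans (abs_sub_le_norm z w 3)
  intro i
  fin_cases i
  · change |z 1 - w 1| ≤ _
    refine key (a := 1) (b := 0) (e := 0) ?_ ?_ hC0 hC0
    · linarith [abs_sub_le_norm z w 1]
    · rw [hC]; linarith
  · change |(-D.flux ξ z + J) - (-D.flux ξ w + J')| ≤ _
    refine key (a := A0) (b := 0) (e := 1) ?_ ?_ hC0 ?_
    · have e : (-D.flux ξ z + J) - (-D.flux ξ w + J')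
          = -(D.flux ξ z - D.flux ξ w) + (J - J') := by ring
      rw [e]
      refine (abs_add_le _ _).trans ?_
      rw [abs_neg]
      linarith [b0 ξ z w hz hw]
    · rw [hC]; linarith
    · rw [hC]; linarith
  · change |tz - tw| ≤ _
    refine key (a := 1) (b := 0) (e := 0) ?_ ?_ hC0 hC0
    · linarith
    · rw [hC]; linarith
  · change |(1 / 2 * z 4 + (D.loc ξ z - I) * z 2 + D.k * z 5) -
      (1 / 2 * w 4 + (D.loc ξ w - I') * w 2 + D.k * w 5)| ≤ _
    refine key (a := A3 + B) (b := M) (e := 0) ?_ ?_ ?_ hC0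
    · have e : (1 / 2 * z 4 + (D.loc ξ z - I) * z 2 + D.k * z 5) -
          (1 / 2 * w 4 + (D.loc ξ w - I') * w 2 + D.k * w 5)
          = ((1 / 2 * z 4 + D.loc ξ z * z 2 + D.k * z 5)
            - (1 / 2 * w 4 + D.loc ξ w * w 2 + D.k * w 5))
            - I * (z 2 - w 2) - (I - I') * w 2 := by ring
      rw [e]
      refine (abs_sub _ _).trans (le_trans (add_le_add (abs_sub _ _) le_rfl) ?_)
      rw [abs_mul, abs_mul]
      have h1 := b3 ξ z w hz hw
      have h2 := mul_le_mul hI hz2 (abs_nonneg _) hB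
      have h3 := mul_le_mul_of_nonneg_left hw2 hdI0
      rw [← hdI]
      linarith
    · rw [hC]; linarith
    · rw [hC]; linarith
  · change |2 * (D.loc ξ z - I) * tz - 2 * (D.loc ξ w - I') * tw| ≤ _
    refine key (a := 2 * A2 * M + 2 * A2 + 2 * B) (b := 2 * M) (e := 0) ?_ ?_ ?_ hC0
    · have e : 2 * (D.loc ξ z - I) * tz - 2 * (D.loc ξ w - I') * tw
          = 2 * ((D.loc ξ z - D.loc ξ w) * tz + D.loc ξ w * (tz - tw))
            - 2 * I * (tz - tw) - 2 * (I - I') * tw := by ring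
      rw [e]
      refine (abs_sub _ _).trans (le_trans (add_le_add (abs_sub _ _) le_rfl) ?_)
      rw [abs_mul (2 * I), abs_mul (2 * (I - I')), abs_mul 2, abs_mul 2, abs_mul 2, abs_two]
      have h0 := abs_add_le ((D.loc ξ z - D.loc ξ w) * tz) (D.loc ξ w * (tz - tw))
      rw [abs_mul, abs_mul] at h0
      have h1 := mul_le_mul (b2 ξ z w hz hw) ht' (abs_nonneg _) (by positivity)
      have h1' := mul_le_mul (a2 ξ w hw) hT (abs_nonneg _) hA2
      have h2 := mul_le_mul hI hT (abs_nonneg _) hB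
      have h3 := mul_le_mul_of_nonneg_left ht hdI0
      rw [← hdI]
      linarith
    · rw [hC]; linarith
    · rw [hC]; linarith
  · change |-(D.k * tz) - -(D.k * tw)| ≤ _
    refine key (a := |D.k|) (b := 0) (e := 0) ?_ ?_ hC0 hC0
    · have e : -(D.k * tz) - -(D.k * tw)
          = -(D.k * (tz - tw)) := by ring
      rw [e, abs_neg, abs_mul]
      have := mul_le_mul_of_nonneg_left hT hk
      linarith
    · rw [hC]; linarith

end Params

/-! ### The nonlocal terms -/

/-- The primitive of `y_ξ` that vanishes at the origin. -/
def pos (f : ℝ → Vals) (ξ : ℝ) : ℝ := ∫ x in (0 : ℝ)..ξ, f x 2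

/-- The kernel `e^{-|y(ξ) - y(η)|}`. -/
def ker (f : ℝ → Vals) (ξ η : ℝ) : ℝ := Real.exp (-|pos f ξ - pos f η|)

/-- Measurable functions with values in `[-1, 1]`. -/
structure IsWeight (κ : ℝ → ℝ) : Prop where
  measurable : Measurable κ
  abs_le_one : ∀ x, |κ x| ≤ 1

lemma isWeight_one : IsWeight fun _ => 1 := ⟨measurable_const, by simp⟩

lemma isWeight_sign : IsWeight Real.sign := by
  constructor
  · refine Measurable.ite measurableSet_Iio measurable_const ?_
    exact Measurable.ite measurableSet_Ioi measurable_const measurable_const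
  · intro x
    rcases lt_trichotomy x 0 with h | h | h
    · simp [Real.sign_of_neg h]
    · simp [h]
    · simp [Real.sign_of_pos h]

namespace Params

variable (D : Params)

/-- `½ ∫ κ(ξ - η) e^{-|y(ξ) - y(η)|} G(η) dη` with the total source `G`. -/
def nonloc (κ : ℝ → ℝ) (f : ℝ → Vals) (ξ : ℝ) : ℝ :=
  1 / 2 * ∫ η, κ (ξ - η) * ker f ξ η * D.tot η (f η)

/-- Profiles at a fixed time with quantitative bounds. -/
structure Profile (M K : ℝ) (f : ℝ → Vals) : Prop where
  int_p : ∀ a b, IntervalIntegrable (fun x => f x 2) volume a b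
  meas_tot : AEStronglyMeasurable (fun η => D.tot η (f η)) volume
  bdd : ∀ᵐ η, ‖f η‖ ≤ M
  coercive : ∀ ξ η, 1 / 2 * |ξ - η| - K ≤ |pos f ξ - pos f η|

variable {D} {M K : ℝ} {f g : ℝ → Vals} {κ : ℝ → ℝ}

lemma Profile.continuous_pos (hf : D.Profile M K f) : Continuous (pos f) :=
  intervalIntegral.continuous_primitive hf.int_p 0

lemma Profile.measurable_ker (hf : D.Profile M K f) (ξ : ℝ) : Measurable (ker f ξ) := by
  unfold ker
  have := hf.continuous_pos.measurable
  fun_prop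

lemma Profile.ker_le (hf : D.Profile M K f) (ξ η : ℝ) :
    ker f ξ η ≤ Real.exp K * Real.exp (-(1 / 2 * |ξ - η|)) := by
  rw [← Real.exp_add]
  exact Real.exp_le_exp.2 (by linarith [hf.coercive ξ η])

lemma ker_pos (f : ℝ → Vals) (ξ η : ℝ) : 0 < ker f ξ η := Real.exp_pos _

lemma Profile.norm_integrand_le (hf : D.Profile M K f) (hκ : IsWeight κ) (ξ η : ℝ) {A : ℝ}
    (hA : |D.tot η (f η)| ≤ A) :
    ‖κ (ξ - η) * ker f ξ η * D.tot η (f η)‖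
      ≤ Real.exp K * (Real.exp (-(1 / 2 * |ξ - η|)) * A) := by
  rw [Real.norm_eq_abs, abs_mul, abs_mul, abs_of_pos (ker_pos f ξ η), ← mul_assoc]
  refine mul_le_mul ?_ hA (abs_nonneg _) (by positivity)
  calc |κ (ξ - η)| * ker f ξ η ≤ 1 * ker f ξ η :=
        mul_le_mul_of_nonneg_right (hκ.abs_le_one _) (ker_pos f ξ η).le
    _ ≤ _ := by rw [one_mul]; exact hf.ker_le ξ η

lemma Profile.aestronglyMeasurable_integrand (hf : D.Profile M K f) (hκ : IsWeight κ) (ξ : ℝ) :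
    AEStronglyMeasurable (fun η => κ (ξ - η) * ker f ξ η * D.tot η (f η)) volume :=
  (((hκ.measurable.comp (measurable_const.sub measurable_id)).mul
    (hf.measurable_ker ξ)).aestronglyMeasurable).mul hf.meas_tot

lemma Profile.integrable_of_envelope (hf : D.Profile M K f) (hκ : IsWeight κ) {m : ℝ → ℝ}
    {B C A : ℝ} (hm : Envelope m B C) (hA : ∀ᵐ η, |D.tot η (f η)| ≤ A * m η) (ξ : ℝ) :
    Integrable fun η => κ (ξ - η) * ker f ξ η * D.tot η (f η) := by
  refine (((hm.integrable ξ).const_mul A).const_mul (Real.exp K)).mono'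
    (hf.aestronglyMeasurable_integrand hκ ξ) ?_
  filter_upwards [hA] with η hη
  refine (hf.norm_integrand_le hκ ξ η hη).trans (le_of_eq ?_)
  ring

lemma Profile.abs_nonloc_le (hf : D.Profile M K f) (hκ : IsWeight κ) {m : ℝ → ℝ}
    {B C A : ℝ} (hA0 : 0 ≤ A) (hm : Envelope m B C) (hA : ∀ᵐ η, |D.tot η (f η)| ≤ A * m η)
    (ξ : ℝ) : |D.nonloc κ f ξ| ≤ 1 / 2 * (Real.exp K * (A * C)) * m ξ := by
  unfold nonloc
  rw [abs_mul, abs_of_pos (by norm_num : (0 : ℝ) < 1 / 2), mul_assoc]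
  refine mul_le_mul_of_nonneg_left ?_ (by norm_num)
  have h1 : ‖∫ η, κ (ξ - η) * ker f ξ η * D.tot η (f η)‖
      ≤ ∫ η, Real.exp K * (A * (Real.exp (-(1 / 2 * |ξ - η|)) * m η)) := by
    refine norm_integral_le_of_norm_le (((hm.integrable ξ).const_mul A).const_mul _) ?_
    filter_upwards [hA] with η hη
    refine (hf.norm_integrand_le hκ ξ η hη).trans (le_of_eq ?_)
    ring
  rw [integral_const_mul, integral_const_mul] at h1
  refine h1.trans ?_
  have := mul_le_mul_of_nonneg_left (hm.conv_le ξ) (mul_nonneg (Real.exp_pos K).le hA0)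
  calc _ = Real.exp K * A * ∫ η, Real.exp (-(1 / 2 * |ξ - η|)) * m η := by ring
    _ ≤ _ := this
    _ = _ := by ring

variable (hχ : IsPartitionFunction D.χ)
include hχ

lemma exists_abs_tot_le (M : ℝ) : ∃ C, 0 ≤ C ∧ ∀ N ξ z, ‖z‖ ≤ M → |(D.withN N).tot ξ z| ≤ C := by
  obtain ⟨A, hA, a, -⟩ := locLip_src hχ M
  obtain ⟨B, hB, b, -⟩ := locLip_srcA hχ M
  refine ⟨A + B, by positivity, fun N ξ z hz => ?_⟩
  unfold tot
  refine (abs_add_le _ _).trans (add_le_add ?_ (b ξ z hz))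
  split_ifs
  · simpa using hA
  · exact a ξ z hz

open Classical in
lemma exists_tot_sub_le (M : ℝ) : ∃ C, 0 ≤ C ∧ ∀ N ξ z w, ‖z‖ ≤ M → ‖w‖ ≤ M →
    |(D.withN N).tot ξ z - (D.withN N).tot ξ w|
      ≤ C * ‖z - w‖
        + C * (if (D.withN N).Broken ξ z ↔ (D.withN N).Broken ξ w then 0 else 1) := by
  obtain ⟨A, hA, a, a'⟩ := locLip_src hχ M
  obtain ⟨B, hB, b, b'⟩ := locLip_srcA hχ M
  refine ⟨A + B, by positivity, fun N ξ z w hz hw => ?_⟩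
  have h1 := a' ξ z w hz hw
  have h2 := b' ξ z w hz hw
  have h3 := a ξ z hz
  have h4 := a ξ w hw
  have hn := norm_nonneg (z - w)
  have h5 := mul_nonneg hA hn
  have h6 := mul_nonneg hB hn
  unfold tot
  rw [show (D.withN N).src = D.src from rfl, show (D.withN N).srcA = D.srcA from rfl]
  by_cases hb : (D.withN N).Broken ξ z <;> by_cases hb' : (D.withN N).Broken ξ w
  · simp only [hb, hb', if_true, zero_add]
    linarith
  · simp only [hb, hb', if_true, if_false, zero_add, iff_false, not_true]
    have e : D.srcA ξ z - (D.src ξ w + D.srcA ξ w)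
      = (D.srcA ξ z - D.srcA ξ w) - D.src ξ w := by ring
    rw [e]
    refine (abs_sub _ _).trans ?_
    linarith
  · simp only [hb, hb', if_true, if_false, zero_add, iff_true]
    have e : D.src ξ z + D.srcA ξ z - D.srcA ξ w
      = (D.srcA ξ z - D.srcA ξ w) + D.src ξ z := by ring
    rw [e]
    refine (abs_add_le _ _).trans ?_
    linarith
  · simp only [hb, hb', if_true, if_false]
    have e : D.src ξ z + D.srcA ξ z - (D.src ξ w + D.srcA ξ w)
      = (D.src ξ z - D.src ξ w) + (D.srcA ξ z - D.srcA ξ w) := by ring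
    rw [e]
    refine (abs_add_le _ _).trans ?_
    linarith

omit hχ in
lemma abs_pos_sub_le {M' : ℝ} (hf : D.Profile M K f) (hg : D.Profile M' K g) {d : ℝ}
    (hd : ∀ᵐ η, ‖f η - g η‖ ≤ d) (ξ η : ℝ) :
    |(pos f ξ - pos f η) - (pos g ξ - pos g η)| ≤ d * |ξ - η| := by
  unfold pos
  rw [intervalIntegral.integral_interval_sub_left (hf.int_p _ _) (hf.int_p _ _),
    intervalIntegral.integral_interval_sub_left (hg.int_p _ _) (hg.int_p _ _),
    ← intervalIntegral.integral_sub (hf.int_p _ _) (hg.int_p _ _)]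
  refine intervalIntegral.norm_integral_le_of_norm_le_const_ae (C := d)
    (f := fun x => f x 2 - g x 2) ?_
  filter_upwards [hd] with x hx _
  exact (abs_sub_le_norm (f x) (g x) 2).trans hx

omit hχ in
lemma abs_exp_neg_sub_le {a b l : ℝ} (ha : l ≤ a) (hb : l ≤ b) :
    |Real.exp (-a) - Real.exp (-b)| ≤ Real.exp (-l) * |a - b| := by
  wlog h : a ≤ b generalizing a b
  · rw [abs_sub_comm, abs_sub_comm a b]
    exact this hb ha (le_of_not_ge h)
  have h1 : Real.exp (-b) ≤ Real.exp (-a) := Real.exp_le_exp.2 (by linarith)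
  have h2 : Real.exp (-a) ≤ Real.exp (-l) := Real.exp_le_exp.2 (by linarith)
  rw [abs_of_nonneg (by linarith), abs_of_nonpos (by linarith)]
  have h3 : Real.exp (-b) = Real.exp (-a) * Real.exp (a - b) := by
    rw [← Real.exp_add]; ring_nf
  have h4 := Real.add_one_le_exp (a - b)
  have h5 := Real.exp_pos (-a)
  rw [h3]
  nlinarith

omit hχ in
lemma abs_ker_sub_le {M' : ℝ} (hf : D.Profile M K f) (hg : D.Profile M' K g) {d : ℝ}
    (hd0 : 0 ≤ d) (hd : ∀ᵐ η, ‖f η - g η‖ ≤ d) (ξ η : ℝ) :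
    |ker f ξ η - ker g ξ η| ≤ 4 * Real.exp K * d * Real.exp (-(1 / 4 * |ξ - η|)) := by
  have h1 := abs_exp_neg_sub_le (hf.coercive ξ η) (hg.coercive ξ η)
  have h2 : |(|pos f ξ - pos f η| - |pos g ξ - pos g η|)| ≤ d * |ξ - η| :=
    (abs_abs_sub_abs_le_abs_sub _ _).trans (abs_pos_sub_le hf hg hd ξ η)
  have h3 : |ξ - η| ≤ 4 * Real.exp (1 / 4 * |ξ - η|) := by
    linarith [Real.add_one_le_exp (1 / 4 * |ξ - η|)]
  refine h1.trans ((mul_le_mul_of_nonneg_left h2 (Real.exp_pos _).le).trans ?_)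
  have h4 : Real.exp (-(1 / 2 * |ξ - η| - K)) * (4 * Real.exp (1 / 4 * |ξ - η|))
      = 4 * Real.exp K * Real.exp (-(1 / 4 * |ξ - η|)) := by
    rw [mul_left_comm, ← Real.exp_add, mul_assoc, ← Real.exp_add]
    ring_nf
  calc Real.exp (-(1 / 2 * |ξ - η| - K)) * (d * |ξ - η|)
      = d * (Real.exp (-(1 / 2 * |ξ - η| - K)) * |ξ - η|) := by ring
    _ ≤ d * (Real.exp (-(1 / 2 * |ξ - η| - K)) * (4 * Real.exp (1 / 4 * |ξ - η|))) :=
        mul_le_mul_of_nonneg_left (mul_le_mul_of_nonneg_left h3 (Real.exp_pos _).le) hd0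
    _ = _ := by rw [h4]; ring

open Classical in
/-- The nonlocal terms are Lipschitz up to the contribution of the points that are close to wave
breaking. -/
lemma exists_nonloc_sub_le (M K : ℝ) : ∃ C, 0 ≤ C ∧ ∀ (N : Set ℝ) (κ : ℝ → ℝ) (f g : ℝ → Vals)
    (d : ℝ) (N' : Set ℝ), IsWeight κ → (D.withN N).Profile M K f → (D.withN N).Profile M K g → 0 ≤ d →
    (∀ᵐ η, ‖f η - g η‖ ≤ d) → MeasurableSet N' → volume N' ≠ ⊤ → Measurable (fun η => f η 3) →
    (∀ᵐ η, η ∈ N → η ∉ N' → 0 ≤ f η 3 ∧ 0 ≤ g η 3) → ∀ ξ,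
    |(D.withN N).nonloc κ f ξ - (D.withN N).nonloc κ g ξ| ≤ C * (d + ∫ η in N', if |f η 3| ≤ d then 1 else 0) := by
  obtain ⟨A, hA, hA'⟩ := exists_abs_tot_le hχ M
  obtain ⟨B, hB, hB'⟩ := exists_tot_sub_le hχ M
  set E4 := ∫ x : ℝ, Real.exp (-(1 / 4 * |x|)) with hE4
  set E2 := ∫ x : ℝ, Real.exp (-(1 / 2 * |x|)) with hE2
  have hE4' : 0 ≤ E4 := integral_nonneg fun x => (Real.exp_pos _).le
  have hE2' : 0 ≤ E2 := integral_nonneg fun x => (Real.exp_pos _).le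
  have heK := Real.exp_pos K
  set C := 4 * Real.exp K * A * E4 + Real.exp K * B * E2 + Real.exp K * B with hC
  refine ⟨C, by positivity, fun N κ f g d N' hκ hf hg hd0 hd hN' hNt hf3 hNN ξ => ?_⟩
  set φ : ℝ → ℝ := fun η => N'.indicator (fun η => if |f η 3| ≤ d then (1 : ℝ) else 0) η with hφ
  have hφm : Measurable φ :=
    (Measurable.ite (measurableSet_le (hf3.norm) measurable_const) measurable_const
      measurable_const).indicator hN'
  have hφ01 : ∀ η, 0 ≤ φ η ∧ φ η ≤ N'.indicator (fun _ => (1 : ℝ)) η := fun η => by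
    simp only [hφ]
    by_cases h : η ∈ N' <;> simp [h]
    split_ifs <;> norm_num
  have hφi : Integrable φ := by
    have h1 : Integrable (N'.indicator (fun _ => (1 : ℝ))) :=
      (integrable_indicator_iff hN').2 (integrableOn_const hNt)
    refine h1.mono' hφm.aestronglyMeasurable (Eventually.of_forall fun η => ?_)
    rw [Real.norm_of_nonneg (hφ01 η).1]
    exact (hφ01 η).2
  have hφint : ∫ η, φ η = ∫ η in N', if |f η 3| ≤ d then (1 : ℝ) else 0 :=
    integral_indicator hN'
  have hconst := Envelope.const (B := 1) zero_le_one
  have hif := hf.integrable_of_envelope hκ hconst (A := A)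
    (by filter_upwards [hf.bdd] with η hη using by simpa using hA' N η _ hη) ξ
  have hig := hg.integrable_of_envelope hκ hconst (A := A)
    (by filter_upwards [hg.bdd] with η hη using by simpa using hA' N η _ hη) ξ
  have hpt : ∀ᵐ η, ‖κ (ξ - η) * ker f ξ η * (D.withN N).tot η (f η) - κ (ξ - η) * ker g ξ η * (D.withN N).tot η (g η)‖
      ≤ 4 * Real.exp K * d * A * Real.exp (-(1 / 4 * |ξ - η|))
        + (Real.exp K * B * d * Real.exp (-(1 / 2 * |ξ - η|)) + Real.exp K * B * φ η) := by
    filter_upwards [hf.bdd, hg.bdd, hd, hNN] with η h1 h2 h3 h4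
    have e : κ (ξ - η) * ker f ξ η * (D.withN N).tot η (f η) - κ (ξ - η) * ker g ξ η * (D.withN N).tot η (g η)
        = κ (ξ - η) * ((ker f ξ η - ker g ξ η) * (D.withN N).tot η (f η)
          + ker g ξ η * ((D.withN N).tot η (f η) - (D.withN N).tot η (g η))) := by ring
    rw [e, Real.norm_eq_abs, abs_mul]
    refine (mul_le_of_le_one_left (abs_nonneg _) (hκ.abs_le_one _)).trans ?_
    refine (abs_add_le _ _).trans (add_le_add ?_ ?_)
    · rw [abs_mul]
      refine (mul_le_mul (abs_ker_sub_le hf hg hd0 hd ξ η) (hA' N η _ h1) (abs_nonneg _)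
        (by positivity)).trans (le_of_eq ?_)
      ring
    · have hbr : (if (D.withN N).Broken η (f η) ↔ (D.withN N).Broken η (g η) then (0 : ℝ) else 1) ≤ φ η := by
        split_ifs with hb
        · exact (hφ01 η).1
        · have hηN : η ∈ N := by
            by_contra hn
            exact hb ⟨fun h => absurd h.1 hn, fun h => absurd h.1 hn⟩
          have hηN' : η ∈ N' := by
            by_contra hn
            have := h4 hηN hn
            exact hb ⟨fun _ => ⟨hηN, this.2⟩, fun _ => ⟨hηN, this.1⟩⟩
          have h5 := (abs_sub_le_norm (f η) (g η) 3).trans h3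
          have h6 : |f η 3| ≤ d := by
            rw [abs_le] at h5 ⊢
            by_cases h7 : 0 ≤ f η 3
            · have h8 : ¬ 0 ≤ g η 3 := fun h => hb ⟨fun _ => ⟨hηN, h⟩, fun _ => ⟨hηN, h7⟩⟩
              constructor <;> linarith
            · have h8 : 0 ≤ g η 3 := by
                by_contra h
                exact hb ⟨fun h' => absurd h'.2 h7, fun h' => absurd h'.2 h⟩
              constructor <;> linarith
          simp [hφ, hηN', h6]
      have h5 : |(D.withN N).tot η (f η) - (D.withN N).tot η (g η)| ≤ B * d + B * φ η :=
        (hB' N η _ _ h1 h2).trans (add_le_add (mul_le_mul_of_nonneg_left h3 hB)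
          (mul_le_mul_of_nonneg_left hbr hB))
      have h6 := hg.ker_le ξ η
      have h7 : Real.exp (-(1 / 2 * |ξ - η|)) ≤ 1 := Real.exp_le_one_iff.2 (by
        have := abs_nonneg (ξ - η); linarith)
      have hφ0 := (hφ01 η).1
      rw [abs_mul, abs_of_pos (ker_pos g ξ η)]
      refine (mul_le_mul h6 h5 (abs_nonneg _) (by positivity)).trans ?_
      have : Real.exp K * Real.exp (-(1 / 2 * |ξ - η|)) * (B * φ η) ≤ Real.exp K * 1 * (B * φ η) :=
        mul_le_mul_of_nonneg_right (mul_le_mul_of_nonneg_left h7 heK.le) (by positivity)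
      linarith
  have hI4 := (integrable_exp_neg_mul_abs_sub (a := 1 / 4) (by norm_num) ξ).const_mul
    (4 * Real.exp K * d * A)
  have hI2 := (integrable_exp_neg_mul_abs_sub (a := 1 / 2) (by norm_num) ξ).const_mul
    (Real.exp K * B * d)
  have hIφ := hφi.const_mul (Real.exp K * B)
  have hI2φ := hI2.add hIφ
  have hmain := norm_integral_le_of_norm_le (hI4.add hI2φ) hpt
  have e1 := integral_add hI4 hI2φ
  have e2 := integral_add hI2 hIφ
  simp only [Pi.add_apply] at hmain e1 e2
  rw [e1, e2, integral_const_mul, integral_const_mul, integral_const_mul,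
    integral_exp_neg_mul_abs_sub, integral_exp_neg_mul_abs_sub, integral_sub hif hig, hφint,
    ← hE4, ← hE2] at hmain
  unfold nonloc
  rw [← mul_sub, abs_mul, abs_of_pos (by norm_num : (0 : ℝ) < 1 / 2)]
  set J := ∫ η in N', if |f η 3| ≤ d then (1 : ℝ) else 0 with hJ
  have hJ0 : 0 ≤ J := by
    rw [← hφint]; exact integral_nonneg fun η => (hφ01 η).1
  rw [Real.norm_eq_abs] at hmain
  have q1 : 0 ≤ 4 * Real.exp K * A * E4 := by positivity
  have q2 : 0 ≤ Real.exp K * B * E2 := by positivity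
  have q3 : 0 ≤ Real.exp K * B := by positivity
  have r1 := mul_nonneg q1 hJ0
  have r2 := mul_nonneg q2 hJ0
  have r3 := mul_nonneg q3 hd0
  have r4 := mul_nonneg q1 hd0
  have r5 := mul_nonneg q2 hd0
  have r6 := mul_nonneg q3 hJ0
  have hR : C * (d + J) = 4 * Real.exp K * d * A * E4 + (Real.exp K * B * d * E2 +
      Real.exp K * B * J) + (4 * Real.exp K * A * E4 * J + Real.exp K * B * E2 * J
        + Real.exp K * B * d) := by rw [hC]; ring
  rw [hR]
  have := abs_nonneg ((∫ η, κ (ξ - η) * ker f ξ η * (D.withN N).tot η (f η))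
    - ∫ η, κ (ξ - η) * ker g ξ η * (D.withN N).tot η (g η))
  linarith

end Params

namespace Params

/-! ### Bounds for the right-hand side -/

variable (D : Params)

/-- The right-hand side of the system at a profile. -/
def rhsAt (f : ℝ → Vals) (ξ : ℝ) : Vals :=
  D.rhs ξ (f ξ) (D.nonloc (fun _ => 1) f ξ) (D.nonloc Real.sign f ξ)

/-- The coefficient `A = U² + k²/2 - P`. -/
def coef (f : ℝ → Vals) (ξ : ℝ) : ℝ := D.loc ξ (f ξ) - D.nonloc (fun _ => 1) f ξ

/-- Pointwise bounds by the envelope `m`. -/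
structure EnvAt (M a : ℝ) (m : ℝ → ℝ) (ξ : ℝ) (z : Vals) : Prop where
  norm_le : ‖z‖ ≤ M
  p_le : |z 2 - 1| ≤ a * m ξ
  q_le : |z 3| ≤ a * m ξ
  h_le : |z 4| ≤ a * m ξ
  r_le : |z 5| ≤ a * m ξ
  ub_le : |D.ub ξ z| ≤ a * m ξ

/-- The size `1` of the first component and `m` of the other ones. -/
def wt (m : ℝ → ℝ) (i : Fin 6) (ξ : ℝ) : ℝ := if i = 0 then 1 else m ξ

variable {D} (hχ : IsPartitionFunction D.χ)

lemma abs_chi_le (hχ : IsPartitionFunction D.χ) (x : ℝ) : |D.χ x| ≤ 1 := by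
  rw [abs_of_nonneg (hχ.nonneg x)]
  exact hχ.le_one x

include hχ

lemma exists_abs_loc_le (M a : ℝ) (ha : 0 ≤ a) : ∃ C, 0 ≤ C ∧ ∀ (m : ℝ → ℝ) (ξ : ℝ) (z : Vals),
    D.EnvAt M a m ξ z → |D.loc ξ z| ≤ C * m ξ := by
  obtain ⟨A, hA, hA', -⟩ := locLip_ub hχ M
  refine ⟨2 * |D.c| * a + A * a, by positivity, fun m ξ z hz => ?_⟩
  unfold loc
  refine (abs_add_le _ _).trans ?_
  rw [abs_mul, abs_mul (D.ub ξ z), abs_mul, abs_mul, abs_two, add_mul]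
  have hc := abs_nonneg D.c
  have h1 := hz.ub_le
  have hn := abs_nonneg (D.ub ξ z)
  refine add_le_add ?_ ?_
  · calc 2 * |D.c| * |D.χ (ξ + z 0)| * |D.ub ξ z| ≤ 2 * |D.c| * 1 * (a * m ξ) := by
          gcongr
          exact abs_chi_le hχ _
      _ = _ := by ring
  · calc |D.ub ξ z| * |D.ub ξ z| ≤ A * (a * m ξ) :=
          mul_le_mul (hA' ξ z hz.norm_le) h1 hn hA
      _ = _ := by ring

omit hχ in
lemma one_le_of_pos_mem {M : ℝ} {m : ℝ → ℝ} (hm1 : ∀ ξ, |ξ| ≤ M + 1 → 1 ≤ m ξ) {ξ : ℝ} {z : Vals}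
    (hz : ‖z‖ ≤ M) (h : ξ + z 0 ∈ Icc (0 : ℝ) 1) : 1 ≤ m ξ := by
  have h0 := (abs_le_norm z 0).trans hz
  rw [abs_le] at h0
  refine hm1 ξ ?_
  rw [abs_le]
  constructor <;> linarith [h.1, h.2]

lemma exists_abs_flux_le (M : ℝ) : ∃ C, 0 ≤ C ∧ ∀ m : ℝ → ℝ, (∀ ξ, 0 ≤ m ξ) →
    (∀ ξ, |ξ| ≤ M + 1 → 1 ≤ m ξ) → ∀ ξ (z : Vals), ‖z‖ ≤ M →
    |D.flux ξ z| ≤ C * m ξ ∧ |D.srcA ξ z| ≤ C * m ξ := by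
  obtain ⟨A, hA, hA', -⟩ := locLip_flux hχ M
  obtain ⟨B, hB, hB', -⟩ := locLip_srcA hχ M
  refine ⟨A + B, by positivity, fun m hm hm1 ξ z hz => ?_⟩
  by_cases h : ξ + z 0 ∈ Icc (0 : ℝ) 1
  · have h1 := one_le_of_pos_mem hm1 hz h
    constructor
    · nlinarith [hA' ξ z hz]
    · nlinarith [hB' ξ z hz]
  · have e1 : D.flux ξ z = 0 := by simp [flux, hχ.deriv_eq_zero h]
    have e2 : D.srcA ξ z = 0 := by simp [srcA, hχ.deriv_flux_eq_zero h]
    rw [e1, e2, abs_zero]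
    have := mul_nonneg (add_nonneg hA hB) (hm ξ)
    exact ⟨this, this⟩

open Classical in
/-- The sources and the right-hand side are controlled by the envelope. -/
lemma exists_rhsAt_le_envelope (M K a B Cm : ℝ) (ha : 0 ≤ a) (m : ℝ → ℝ) (hm : Envelope m B Cm)
    (hm1 : ∀ ξ, |ξ| ≤ M + 1 → 1 ≤ m ξ) : ∃ L, 0 ≤ L ∧ ∀ N f, (D.withN N).Profile M K f →
      (∀ᵐ η, D.EnvAt M a m η (f η)) → ∀ ξ, D.EnvAt M a m ξ (f ξ) →
      (∀ i, |(D.withN N).rhsAt f ξ i| ≤ L * wt m i ξ) ∧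
      |(D.withN N).coef f ξ| ≤ L * m ξ := by
  obtain ⟨A1, hA1, hA1'⟩ := exists_abs_loc_le hχ M a ha
  obtain ⟨A2, hA2, hA2'⟩ := exists_abs_flux_le hχ M
  replace hA2' := hA2' m hm.nonneg hm1
  by_cases hM : 0 ≤ M
  swap
  · exact ⟨0, le_rfl, fun N f _ _ ξ h => absurd ((norm_nonneg _).trans h.norm_le) hM⟩
  have hk := abs_nonneg D.k
  set A := A1 * M + 1 / 2 * a + |D.k| * a + A2 with hA
  have hA0 : 0 ≤ A := by positivity
  set CI := 1 / 2 * (Real.exp K * (A * |Cm|)) with hCI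
  have hCI0 : 0 ≤ CI := by positivity
  set L := M + (A2 + CI) + a + (1 / 2 * a + (A1 + CI) * M + |D.k| * a) + 2 * (A1 + CI) * M
    + |D.k| * a + (A1 + CI) with hL
  have hL0 : 0 ≤ L := by positivity
  refine ⟨L, hL0, fun N f hf hae ξ hξ => ?_⟩
  have hmξ := hm.nonneg ξ
  have htot : ∀ η z, D.EnvAt M a m η z → |(D.withN N).tot η z| ≤ A * m η := by
    intro η z hz
    unfold tot
    refine (abs_add_le _ _).trans ?_
    have h1 : |D.src η z| ≤ (A1 * M + 1 / 2 * a + |D.k| * a) * m η := by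
      unfold src
      refine (abs_add_le _ _).trans (le_trans (add_le_add (abs_add_le _ _) le_rfl) ?_)
      rw [abs_mul, abs_mul, abs_mul D.k, abs_of_pos (by norm_num : (0 : ℝ) < 1 / 2)]
      have h2 := mul_le_mul (hA1' m η z hz) ((abs_le_norm z 2).trans hz.norm_le) (abs_nonneg _)
        (mul_nonneg hA1 (hm.nonneg η))
      have h3 := mul_le_mul_of_nonneg_left hz.r_le hk
      linarith [hz.h_le]
    have h2 : |if (D.withN N).Broken η z then 0 else (D.withN N).src η z|
        ≤ (A1 * M + 1 / 2 * a + |D.k| * a) * m η := by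
      split_ifs
      · rw [abs_zero]; exact (abs_nonneg _).trans h1
      · exact h1
    have h3 := (hA2' η z hz.norm_le).2
    change _ + |D.srcA η z| ≤ _
    rw [hA]
    linarith
  have hae' : ∀ᵐ η, |(D.withN N).tot η (f η)| ≤ A * m η := by
    filter_upwards [hae] with η hη using htot η _ hη
  have hnl : ∀ κ, IsWeight κ → |(D.withN N).nonloc κ f ξ| ≤ CI * m ξ := fun κ hκ => by
    refine (hf.abs_nonloc_le hκ hA0 hm hae' ξ).trans (mul_le_mul_of_nonneg_right ?_ hmξ)
    rw [hCI]
    have := mul_le_mul_of_nonneg_left (le_abs_self Cm) hA0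
    gcongr
  have hI := hnl _ isWeight_one
  have hJ := hnl _ isWeight_sign
  have hl := hA1' m ξ _ hξ
  have hfl := (hA2' ξ _ hξ.norm_le).1
  have ht : |(D.withN N).trunc ξ (f ξ)| ≤ a * m ξ := (abs_trunc_le ξ _).trans hξ.q_le
  have ht' : |(D.withN N).trunc ξ (f ξ)| ≤ M :=
    (abs_trunc_le ξ _).trans ((abs_le_norm _ 3).trans hξ.norm_le)
  have hp : |f ξ 2| ≤ M := (abs_le_norm _ 2).trans hξ.norm_le
  have hcoef : |(D.withN N).coef f ξ| ≤ (A1 + CI) * m ξ := by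
    unfold coef
    refine (abs_sub _ _).trans ?_
    change |D.loc ξ (f ξ)| + _ ≤ _
    linarith
  have hACm : 0 ≤ (A1 + CI) * m ξ := by positivity
  have fin : ∀ {x : ℝ} (b : ℝ), |x| ≤ b * m ξ → b ≤ L → |x| ≤ L * m ξ := fun b h1 h2 =>
    h1.trans (mul_le_mul_of_nonneg_right h2 hmξ)
  have p1 : 0 ≤ (A1 + CI) * M := by positivity
  have p2 : 0 ≤ |D.k| * a := by positivity
  refine ⟨fun i => ?_, fin _ hcoef (by rw [hL]; linarith)⟩
  fin_cases i
  · change |f ξ 1| ≤ L * 1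
    have := (abs_le_norm (f ξ) 1).trans hξ.norm_le
    rw [mul_one, hL]
    linarith
  · change |-D.flux ξ (f ξ) + _| ≤ L * m ξ
    refine fin (A2 + CI) ?_ (by rw [hL]; linarith)
    refine (abs_add_le _ _).trans ?_
    rw [abs_neg]
    linarith
  · exact fin a ht (by rw [hL]; linarith)
  · change |1 / 2 * f ξ 4 + (D.withN N).coef f ξ * f ξ 2 + D.k * f ξ 5| ≤ L * m ξ
    refine fin (1 / 2 * a + (A1 + CI) * M + |D.k| * a) ?_ (by rw [hL]; linarith)
    refine (abs_add_le _ _).trans (le_trans (add_le_add (abs_add_le _ _) le_rfl) ?_)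
    rw [abs_mul, abs_mul _ (f ξ 2), abs_mul D.k, abs_of_pos (by norm_num : (0 : ℝ) < 1 / 2)]
    have h1 := mul_le_mul hcoef hp (abs_nonneg _) hACm
    have h2 := mul_le_mul_of_nonneg_left hξ.r_le hk
    linarith [hξ.h_le]
  · change |2 * (D.withN N).coef f ξ * (D.withN N).trunc ξ (f ξ)| ≤ L * m ξ
    refine fin (2 * (A1 + CI) * M) ?_ (by rw [hL]; linarith)
    rw [abs_mul, abs_mul, abs_two]
    have h1 := mul_le_mul hcoef ht' (abs_nonneg _) hACm
    linarith
  · change |-(D.k * (D.withN N).trunc ξ (f ξ))| ≤ L * m ξ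
    refine fin (|D.k| * a) ?_ (by rw [hL]; linarith)
    rw [abs_neg, abs_mul]
    have := mul_le_mul_of_nonneg_left ht hk
    linarith

/-- Bounds for the right-hand side and the coefficient that depend on the sup norm only. -/
lemma exists_norm_rhsAt_le (M K : ℝ) : ∃ Λ, 0 ≤ Λ ∧ ∀ N f, (D.withN N).Profile M K f →
    ∀ ξ, ‖f ξ‖ ≤ M → ‖(D.withN N).rhsAt f ξ‖ ≤ Λ ∧ |(D.withN N).coef f ξ| ≤ Λ ∧
      |(D.withN N).nonloc (fun _ => 1) f ξ| ≤ Λ := by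
  by_cases hM : 0 ≤ M
  swap
  · exact ⟨0, le_rfl, fun N f _ ξ h => absurd ((norm_nonneg _).trans h) hM⟩
  obtain ⟨A, hA, hA', -⟩ := locLip_ub hχ M
  obtain ⟨A1, hA1, hA1', -⟩ := locLip_loc hχ M
  set b := M + 1 + A with hb
  have hb1 : 1 ≤ b := by rw [hb]; linarith
  have henv : ∀ ξ z, ‖z‖ ≤ M → D.EnvAt M 1 (fun _ => b) ξ z := fun ξ z hz => by
    have h : ∀ i, |z i| ≤ 1 * b := fun i => by
      have := (abs_le_norm z i).trans hz
      rw [hb]; linarith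
    refine ⟨hz, ?_, h 3, h 4, h 5, ?_⟩
    · refine (abs_sub _ _).trans ?_
      have := (abs_le_norm z 2).trans hz
      rw [abs_one, hb]; linarith
    · have := hA' ξ z hz
      rw [hb]; linarith
  obtain ⟨L, hL, H⟩ := exists_rhsAt_le_envelope hχ M K 1 b _ zero_le_one (fun _ => b)
    (Envelope.const (by linarith)) (fun _ _ => hb1)
  refine ⟨L * b + A1, by positivity, fun N f hf ξ hξ => ?_⟩
  obtain ⟨h1, h2⟩ := H N f hf (by filter_upwards [hf.bdd] with η hη using henv η _ hη) ξ (henv ξ _ hξ)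
  refine ⟨?_, h2.trans (by linarith), ?_⟩
  · rw [pi_norm_le_iff_of_nonneg (by positivity)]
    intro i
    refine (h1 i).trans (le_trans (mul_le_mul_of_nonneg_left ?_ hL) (le_add_of_nonneg_right hA1))
    unfold wt
    split_ifs
    · exact hb1
    · exact le_rfl
  · have e : (D.withN N).nonloc (fun _ => 1) f ξ = D.loc ξ (f ξ) - (D.withN N).coef f ξ := by
      unfold coef
      change _ = D.loc ξ (f ξ) - (D.loc ξ (f ξ) - _)
      ring
    rw [e]
    refine (abs_sub _ _).trans ?_
    linarith [hA1' ξ _ hξ]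

open Classical in
/-- The right-hand side is Lipschitz up to the contribution of the points that are close to wave
breaking. -/
lemma exists_rhsAt_sub_le (M K : ℝ) : ∃ C, 0 ≤ C ∧ ∀ (N : Set ℝ) (f g : ℝ → Vals)
    (d : ℝ) (N' : Set ℝ), (D.withN N).Profile M K f → (D.withN N).Profile M K g → 0 ≤ d →
    (∀ᵐ η, ‖f η - g η‖ ≤ d) → MeasurableSet N' → volume N' ≠ ⊤ → Measurable (fun η => f η 3) →
    (∀ᵐ η, η ∈ N → η ∉ N' → 0 ≤ f η 3 ∧ 0 ≤ g η 3) → ∀ ξ, ‖f ξ‖ ≤ M → ‖g ξ‖ ≤ M →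
    ‖f ξ - g ξ‖ ≤ d → ‖(D.withN N).rhsAt f ξ - (D.withN N).rhsAt g ξ‖
      ≤ C * (d + ∫ η in N', if |f η 3| ≤ d then 1 else 0) := by
  obtain ⟨Λ, hΛ, hΛ'⟩ := exists_norm_rhsAt_le hχ M K
  obtain ⟨A, hA, hA'⟩ := exists_rhs_sub_le hχ M Λ
  obtain ⟨B, hB, hB'⟩ := exists_nonloc_sub_le hχ M K
  refine ⟨A * (1 + 2 * B), by positivity,
    fun N f g d N' hf hg hd0 hd hN' hNt hf3 hNN ξ hfξ hgξ hξ => ?_⟩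
  have h1 := hA' N ξ (f ξ) (g ξ) ((D.withN N).nonloc (fun _ => 1) f ξ)
    ((D.withN N).nonloc Real.sign f ξ) ((D.withN N).nonloc (fun _ => 1) g ξ)
    ((D.withN N).nonloc Real.sign g ξ) hfξ hgξ (hΛ' N f hf ξ hfξ).2.2
  have h2 := hB' N _ f g d N' isWeight_one hf hg hd0 hd hN' hNt hf3 hNN ξ
  have h3 := hB' N _ f g d N' isWeight_sign hf hg hd0 hd hN' hNt hf3 hNN ξ
  set J := ∫ η in N', if |f η 3| ≤ d then (1 : ℝ) else 0 with hJ
  have hJ0 : 0 ≤ J := integral_nonneg fun η => by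
    change (0 : ℝ) ≤ if |f η 3| ≤ d then 1 else 0
    split_ifs <;> norm_num
  refine h1.trans ?_
  rw [mul_assoc]
  refine mul_le_mul_of_nonneg_left ?_ hA
  have := mul_nonneg hB hJ0
  nlinarith

end Params

/-! ### Measurability -/

namespace Params

variable {D : Params} (hχ : IsPartitionFunction D.χ) (hN : MeasurableSet D.N)

include hN in
lemma measurable_broken : MeasurableSet {p : ℝ × Vals | D.Broken p.1 p.2} := by
  have h3 : Measurable fun p : ℝ × Vals => p.2 3 := (measurable_pi_apply 3).comp measurable_snd
  exact (measurable_fst hN).inter (measurableSet_le measurable_const h3)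

include hχ hN

lemma measurable_tot : Measurable fun p : ℝ × Vals => D.tot p.1 p.2 := by
  have h : ∀ i : Fin 6, Measurable fun p : ℝ × Vals => p.2 i := fun i =>
    (measurable_pi_apply i).comp measurable_snd
  have h0 := h 0
  have h1 := h 1
  have h2 := h 2
  have h4 := h 4
  have h5 := h 5
  have c0 := hχ.smooth.continuous.measurable
  have c1 := hχ.contDiff_deriv.continuous.measurable
  have c2 := hχ.contDiff_deriv_deriv.continuous.measurable
  unfold tot src loc ub srcA
  refine Measurable.add (Measurable.ite (measurable_broken hN) measurable_const ?_) ?_ <;> fun_prop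

lemma measurable_rhs : Measurable fun p : (ℝ × Vals) × ℝ × ℝ => D.rhs p.1.1 p.1.2 p.2.1 p.2.2 := by
  have h : ∀ i : Fin 6, Measurable fun p : (ℝ × Vals) × ℝ × ℝ => p.1.2 i := fun i =>
    (measurable_pi_apply i).comp (measurable_snd.comp measurable_fst)
  have h0 := h 0
  have h1 := h 1
  have h2 := h 2
  have h3 := h 3
  have h4 := h 4
  have h5 := h 5
  have c0 := hχ.smooth.continuous.measurable
  have c1 := hχ.contDiff_deriv.continuous.measurable
  have ht : Measurable fun p : (ℝ × Vals) × ℝ × ℝ => D.trunc p.1.1 p.1.2 := by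
    unfold trunc
    exact Measurable.ite ((measurable_fst.comp measurable_fst) hN) (h3.min measurable_const) h3
  refine measurable_pi_lambda _ fun i => ?_
  unfold rhs loc ub flux
  fin_cases i <;> simp <;> fun_prop

end Params

lemma measurable_pos {Z : ℝ → ℝ → Vals} (hZ : Measurable (Function.uncurry Z))
    (hc : ∀ t, Continuous (pos (Z t))) : Measurable fun p : ℝ × ℝ => pos (Z p.1) p.2 := by
  have h2 : StronglyMeasurable (Function.uncurry fun t x => Z t x 2) :=
    ((measurable_pi_apply 2).comp hZ).stronglyMeasurable
  have h := measurable_uncurry_of_continuous_of_measurable (u := fun ξ t => pos (Z t) ξ)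
    (fun t => hc t) (fun ξ => by
      unfold pos intervalIntegral
      exact (h2.integral_prod_right.sub h2.integral_prod_right).measurable)
  exact h.comp measurable_swap

lemma Params.measurable_nonloc {D : Params} (hχ : IsPartitionFunction D.χ)
    (hN : MeasurableSet D.N) {κ : ℝ → ℝ} (hκ : IsWeight κ) {Z : ℝ → ℝ → Vals}
    (hZ : Measurable (Function.uncurry Z)) (hc : ∀ t, Continuous (pos (Z t))) :
    Measurable fun p : ℝ × ℝ => D.nonloc κ (Z p.1) p.2 := by
  have hp := measurable_pos hZ hc
  have hp1 : Measurable fun q : (ℝ × ℝ) × ℝ => pos (Z q.1.1) q.1.2 := hp.comp measurable_fst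
  have hp2 : Measurable fun q : (ℝ × ℝ) × ℝ => pos (Z q.1.1) q.2 :=
    hp.comp ((measurable_fst.comp measurable_fst).prodMk measurable_snd)
  have hz : Measurable fun q : (ℝ × ℝ) × ℝ => D.tot q.2 (Z q.1.1 q.2) :=
    (Params.measurable_tot hχ hN).comp (measurable_snd.prodMk
      (hZ.comp ((measurable_fst.comp measurable_fst).prodMk measurable_snd)))
  have hk : Measurable fun q : (ℝ × ℝ) × ℝ => κ (q.1.2 - q.2) :=
    hκ.measurable.comp ((measurable_snd.comp measurable_fst).sub measurable_snd)
  have hm : Measurable fun q : (ℝ × ℝ) × ℝ =>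
      κ (q.1.2 - q.2) * ker (Z q.1.1) q.1.2 q.2 * D.tot q.2 (Z q.1.1 q.2) := by
    unfold ker
    exact (hk.mul (Real.measurable_exp.comp (hp1.sub hp2).norm.neg)).mul hz
  exact (hm.stronglyMeasurable.integral_prod_right').measurable.const_mul _

lemma Params.measurable_rhsAt {D : Params} (hχ : IsPartitionFunction D.χ)
    (hN : MeasurableSet D.N) {Z : ℝ → ℝ → Vals}
    (hZ : Measurable (Function.uncurry Z)) (hc : ∀ t, Continuous (pos (Z t))) :
    Measurable fun p : ℝ × ℝ => D.rhsAt (Z p.1) p.2 :=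
  (Params.measurable_rhs hχ hN).comp ((measurable_snd.prodMk hZ).prodMk
    ((Params.measurable_nonloc hχ hN isWeight_one hZ hc).prodMk
      (Params.measurable_nonloc hχ hN isWeight_sign hZ hc)))

/-! ### The setting for the short time existence -/

/-- Everywhere defined initial data together with the constants that govern the construction. -/
structure Setting where
  D : Params
  z₀ : ℝ → Vals
  m : ℝ → ℝ
  (B Cm κ M K L Λ C ρ ε T : ℝ)
  hχ : IsPartitionFunction D.χ
  meas_z₀ : Measurable z₀
  norm_z₀ : ∀ ξ, ‖z₀ ξ‖ ≤ M - 1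
  env : Envelope m B Cm
  memLp_m : MemLp m 2 volume
  one_le_m : ∀ ξ, |ξ| ≤ M + 1 → 1 ≤ m ξ
  env_z₀ : ∀ ξ, D.EnvAt M 1 m ξ (z₀ ξ)
  p_nonneg : ∀ ξ, 0 ≤ z₀ ξ 2
  identity : ∀ ξ, z₀ ξ 2 * z₀ ξ 4 = z₀ ξ 3 ^ 2 + z₀ ξ 5 ^ 2
  κ_pos : 0 < κ
  denom : ∀ ξ, κ ≤ z₀ ξ 2 + z₀ ξ 4
  N_eq : D.N = {ξ | z₀ ξ 2 < ε ∧ z₀ ξ 3 ≤ 0 ∧ z₀ ξ 5 + D.k * z₀ ξ 2 = 0}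
  vol_N : volume (D.N ∩ {ξ | 0 < z₀ ξ 2}) ≠ ⊤
  K_ge : 2 * ∫ x, m x ^ 2 ≤ K
  K_ge' : 2 * M ≤ K
  one_le_L : 1 ≤ L
  rhs_env : ∀ f, D.Profile M K f → (∀ᵐ η, D.EnvAt M (2 + |D.c|) m η (f η)) →
    ∀ ξ, D.EnvAt M (2 + |D.c|) m ξ (f ξ) →
      (∀ i, |D.rhsAt f ξ i| ≤ L * Params.wt m i ξ) ∧ |D.coef f ξ| ≤ L * m ξ
  Λ_nonneg : 0 ≤ Λ
  rhs_norm_withN : ∀ N f, (D.withN N).Profile M K f → ∀ ξ, ‖f ξ‖ ≤ M →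
    ‖(D.withN N).rhsAt f ξ‖ ≤ Λ ∧ |(D.withN N).coef f ξ| ≤ Λ
  C_nonneg : 0 ≤ C
  rhs_lip : open Classical in ∀ (f g : ℝ → Vals) (d : ℝ), D.Profile M K f → D.Profile M K g →
    0 ≤ d → (∀ᵐ η, ‖f η - g η‖ ≤ d) → Measurable (fun η => f η 3) →
    (∀ᵐ η, η ∈ D.N → η ∉ D.N ∩ {ξ | 0 < z₀ ξ 2} → 0 ≤ f η 3 ∧ 0 ≤ g η 3) →
    ∀ ξ, ‖f ξ‖ ≤ M → ‖g ξ‖ ≤ M → ‖f ξ - g ξ‖ ≤ d → ‖D.rhsAt f ξ - D.rhsAt g ξ‖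
      ≤ C * (d + ∫ η in D.N ∩ {ξ | 0 < z₀ ξ 2}, if |f η 3| ≤ d then 1 else 0)
  T_pos : 0 < T
  ε_pos : 0 < ε
  LT_le : L * T ≤ 1
  LBT_le : L * (1 + B) * T ≤ ρ
  ΛT_le : Λ * T ≤ ρ
  ρ_le : ρ ≤ 1 / 2
  ρ_lt : ρ ≤ ε / 2
  small : (ε + ρ) * (1 + Λ + |D.k| * (|D.k| + 1)) ≤ κ / 4
  contr : C * (T + (volume (D.N ∩ {ξ | 0 < z₀ ξ 2})).toReal * (2 / (κ / 4))) ≤ 1 / 2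

/-- The projection to `[0, T]`. -/
def clamp (T t : ℝ) : ℝ := max 0 (min t T)

lemma clamp_mem {T : ℝ} (hT : 0 ≤ T) (t : ℝ) : clamp T t ∈ Icc 0 T :=
  ⟨le_max_left _ _, max_le hT (min_le_right _ _)⟩

lemma clamp_eq {T t : ℝ} (ht : t ∈ Icc 0 T) : clamp T t = t := by
  rw [clamp, min_eq_left ht.2, max_eq_right ht.1]

lemma abs_clamp_sub_le (T s t : ℝ) : |clamp T t - clamp T s| ≤ |t - s| := by
  unfold clamp
  refine (abs_max_sub_max_le_max 0 _ 0 _).trans ?_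
  simp only [sub_self, abs_zero]
  refine max_le (abs_nonneg _) ((abs_min_sub_min_le_max t T s T).trans ?_)
  simp

namespace Setting

variable (S : Setting)

/-- The points where the wave breaks after the initial time. -/
def N' : Set ℝ := S.D.N ∩ {ξ | 0 < S.z₀ ξ 2}

lemma rhs_norm {f : ℝ → Vals} (hf : S.D.Profile S.M S.K f) {ξ : ℝ} (hξ : ‖f ξ‖ ≤ S.M) :
    ‖S.D.rhsAt f ξ‖ ≤ S.Λ ∧ |S.D.coef f ξ| ≤ S.Λ :=
  S.rhs_norm_withN S.D.N f hf ξ hξ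

/-- A lower bound for the slope of `U_ξ` at the breaking candidates. -/
def δ : ℝ := S.κ / 4

lemma δ_pos : 0 < S.δ := by have := S.κ_pos; unfold δ; positivity

lemma meas_coord (i : Fin 6) : Measurable fun ξ => S.z₀ ξ i :=
  (measurable_pi_apply i).comp S.meas_z₀

lemma meas_N : MeasurableSet S.D.N := by
  rw [S.N_eq]
  have h2 := S.meas_coord 2
  exact (measurableSet_lt h2 measurable_const).inter
    ((measurableSet_le (S.meas_coord 3) measurable_const).inter
      (measurableSet_eq_fun ((S.meas_coord 5).add (h2.const_mul _)) measurable_const))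

lemma meas_N' : MeasurableSet S.N' :=
  S.meas_N.inter (measurableSet_lt measurable_const (S.meas_coord 2))

lemma L_nonneg : 0 ≤ S.L := zero_le_one.trans S.one_le_L

lemma M_ge : 1 ≤ S.M := by
  have := (norm_nonneg _).trans (S.norm_z₀ 0)
  linarith

lemma B_nonneg : 0 ≤ S.B := (S.env.nonneg 0).trans (S.env.le_bound 0)

lemma ρ_nonneg : 0 ≤ S.ρ := (mul_nonneg S.Λ_nonneg S.T_pos.le).trans S.ΛT_le

lemma wt_nonneg (i : Fin 6) (ξ : ℝ) : 0 ≤ Params.wt S.m i ξ := by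
  unfold Params.wt
  split_ifs
  · exact zero_le_one
  · exact S.env.nonneg ξ

lemma wt_le (i : Fin 6) (ξ : ℝ) : Params.wt S.m i ξ ≤ 1 + S.B := by
  unfold Params.wt
  split_ifs
  · linarith [S.B_nonneg]
  · linarith [S.env.le_bound ξ]

/-- The class of trajectories on which the solution operator acts. -/
structure Traj (Z : ℝ → ℝ → Vals) : Prop where
  meas : ∀ t, Measurable (Z t)
  init : ∀ ξ, Z 0 ξ = S.z₀ ξ
  eq_clamp : ∀ t ξ, Z t ξ = Z (clamp S.T t) ξ
  lip : ∀ s t ξ i, |Z t ξ i - Z s ξ i| ≤ S.L * Params.wt S.m i ξ * |t - s|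
  slope : ∀ ξ ∈ S.D.N, ∀ s ∈ Icc 0 S.T, ∀ t ∈ Icc 0 S.T, s ≤ t →
    S.δ * (t - s) ≤ Z t ξ 3 - Z s ξ 3

variable {S} {Z W : ℝ → ℝ → Vals}

namespace Traj

lemma abs_sub_init_le (hZ : S.Traj Z) (t ξ : ℝ) (i : Fin 6) :
    |Z t ξ i - S.z₀ ξ i| ≤ S.L * Params.wt S.m i ξ * S.T := by
  rw [hZ.eq_clamp, ← hZ.init]
  refine (hZ.lip 0 _ ξ i).trans (mul_le_mul_of_nonneg_left ?_
    (mul_nonneg S.L_nonneg (S.wt_nonneg i ξ)))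
  have := clamp_mem S.T_pos.le t
  rw [sub_zero, abs_of_nonneg this.1]
  exact this.2

lemma norm_sub_init_le (hZ : S.Traj Z) (t ξ : ℝ) : ‖Z t ξ - S.z₀ ξ‖ ≤ S.ρ := by
  rw [pi_norm_le_iff_of_nonneg S.ρ_nonneg]
  intro i
  refine (hZ.abs_sub_init_le t ξ i).trans (le_trans ?_ S.LBT_le)
  exact mul_le_mul_of_nonneg_right (mul_le_mul_of_nonneg_left (S.wt_le i ξ) S.L_nonneg) S.T_pos.le

lemma norm_le (hZ : S.Traj Z) (t ξ : ℝ) : ‖Z t ξ‖ ≤ S.M := by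
  have h1 := hZ.norm_sub_init_le t ξ
  have h2 := S.norm_z₀ ξ
  have h3 := norm_le_norm_add_norm_sub' (Z t ξ) (S.z₀ ξ)
  linarith [S.ρ_le]

lemma abs_sub_init_le_m (hZ : S.Traj Z) (t ξ : ℝ) {i : Fin 6} (hi : i ≠ 0) :
    |Z t ξ i - S.z₀ ξ i| ≤ S.m ξ := by
  refine (hZ.abs_sub_init_le t ξ i).trans ?_
  have h1 : Params.wt S.m i ξ = S.m ξ := if_neg hi
  rw [h1]
  have := mul_le_mul_of_nonneg_left S.LT_le (S.env.nonneg ξ)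
  linarith

lemma envAt (hZ : S.Traj Z) (t ξ : ℝ) : S.D.EnvAt S.M (2 + |S.D.c|) S.m ξ (Z t ξ) := by
  have h0 := S.env_z₀ ξ
  have hm := S.env.nonneg ξ
  have hcm := mul_nonneg (abs_nonneg S.D.c) hm
  have tri : ∀ {a b : ℝ}, |a - b| ≤ S.m ξ → |b| ≤ 1 * S.m ξ → |a| ≤ (2 + |S.D.c|) * S.m ξ := by
    intro a b h1 h2
    have := abs_sub_abs_le_abs_sub a b
    linarith
  refine ⟨hZ.norm_le t ξ, ?_, tri (hZ.abs_sub_init_le_m t ξ (by decide)) h0.q_le,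
    tri (hZ.abs_sub_init_le_m t ξ (by decide)) h0.h_le,
    tri (hZ.abs_sub_init_le_m t ξ (by decide)) h0.r_le, ?_⟩
  · refine tri (b := S.z₀ ξ 2 - 1) ?_ h0.p_le
    rw [sub_sub_sub_cancel_right]
    exact hZ.abs_sub_init_le_m t ξ (by decide)
  · have h1 := hZ.abs_sub_init_le_m t ξ (i := 1) (by decide)
    have h2 : |S.D.χ (ξ + Z t ξ 0) - S.D.χ (ξ + S.z₀ ξ 0)| ≤ S.m ξ := by
      have n1 := (abs_le_norm (Z t ξ) 0).trans (hZ.norm_le t ξ)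
      have n2 := (abs_le_norm (S.z₀ ξ) 0).trans h0.norm_le
      rw [abs_le] at n1 n2
      by_cases hξ : |ξ| ≤ S.M + 1
      · refine le_trans ?_ (S.one_le_m ξ hξ)
        have a1 := S.hχ.nonneg (ξ + Z t ξ 0)
        have a2 := S.hχ.nonneg (ξ + S.z₀ ξ 0)
        have a3 := S.hχ.le_one (ξ + Z t ξ 0)
        have a4 := S.hχ.le_one (ξ + S.z₀ ξ 0)
        rw [abs_le]
        constructor <;> linarith
      · rw [not_le, lt_abs] at hξ
        rcases hξ with hξ | hξ
        · rw [S.hχ.eq_one _ (by linarith), S.hχ.eq_one _ (by linarith)]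
          simpa using hm
        · rw [S.hχ.eq_zero (by linarith), S.hχ.eq_zero (by linarith)]
          simpa using hm
    have h3 := h0.ub_le
    have e : S.D.ub ξ (Z t ξ) = (Z t ξ 1 - S.z₀ ξ 1)
        - S.D.c * (S.D.χ (ξ + Z t ξ 0) - S.D.χ (ξ + S.z₀ ξ 0)) + S.D.ub ξ (S.z₀ ξ) := by
      unfold Params.ub; ring
    rw [e]
    refine (abs_add_le _ _).trans (le_trans (add_le_add (abs_sub _ _) le_rfl) ?_)
    rw [abs_mul]
    have := mul_le_mul_of_nonneg_left h2 (abs_nonneg S.D.c)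
    linarith

lemma continuous_time (hZ : S.Traj Z) (ξ : ℝ) : Continuous fun t => Z t ξ := by
  refine continuous_pi fun i => ?_
  have hK : 0 ≤ S.L * Params.wt S.m i ξ := mul_nonneg S.L_nonneg (S.wt_nonneg i ξ)
  have : LipschitzWith (Real.toNNReal (S.L * Params.wt S.m i ξ)) fun t => Z t ξ i :=
    LipschitzWith.of_dist_le_mul fun t s => by
      rw [Real.coe_toNNReal _ hK, Real.dist_eq, Real.dist_eq]
      exact hZ.lip s t ξ i
  exact this.continuous

lemma measurable_uncurry (hZ : S.Traj Z) : Measurable (Function.uncurry Z) :=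
  measurable_uncurry_of_continuous_of_measurable hZ.continuous_time hZ.meas

end Traj

/-- A bound by the envelope makes the kernel coercive. -/
lemma coercive_of_env {f : ℝ → Vals} (hf : ∀ a b, IntervalIntegrable (fun x => f x 2) volume a b)
    (h : ∀ ξ, |f ξ 2 - 1| ≤ 2 * S.m ξ) (ξ η : ℝ) :
    1 / 2 * |ξ - η| - S.K ≤ |pos f ξ - pos f η| := by
  wlog hle : η ≤ ξ generalizing ξ η
  · rw [abs_sub_comm, abs_sub_comm (pos f ξ)]
    exact this η ξ (le_of_not_ge hle)
  have hm2 : Integrable fun x => S.m x ^ 2 := by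
    simpa using (memLp_two_iff_integrable_sq_norm S.memLp_m.1).1 S.memLp_m
  refine le_trans ?_ (le_abs_self _)
  unfold pos
  rw [intervalIntegral.integral_interval_sub_left (hf _ _) (hf _ _), abs_of_nonneg (by linarith)]
  have h1 : ∫ x in η..ξ, (1 / 2 - 2 * S.m x ^ 2) ≤ ∫ x in η..ξ, f x 2 := by
    refine intervalIntegral.integral_mono_on hle ?_ (hf _ _) fun x _ => ?_
    · exact intervalIntegrable_const.sub (hm2.intervalIntegrable.const_mul 2)
    · have := (abs_le.1 (h x)).1
      nlinarith [sq_nonneg (2 * S.m x - 1)]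
  rw [intervalIntegral.integral_sub intervalIntegrable_const (hm2.intervalIntegrable.const_mul 2),
    intervalIntegral.integral_const, intervalIntegral.integral_const_mul,
    intervalIntegral.integral_of_le hle] at h1
  have h2 : ∫ x in Ioc η ξ, S.m x ^ 2 ≤ ∫ x, S.m x ^ 2 :=
    setIntegral_le_integral hm2 (Eventually.of_forall fun x => sq_nonneg _)
  have := S.K_ge
  simp only [smul_eq_mul] at h1
  linarith

namespace Traj

lemma profile (hZ : S.Traj Z) (t : ℝ) : S.D.Profile S.M S.K (Z t) := by
  have hint : ∀ a b, IntervalIntegrable (fun x => Z t x 2) volume a b := fun a b => by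
    refine (intervalIntegrable_const (c := S.M)).mono_fun'
      ((measurable_pi_apply 2).comp (hZ.meas t)).aestronglyMeasurable
      (Eventually.of_forall fun x => ?_)
    exact (abs_le_norm _ 2).trans (hZ.norm_le t x)
  refine ⟨hint, ?_, Eventually.of_forall fun η => hZ.norm_le t η, ?_⟩
  · exact ((Params.measurable_tot S.hχ S.meas_N).comp
      (measurable_id.prodMk (hZ.meas t))).aestronglyMeasurable
  · refine coercive_of_env hint fun ξ => ?_
    have h1 := hZ.abs_sub_init_le_m t ξ (i := 2) (by decide)
    have h2 := (S.env_z₀ ξ).p_le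
    have e : Z t ξ 2 - 1 = (Z t ξ 2 - S.z₀ ξ 2) + (S.z₀ ξ 2 - 1) := by ring
    rw [e]
    refine (abs_add_le _ _).trans ?_
    linarith

lemma rhs_le (hZ : S.Traj Z) (t ξ : ℝ) :
    (∀ i, |S.D.rhsAt (Z t) ξ i| ≤ S.L * Params.wt S.m i ξ) ∧ |S.D.coef (Z t) ξ| ≤ S.L * S.m ξ :=
  S.rhs_env _ (hZ.profile t) (Eventually.of_forall fun η => hZ.envAt t η) ξ (hZ.envAt t ξ)

lemma measurable_rhsAt (hZ : S.Traj Z) : Measurable fun p : ℝ × ℝ => S.D.rhsAt (Z p.1) p.2 :=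
  Params.measurable_rhsAt S.hχ S.meas_N hZ.measurable_uncurry
    fun t => (hZ.profile t).continuous_pos

lemma intervalIntegrable_rhsAt (hZ : S.Traj Z) (ξ a b : ℝ) :
    IntervalIntegrable (fun s => S.D.rhsAt (Z s) ξ) volume a b := by
  refine (intervalIntegrable_const (c := S.Λ)).mono_fun'
    (hZ.measurable_rhsAt.comp (measurable_id.prodMk measurable_const)).aestronglyMeasurable
    (Eventually.of_forall fun s => ?_)
  exact (S.rhs_norm (hZ.profile s) (hZ.norm_le s ξ)).1

end Traj

/-- The solution operator. -/
def Phi (S : Setting) (Z : ℝ → ℝ → Vals) (t ξ : ℝ) : Vals :=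
  S.z₀ ξ + ∫ s in (0 : ℝ)..clamp S.T t, S.D.rhsAt (Z s) ξ

lemma eval_intervalIntegral {F : ℝ → Vals} {a b : ℝ} (hF : IntervalIntegrable F volume a b)
    (i : Fin 6) : (∫ s in a..b, F s) i = ∫ s in a..b, F s i :=
  ((ContinuousLinearMap.proj (R := ℝ) (φ := fun _ : Fin 6 => ℝ) i).intervalIntegral_comp_comm
    hF).symm

lemma intervalIntegrable_eval {F : ℝ → Vals} {a b : ℝ} (hF : IntervalIntegrable F volume a b)
    (i : Fin 6) : IntervalIntegrable (fun s => F s i) volume a b :=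
  ⟨(ContinuousLinearMap.proj (R := ℝ) (φ := fun _ : Fin 6 => ℝ) i).integrable_comp hF.1,
    (ContinuousLinearMap.proj (R := ℝ) (φ := fun _ : Fin 6 => ℝ) i).integrable_comp hF.2⟩

lemma Traj.Phi_sub (hZ : S.Traj Z) (s t ξ : ℝ) (i : Fin 6) :
    S.Phi Z t ξ i - S.Phi Z s ξ i
      = ∫ x in clamp S.T s..clamp S.T t, S.D.rhsAt (Z x) ξ i := by
  have hi := hZ.intervalIntegrable_rhsAt ξ
  unfold Phi
  rw [Pi.add_apply, Pi.add_apply, eval_intervalIntegral (hi _ _), eval_intervalIntegral (hi _ _),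
    add_sub_add_left_eq_sub, intervalIntegral.integral_interval_sub_left
      (intervalIntegrable_eval (hi _ _) i) (intervalIntegrable_eval (hi _ _) i)]

/-- Close to initial data at a breaking candidate, `U_ξ` increases with slope at least `δ`. -/
lemma δ_le {z : Vals} {A ξ : ℝ} (h1 : S.z₀ ξ 2 < S.ε)
    (h2 : S.z₀ ξ 5 + S.D.k * S.z₀ ξ 2 = 0) (hz : ‖z - S.z₀ ξ‖ ≤ S.ρ) (hA : |A| ≤ S.Λ) :
    S.δ ≤ 1 / 2 * z 4 + A * z 2 + S.D.k * z 5 := by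
  have hp0 := S.p_nonneg ξ
  have d2 := abs_le.1 ((abs_sub_le_norm z (S.z₀ ξ) 2).trans hz)
  have d4 := abs_le.1 ((abs_sub_le_norm z (S.z₀ ξ) 4).trans hz)
  have d5 := (abs_sub_le_norm z (S.z₀ ξ) 5).trans hz
  have hden := S.denom ξ
  set γ := S.ε + S.ρ with hγ
  have hε := S.ε_pos
  have hρ := S.ρ_nonneg
  have hk := abs_nonneg S.D.k
  have b2 : |z 2| ≤ γ := by rw [abs_le]; constructor <;> linarith
  have r0 : |S.z₀ ξ 5| ≤ |S.D.k| * S.ε := by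
    have : S.z₀ ξ 5 = -(S.D.k * S.z₀ ξ 2) := by linarith
    rw [this, abs_neg, abs_mul, abs_of_nonneg hp0]
    exact mul_le_mul_of_nonneg_left h1.le hk
  have b5 : |z 5| ≤ (|S.D.k| + 1) * γ := by
    have := abs_sub_abs_le_abs_sub (z 5) (S.z₀ ξ 5)
    have e : (|S.D.k| + 1) * γ = |S.D.k| * S.ε + |S.D.k| * S.ρ + S.ε + S.ρ := by rw [hγ]; ring
    have := mul_nonneg hk hρ
    linarith
  have t1 : -(S.Λ * γ) ≤ A * z 2 := by
    have := mul_le_mul hA b2 (abs_nonneg _) S.Λ_nonneg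
    rw [← abs_mul] at this
    exact (abs_le.1 this).1
  have t2 : -(|S.D.k| * ((|S.D.k| + 1) * γ)) ≤ S.D.k * z 5 := by
    have := mul_le_mul_of_nonneg_left b5 hk
    rw [← abs_mul] at this
    exact (abs_le.1 this).1
  have := S.small
  unfold δ
  rw [← hγ] at this
  have hγ0 : 0 ≤ γ := by positivity
  nlinarith

lemma rhsAt_three (f : ℝ → Vals) (ξ : ℝ) : S.D.rhsAt f ξ 3
    = 1 / 2 * f ξ 4 + S.D.coef f ξ * f ξ 2 + S.D.k * f ξ 5 := rfl

lemma Traj.phi (hZ : S.Traj Z) : S.Traj (S.Phi Z) := by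
  have hT := S.T_pos.le
  refine ⟨fun t => ?_, fun ξ => ?_, fun t ξ => ?_, fun s t ξ i => ?_, fun ξ hξ s hs t ht hst => ?_⟩
  · refine S.meas_z₀.add ?_
    simp only [intervalIntegral.integral_of_le (clamp_mem hT t).1]
    have : StronglyMeasurable (Function.uncurry fun ξ s => S.D.rhsAt (Z s) ξ) :=
      (hZ.measurable_rhsAt.comp measurable_swap).stronglyMeasurable
    exact this.integral_prod_right.measurable
  · unfold Phi
    rw [clamp_eq ⟨le_rfl, hT⟩]
    simp
  · unfold Phi
    rw [clamp_eq (clamp_mem hT t)]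
  · rw [hZ.Phi_sub]
    have hK : 0 ≤ S.L * Params.wt S.m i ξ := mul_nonneg S.L_nonneg (S.wt_nonneg i ξ)
    refine (intervalIntegral.norm_integral_le_of_norm_le_const
      (C := S.L * Params.wt S.m i ξ) (f := fun x => S.D.rhsAt (Z x) ξ i) fun x _ => (hZ.rhs_le x ξ).1 i).trans ?_
    exact mul_le_mul_of_nonneg_left (abs_clamp_sub_le _ _ _) hK
  · rw [hZ.Phi_sub, clamp_eq hs, clamp_eq ht]
    have h1 : ∫ _ in s..t, S.δ ≤ ∫ x in s..t, S.D.rhsAt (Z x) ξ 3 := by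
      refine intervalIntegral.integral_mono_on hst intervalIntegrable_const
        (intervalIntegrable_eval (hZ.intervalIntegrable_rhsAt ξ _ _) 3) fun x _ => ?_
      rw [rhsAt_three]
      rw [S.N_eq] at hξ
      exact δ_le hξ.1 hξ.2.2 (hZ.norm_sub_init_le x ξ)
        (S.rhs_norm (hZ.profile x) (hZ.norm_le x ξ)).2
    rw [intervalIntegral.integral_const, smul_eq_mul] at h1
    linarith

end Setting

namespace Setting

variable {S : Setting} {Z W : ℝ → ℝ → Vals}

/-! ### Contraction -/

lemma q_eq_zero_of_mem {ξ : ℝ} (h : ξ ∈ S.D.N) (h' : ξ ∉ S.N') :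
    S.z₀ ξ 2 = 0 ∧ S.z₀ ξ 3 = 0 ∧ S.z₀ ξ 5 = 0 := by
  have h0 : S.z₀ ξ 2 = 0 := by
    by_contra hne
    exact h' ⟨h, lt_of_le_of_ne (S.p_nonneg ξ) (Ne.symm hne)⟩
  have hid := S.identity ξ
  rw [h0, zero_mul] at hid
  refine ⟨h0, ?_, ?_⟩
  · exact pow_eq_zero_iff two_ne_zero |>.1 (by nlinarith [sq_nonneg (S.z₀ ξ 3), sq_nonneg (S.z₀ ξ 5)])
  · exact pow_eq_zero_iff two_ne_zero |>.1 (by nlinarith [sq_nonneg (S.z₀ ξ 3), sq_nonneg (S.z₀ ξ 5)])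

lemma Traj.q_nonneg (hZ : S.Traj Z) {ξ : ℝ} (h : ξ ∈ S.D.N) (h' : ξ ∉ S.N') {t : ℝ}
    (ht : t ∈ Icc 0 S.T) : 0 ≤ Z t ξ 3 := by
  have h1 := hZ.slope ξ h 0 ⟨le_rfl, S.T_pos.le⟩ t ht ht.1
  rw [hZ.init, (q_eq_zero_of_mem h h').2.1] at h1
  have := mul_nonneg S.δ_pos.le ht.1
  linarith

lemma volume_le_of_slope {q : ℝ → ℝ} {δ d t : ℝ} (hδ : 0 < δ)
    (hq : ∀ s ∈ Icc 0 t, ∀ s' ∈ Icc 0 t, s ≤ s' → δ * (s' - s) ≤ q s' - q s) :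
    volume (Ioc 0 t ∩ {s | |q s| ≤ d}) ≤ ENNReal.ofReal (2 / δ * d) := by
  refine (Real.volume_le_diam _).trans (Metric.ediam_le fun x hx y hy => ?_)
  wlog hxy : x ≤ y generalizing x y
  · rw [edist_comm]; exact this y hy x hx (le_of_not_ge hxy)
  rw [edist_dist]
  refine ENNReal.ofReal_le_ofReal ?_
  have h1 := hq x ⟨hx.1.1.le, hx.1.2⟩ y ⟨hy.1.1.le, hy.1.2⟩ hxy
  have h2 : |q x| ≤ d := hx.2
  have h3 : |q y| ≤ d := hy.2
  rw [abs_le] at h2 h3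
  rw [dist_comm, Real.dist_eq, abs_of_nonneg (by linarith), div_mul_eq_mul_div, le_div_iff₀ hδ]
  linarith

open Classical in
/-- The time spent close to wave breaking is controlled by the slope of `U_ξ`. -/
lemma Traj.integral_near_breaking_le (hZ : S.Traj Z) {d t : ℝ} (hd : 0 ≤ d) (ht : t ∈ Icc 0 S.T) :
    IntervalIntegrable (fun s => ∫ η in S.N', if |Z s η 3| ≤ d then (1 : ℝ) else 0) volume 0 t ∧
    ∫ s in (0 : ℝ)..t, (∫ η in S.N', if |Z s η 3| ≤ d then (1 : ℝ) else 0)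
      ≤ (volume S.N').toReal * (2 / S.δ * d) := by
  have h3 : Measurable fun p : ℝ × ℝ => Z p.1 p.2 3 :=
    (measurable_pi_apply 3).comp hZ.measurable_uncurry
  have hm : Measurable (Function.uncurry fun s η => if |Z s η 3| ≤ d then (1 : ℝ) else 0) :=
    Measurable.ite (measurableSet_le h3.norm measurable_const) measurable_const measurable_const
  have : IsFiniteMeasure (volume.restrict S.N') :=
    ⟨by rw [Measure.restrict_apply_univ]; exact lt_top_iff_ne_top.2 S.vol_N⟩
  have hint : Integrable (Function.uncurry fun s η => if |Z s η 3| ≤ d then (1 : ℝ) else 0)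
      ((volume.restrict (Ioc 0 t)).prod (volume.restrict S.N')) := by
    refine (integrable_const (1 : ℝ)).mono' hm.aestronglyMeasurable (Eventually.of_forall fun p => ?_)
    simp only [Function.uncurry]
    split_ifs <;> simp
  refine ⟨?_, ?_⟩
  · rw [intervalIntegrable_iff_integrableOn_Ioc_of_le ht.1]
    exact hint.integral_prod_left
  · rw [intervalIntegral.integral_of_le ht.1, integral_integral_swap hint]
    have hin : ∀ η ∈ S.N', (∫ s in Ioc 0 t, if |Z s η 3| ≤ d then (1 : ℝ) else 0)
        ≤ 2 / S.δ * d := fun η hη => by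
      have hs : MeasurableSet {s : ℝ | |Z s η 3| ≤ d} :=
        measurableSet_le ((h3.comp (measurable_id.prodMk measurable_const)).norm) measurable_const
      have e : (∫ s in Ioc 0 t, if |Z s η 3| ≤ d then (1 : ℝ) else 0)
          = (volume (Ioc 0 t ∩ {s | |Z s η 3| ≤ d})).toReal := by
        have : (fun s => if |Z s η 3| ≤ d then (1 : ℝ) else 0)
            = {s : ℝ | |Z s η 3| ≤ d}.indicator fun _ => 1 := by
          funext s; simp [indicator]
        rw [this, setIntegral_indicator hs]
        simp [Measure.real]
      rw [e]
      have hsl := volume_le_of_slope (q := fun s => Z s η 3) S.δ_pos (d := d) (t := t)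
        fun s hs s' hs' hss' => hZ.slope η hη.1 s ⟨hs.1, hs.2.trans ht.2⟩ s'
          ⟨hs'.1, hs'.2.trans ht.2⟩ hss'
      have h0 : 0 ≤ 2 / S.δ * d := mul_nonneg (div_nonneg zero_le_two S.δ_pos.le) hd
      have := ENNReal.toReal_mono ENNReal.ofReal_ne_top hsl
      rwa [ENNReal.toReal_ofReal h0] at this
    have h4 : ∫ η in S.N', ∫ s in Ioc 0 t, (if |Z s η 3| ≤ d then (1 : ℝ) else 0)
        ≤ ∫ _ in S.N', 2 / S.δ * d :=
      setIntegral_mono_on hint.integral_prod_right (integrable_const _) S.meas_N' hin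
    refine h4.trans (le_of_eq ?_)
    simp [Measure.real]

/-- The contraction estimate. The second trajectory need not belong to the class. -/
lemma Traj.norm_integral_sub_le (hZ : S.Traj Z) {d : ℝ} (hd : 0 ≤ d)
    (hW : ∀ t ∈ Icc 0 S.T, S.D.Profile S.M S.K (W t))
    (hae : ∀ᵐ η, ∀ t ∈ Icc 0 S.T, ‖Z t η - W t η‖ ≤ d)
    (hW3 : ∀ᵐ η, η ∈ S.D.N → η ∉ S.N' → ∀ t ∈ Icc 0 S.T, 0 ≤ W t η 3) {ξ : ℝ}
    (hWM : ∀ t ∈ Icc 0 S.T, ‖W t ξ‖ ≤ S.M) (hξ : ∀ t ∈ Icc 0 S.T, ‖Z t ξ - W t ξ‖ ≤ d) {t : ℝ}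
    (ht : t ∈ Icc 0 S.T) (hint : IntervalIntegrable (fun s => S.D.rhsAt (W s) ξ) volume 0 t) :
    ‖(∫ s in (0 : ℝ)..t, S.D.rhsAt (Z s) ξ) - ∫ s in (0 : ℝ)..t, S.D.rhsAt (W s) ξ‖ ≤ d / 2 := by
  classical
  obtain ⟨hJ, hJ'⟩ := hZ.integral_near_breaking_le hd ht
  rw [← intervalIntegral.integral_sub (hZ.intervalIntegrable_rhsAt ξ 0 t) hint]
  have hpt : ∀ s ∈ Ioc 0 t, ‖S.D.rhsAt (Z s) ξ - S.D.rhsAt (W s) ξ‖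
      ≤ S.C * (d + ∫ η in S.N', if |Z s η 3| ≤ d then (1 : ℝ) else 0) := fun s hs => by
    have hs' : s ∈ Icc 0 S.T := ⟨hs.1.le, hs.2.trans ht.2⟩
    refine S.rhs_lip _ _ d (hZ.profile s) (hW s hs') hd ?_ ?_ ?_ ξ (hZ.norm_le s ξ) (hWM s hs')
      (hξ s hs')
    · filter_upwards [hae] with η hη using hη s hs'
    · exact (measurable_pi_apply 3).comp (hZ.meas s)
    · filter_upwards [hW3] with η hη h1 h2
      exact ⟨hZ.q_nonneg h1 h2 hs', hη h1 h2 s hs'⟩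
  have hci : IntervalIntegrable (fun _ : ℝ => d) volume 0 t := intervalIntegrable_const
  have h1 := intervalIntegral.norm_integral_le_of_norm_le ht.1
    (Eventually.of_forall fun s hs => hpt s hs) ((hci.add hJ).const_mul S.C)
  rw [intervalIntegral.integral_const_mul, intervalIntegral.integral_add hci hJ,
    intervalIntegral.integral_const, smul_eq_mul, sub_zero] at h1
  refine h1.trans ?_
  have h2 : t * d ≤ S.T * d := mul_le_mul_of_nonneg_right ht.2 hd
  have h3 := mul_le_mul_of_nonneg_left (add_le_add h2 hJ') S.C_nonneg
  have h4 := mul_le_mul_of_nonneg_right S.contr hd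
  change S.C * (S.T + (volume S.N').toReal * (2 / S.δ)) * d ≤ _ at h4
  refine h3.trans (le_trans (le_of_eq ?_) (h4.trans (le_of_eq ?_))) <;> ring

/-! ### The fixed point -/

variable (S) in
open Classical in
/-- The trajectory from which the iteration starts: `U_ξ` has slope `δ` at the breaking
candidates, everything else is constant in time. -/
lemma exists_traj : ∃ Z, S.Traj Z := by
  have hT := S.T_pos.le
  have hδ := S.δ_pos
  refine ⟨fun t ξ i => S.z₀ ξ i + if i = 3 ∧ ξ ∈ S.D.N then S.δ * clamp S.T t else 0, fun t => ?_,
    fun ξ => ?_, fun t ξ => ?_, fun s t ξ i => ?_, fun ξ hξ s hs t ht hst => ?_⟩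
  · refine measurable_pi_lambda _ fun i => (S.meas_coord i).add ?_
    refine Measurable.ite ?_ measurable_const measurable_const
    exact (MeasurableSet.const _).inter S.meas_N
  · funext i
    simp [clamp_eq (T := S.T) ⟨le_rfl, hT⟩]
  · rw [clamp_eq (clamp_mem hT t)]
  · have hK : 0 ≤ S.L * Params.wt S.m i ξ := mul_nonneg S.L_nonneg (S.wt_nonneg i ξ)
    rw [add_sub_add_left_eq_sub]
    by_cases h : i = 3 ∧ ξ ∈ S.D.N
    · rw [if_pos h, if_pos h, ← mul_sub, abs_mul, abs_of_pos hδ]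
      refine mul_le_mul ?_ (abs_clamp_sub_le _ _ _) (abs_nonneg _) hK
      have hw : Params.wt S.m i ξ = S.m ξ := if_neg (by rw [h.1]; decide)
      rw [hw]
      have h1 := h.2
      rw [S.N_eq] at h1
      have h2 := S.denom ξ
      have h3 := (le_abs_self _).trans (S.env_z₀ ξ).h_le
      have h4 := S.small
      have h5 := S.ε_pos
      have h6 := S.ρ_nonneg
      have h7 : S.ε ≤ S.κ / 4 := by
        refine le_trans ?_ h4
        have : 0 ≤ S.Λ + |S.D.k| * (|S.D.k| + 1) := by
          have := S.Λ_nonneg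
          positivity
        nlinarith
      have h8 : S.δ ≤ S.m ξ := by
        unfold δ
        linarith [h1.1, S.κ_pos]
      exact h8.trans (le_mul_of_one_le_left (S.env.nonneg ξ) S.one_le_L)
    · rw [if_neg h, if_neg h, sub_zero, abs_zero]
      exact mul_nonneg hK (abs_nonneg _)
  · simp only [hξ, clamp_eq hs, clamp_eq ht]
    simp
    linarith

lemma traj_of_tendsto {u : ℕ → ℝ → ℝ → Vals} (hu : ∀ n, S.Traj (u n))
    (hZ : ∀ t ξ, Tendsto (fun n => u n t ξ) atTop (𝓝 (Z t ξ))) : S.Traj Z := by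
  have hc : ∀ t ξ i, Tendsto (fun n => u n t ξ i) atTop (𝓝 (Z t ξ i)) := fun t ξ i =>
    ((continuous_apply i).tendsto _).comp (hZ t ξ)
  refine ⟨fun t => ?_, fun ξ => ?_, fun t ξ => ?_, fun s t ξ i => ?_, fun ξ hξ s hs t ht hst => ?_⟩
  · exact measurable_of_tendsto_metrizable (fun n => (hu n).meas t)
      (tendsto_pi_nhds.2 fun ξ => hZ t ξ)
  · exact tendsto_nhds_unique (hZ 0 ξ) (by simp only [(hu _).init]; exact tendsto_const_nhds)
  · refine tendsto_nhds_unique (hZ t ξ) ?_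
    simp only [fun n => (hu n).eq_clamp t ξ]
    exact hZ _ ξ
  · exact le_of_tendsto ((hc t ξ i).sub (hc s ξ i)).abs
      (Eventually.of_forall fun n => (hu n).lip s t ξ i)
  · exact ge_of_tendsto ((hc t ξ 3).sub (hc s ξ 3))
      (Eventually.of_forall fun n => (hu n).slope ξ hξ s hs t ht hst)

variable (S) in
lemma exists_fixed : ∃ Z, S.Traj Z ∧ S.Phi Z = Z := by
  obtain ⟨Z₀, hZ₀⟩ := S.exists_traj
  obtain ⟨z, hz, hfix⟩ := exists_fixedPoint (α := ℝ × ℝ) (E := Vals)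
    {z | S.Traj fun t ξ => z (t, ξ)} (fun z p => S.Phi (fun t ξ => z (t, ξ)) p.1 p.2)
    (fun p => Z₀ p.1 p.2) hZ₀ (fun z hz => Traj.phi hz)
    (fun u z hu hz => traj_of_tendsto hu fun t ξ => hz (t, ξ)) 1
    (fun p => by
      have h1 := hZ₀.norm_sub_init_le p.1 p.2
      have h2 := hZ₀.phi.norm_sub_init_le p.1 p.2
      rw [dist_eq_norm]
      have := norm_sub_le_norm_sub_add_norm_sub (Z₀ p.1 p.2) (S.z₀ p.2) (S.Phi Z₀ p.1 p.2)
      rw [norm_sub_rev (S.z₀ p.2)] at this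
      linarith [S.ρ_le])
    (fun z hz w hw d hd p => by
      have hd0 : 0 ≤ d := dist_nonneg.trans (hd p)
      simp only [dist_eq_norm] at hd ⊢
      unfold Phi
      rw [add_sub_add_left_eq_sub]
      exact hz.norm_integral_sub_le hd0 (fun t _ => hw.profile t)
        (Eventually.of_forall fun η t _ => hd (t, η))
        (Eventually.of_forall fun η h1 h2 t ht => hw.q_nonneg h1 h2 ht)
        (fun t _ => hw.norm_le t _) (fun t _ => hd (t, _)) (clamp_mem S.T_pos.le _)
        (hw.intervalIntegrable_rhsAt _ _ _))
  refine ⟨fun t ξ => z (t, ξ), hz, ?_⟩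
  funext t ξ
  exact congrFun hfix (t, ξ)

end Setting

/-! ### Wave breaking times -/

/-- For a continuous `y_ξ`, no breaking up to time `t` means that `y_ξ` is positive on `[0, t]`. -/
lemma mem_unbroken_iff {T : ℝ} {X : ℝ → State} {t ξ : ℝ} (ht : t ∈ Icc 0 T)
    (hc : ContinuousOn (fun s => (X s).yXi ξ) (Icc 0 T)) :
    ξ ∈ unbroken T X t ↔ ∀ s ∈ Icc 0 t, 0 < (X s).yXi ξ := by
  change (t : EReal) < breakingTime T X ξ ↔ _
  unfold breakingTime
  split_ifs with h0
  · constructor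
    · intro h
      exact absurd ht.1 (not_le.2 (EReal.coe_lt_coe_iff.1 h))
    · intro h
      exact absurd h0 (h 0 ⟨le_rfl, ht.1⟩).ne'
  · rw [lt_sSup_iff]
    constructor
    · rintro ⟨_, ⟨r, ⟨-, hr⟩, rfl⟩, htr⟩ s hs
      exact hr s ⟨hs.1, hs.2.trans ht.2⟩ (lt_of_le_of_lt hs.2 (EReal.coe_lt_coe_iff.1 htr))
    · intro h
      have hev : ∀ᶠ s in 𝓝[Icc 0 T] t, 0 < (X s).yXi ξ :=
        (hc t ht).eventually (lt_mem_nhds (h t ⟨ht.1, le_rfl⟩))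
      obtain ⟨e, he, hball⟩ := Metric.mem_nhdsWithin_iff.1 hev
      refine ⟨_, ⟨t + e, ⟨by linarith [ht.1], fun t' ht' hlt => ?_⟩, rfl⟩,
        EReal.coe_lt_coe_iff.2 (by linarith)⟩
      rcases le_or_gt t' t with hle | hgt
      · exact h t' ⟨ht'.1, hle⟩
      · refine hball ⟨?_, ht'⟩
        rw [Metric.mem_ball, Real.dist_eq, abs_of_pos (by linarith)]
        linarith

open Classical in
lemma SolvesODE.min_zero {T : ℝ} {f F : ℝ → ℝ} (hf : SolvesODE T f F)
    (hmono : StrictMonoOn f (Icc 0 T)) :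
    SolvesODE T (fun t => min (f t) 0) (fun t => if f t < 0 then F t else 0) := by
  intro t ht
  have h0 : (0 : ℝ) ∈ Icc 0 T := ⟨le_rfl, ht.1.trans ht.2⟩
  have hneg : ∀ s ∈ Icc 0 T, f s ≤ 0 →
      IntervalIntegrable (fun t => if f t < 0 then F t else 0) volume 0 s ∧
      ∫ x in (0 : ℝ)..s, (if f x < 0 then F x else 0) = f s - f 0 := by
    intro s hs hfs
    have hae : ∀ᵐ x, x ∈ uIoc 0 s → F x = if f x < 0 then F x else 0 := by
      have hne : ∀ᵐ x : ℝ, x ≠ s := by simp [ae_iff, measure_singleton]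
      filter_upwards [hne] with x hx hxI
      rw [uIoc_of_le hs.1] at hxI
      have hxs : x < s := lt_of_le_of_ne hxI.2 hx
      rw [if_pos]
      exact (hmono ⟨hxI.1.le, hxI.2.trans hs.2⟩ hs hxs).trans_le hfs
    refine ⟨(hf s hs).1.congr_ae ((ae_restrict_iff' measurableSet_uIoc).2 hae), ?_⟩
    rw [← intervalIntegral.integral_congr_ae hae]
    linarith [(hf s hs).2]
  have hposz : ∀ s ∈ Icc 0 T, 0 ≤ f s → s ≤ t →
      IntervalIntegrable (fun t => if f t < 0 then F t else 0) volume s t ∧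
      ∫ x in s..t, (if f x < 0 then F x else 0) = 0 := by
    intro s hs hfs hst
    have hE : EqOn (fun _ => (0 : ℝ)) (fun t => if f t < 0 then F t else 0) (uIoc s t) := by
      intro x hx
      rw [uIoc_of_le hst] at hx
      have : f s < f x := hmono hs ⟨hs.1.trans hx.1.le, hx.2.trans ht.2⟩ hx.1
      simp only
      rw [if_neg (by linarith)]
    refine ⟨(intervalIntegrable_const (c := (0 : ℝ))).congr hE, ?_⟩
    rw [← intervalIntegral.integral_congr_ae (Eventually.of_forall hE)]
    simp
  beta_reduce
  rcases le_or_gt (f t) 0 with h | h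
  · obtain ⟨h1, h2⟩ := hneg t ht h
    have : f 0 ≤ 0 := (hmono.monotoneOn h0 ht ht.1).trans h
    refine ⟨h1, ?_⟩
    rw [h2, min_eq_left h, min_eq_left this]
    ring
  · rcases le_or_gt 0 (f 0) with h' | h'
    · obtain ⟨h1, h2⟩ := hposz 0 h0 h' ht.1
      refine ⟨h1, ?_⟩
      rw [h2, min_eq_right h.le, min_eq_right h']
      ring
    · obtain ⟨τ, hτ, hfτ⟩ := intermediate_value_Icc ht.1
        (hf.continuousOn.mono (Icc_subset_Icc_right ht.2)) ⟨h'.le, h.le⟩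
      have hτ' : τ ∈ Icc 0 T := ⟨hτ.1, hτ.2.trans ht.2⟩
      obtain ⟨h1, h2⟩ := hneg τ hτ' hfτ.le
      obtain ⟨h3, h4⟩ := hposz τ hτ' hfτ.ge hτ.2
      refine ⟨h1.trans h3, ?_⟩
      rw [← intervalIntegral.integral_add_adjacent_intervals h1 h3, h2, h4, min_eq_right h.le,
        min_eq_left h'.le, hfτ]
      ring

namespace Setting

variable {S : Setting} {Z : ℝ → ℝ → Vals}

lemma ρ_le_κ : (1 + |S.D.k| * (|S.D.k| + 1)) * (S.ε + S.ρ) ≤ S.κ / 4 ∧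
    S.ε + S.ρ ≤ S.κ / 4 := by
  have h1 := S.small
  have h2 := S.Λ_nonneg
  have h3 := abs_nonneg S.D.k
  have h4 := S.ρ_nonneg
  have h5 := S.ε_pos
  have h6 : 0 ≤ (S.ε + S.ρ) * S.Λ := by positivity
  have h7 : 0 ≤ (S.ε + S.ρ) * (|S.D.k| * (|S.D.k| + 1)) := by positivity
  constructor <;> nlinarith

/-- Initially nonzero density, or initially large `y_ξ`, or increasing `U`, prevents breaking. -/
lemma p_pos_of_notMem {ξ : ℝ} (hξ : ξ ∉ S.D.N) {z : ℝ → Vals} {P Q : ℝ → ℝ}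
    (hz0 : z 0 = S.z₀ ξ) (hcl : ∀ t ∈ Icc 0 S.T, ‖z t - S.z₀ ξ‖ ≤ S.ρ)
    (hid : ∀ t ∈ Icc 0 S.T, z t 2 * z t 4 = z t 3 ^ 2 + z t 5 ^ 2)
    (hcons : ∀ t ∈ Icc 0 S.T, z t 5 + S.D.k * z t 2 = z 0 5 + S.D.k * z 0 2)
    (hp : SolvesODE S.T (fun t => z t 2) P) (hq : SolvesODE S.T (fun t => z t 3) Q)
    (hP : ∀ t ∈ Icc 0 S.T, 0 ≤ z t 3 → 0 ≤ P t)
    (hQ : S.z₀ ξ 2 < S.ε → S.z₀ ξ 5 + S.D.k * S.z₀ ξ 2 = 0 → ∀ t ∈ Icc 0 S.T, 0 ≤ Q t) :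
    ∀ t ∈ Icc 0 S.T, 0 < z t 2 := by
  have h0 : (0 : ℝ) ∈ Icc 0 S.T := ⟨le_rfl, S.T_pos.le⟩
  have hzero : S.z₀ ξ 2 = 0 → S.z₀ ξ 3 = 0 ∧ S.z₀ ξ 5 = 0 := fun h => by
    have h1 := S.identity ξ
    rw [h, zero_mul] at h1
    constructor
    · exact pow_eq_zero_iff two_ne_zero |>.1
        (by nlinarith [sq_nonneg (S.z₀ ξ 3), sq_nonneg (S.z₀ ξ 5)])
    · exact pow_eq_zero_iff two_ne_zero |>.1
        (by nlinarith [sq_nonneg (S.z₀ ξ 3), sq_nonneg (S.z₀ ξ 5)])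
  intro t ht
  by_cases h1 : S.ε ≤ S.z₀ ξ 2
  · have := abs_le.1 ((abs_sub_le_norm (z t) (S.z₀ ξ) 2).trans (hcl t ht))
    linarith [S.ρ_lt, S.ε_pos]
  by_cases h2 : S.z₀ ξ 5 + S.D.k * S.z₀ ξ 2 = 0
  · have h3 : 0 < S.z₀ ξ 3 := by
      by_contra h3
      rw [S.N_eq] at hξ
      exact hξ ⟨not_le.1 h1, not_lt.1 h3, h2⟩
    have hq0 : ∀ s ∈ Icc 0 S.T, 0 ≤ z s 3 := fun s hs => by
      rw [show z s 3 = z 0 3 + _ from (hq s hs).2]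
      refine add_nonneg (by rw [hz0]; exact h3.le) (intervalIntegral.integral_nonneg hs.1 ?_)
      exact fun x hx => hQ (not_le.1 h1) h2 x ⟨hx.1, hx.2.trans hs.2⟩
    rw [show z t 2 = z 0 2 + _ from (hp t ht).2]
    have h4 : 0 < z 0 2 := by
      rw [hz0]
      refine lt_of_le_of_ne (S.p_nonneg ξ) fun h => ?_
      exact h3.ne' (hzero h.symm).1
    refine add_pos_of_pos_of_nonneg h4 (intervalIntegral.integral_nonneg ht.1 fun x hx => ?_)
    have hx' : x ∈ Icc 0 S.T := ⟨hx.1, hx.2.trans ht.2⟩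
    exact hP x hx' (hq0 x hx')
  · by_contra hneg
    have h4 : 0 ≤ z 0 2 := by rw [hz0]; exact S.p_nonneg ξ
    obtain ⟨s, hs, hs0⟩ := intermediate_value_Icc' ht.1
      (hp.continuousOn.mono (Icc_subset_Icc_right ht.2)) ⟨not_lt.1 hneg, h4⟩
    have hs' : s ∈ Icc 0 S.T := ⟨hs.1, hs.2.trans ht.2⟩
    have h5 := hid s hs'
    have h6 := hcons s hs'
    simp only at hs0
    rw [hs0, zero_mul] at h5
    rw [hs0, mul_zero, add_zero, hz0] at h6
    have h7 : z s 5 = 0 := pow_eq_zero_iff two_ne_zero |>.1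
      (by nlinarith [sq_nonneg (z s 3), sq_nonneg (z s 5)])
    exact h2 (by rw [← h6, h7])

/-! ### Pointwise properties of the fixed point -/

lemma solves (hZ : S.Traj Z) (hfix : S.Phi Z = Z) (ξ : ℝ) (i : Fin 6) :
    SolvesODE S.T (fun t => Z t ξ i) (fun t => S.D.rhsAt (Z t) ξ i) := by
  intro t ht
  have hi := hZ.intervalIntegrable_rhsAt ξ 0 t
  refine ⟨intervalIntegrable_eval hi i, ?_⟩
  have h := hZ.Phi_sub 0 t ξ i
  rw [hfix, clamp_eq ht, clamp_eq ⟨le_rfl, S.T_pos.le⟩] at h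
  linarith

variable (hZ : S.Traj Z) (hfix : S.Phi Z = Z)

lemma strictMonoOn_q {Z : ℝ → ℝ → Vals} (hZ : S.Traj Z) {ξ : ℝ} (hξ : ξ ∈ S.D.N) :
    StrictMonoOn (fun t => Z t ξ 3) (Icc 0 S.T) := fun s hs t ht hst => by
  have h1 := hZ.slope ξ hξ s hs t ht hst.le
  have := mul_pos S.δ_pos (sub_pos.2 hst)
  simp only
  linarith

open Classical in
include hZ hfix in
/-- The equation for the cut off `U_ξ`. -/
lemma solves_trunc (ξ : ℝ) : SolvesODE S.T (fun t => S.D.trunc ξ (Z t ξ))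
    (fun t => if S.D.Broken ξ (Z t ξ) then 0 else S.D.rhsAt (Z t) ξ 3) := by
  by_cases hξ : ξ ∈ S.D.N
  · refine ((solves hZ hfix ξ 3).min_zero (strictMonoOn_q hZ hξ)).congr (fun t _ => ?_) fun t _ => ?_
    · simp [Params.trunc, hξ]
    · by_cases h : Z t ξ 3 < 0
      · rw [if_pos h, if_neg fun hb => absurd hb.2 (not_le.2 h)]
      · rw [if_neg h, if_pos ⟨hξ, not_lt.1 h⟩]
  · refine (solves hZ hfix ξ 3).congr (fun t _ => ?_) fun t _ => ?_
    · simp [Params.trunc, hξ]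
    · rw [if_neg fun hb => hξ hb.1]

lemma trunc_of_broken {ξ : ℝ} {z : Vals} (h : S.D.Broken ξ z) : S.D.trunc ξ z = 0 := by
  simp [Params.trunc, h.1, h.2]

include hZ hfix

lemma conserved (ξ : ℝ) : ∀ t ∈ Icc 0 S.T,
    Z t ξ 5 + S.D.k * Z t ξ 2 = S.z₀ ξ 5 + S.D.k * S.z₀ ξ 2 := by
  have h := ((solves hZ hfix ξ 5).add ((solves hZ hfix ξ 2).const_mul S.D.k)).const_of_zero
    fun t _ => by
      change -(S.D.k * S.D.trunc ξ (Z t ξ)) + S.D.k * S.D.trunc ξ (Z t ξ) = 0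
      ring
  intro t ht
  have := h t ht
  simp only [hZ.init] at this
  exact this

lemma identity_of_fixed (ξ : ℝ) : ∀ t ∈ Icc 0 S.T,
    Z t ξ 2 * Z t ξ 4 = S.D.trunc ξ (Z t ξ) ^ 2 + Z t ξ 5 ^ 2 := by
  classical
  have hp := solves hZ hfix ξ 2
  have hh := solves hZ hfix ξ 4
  have hr := solves hZ hfix ξ 5
  have hq := solves_trunc hZ hfix ξ
  have h := ((hp.mul hh).sub ((hq.mul hq).add (hr.mul hr))).const_of_zero fun t ht => by
    change S.D.trunc ξ (Z t ξ) * Z t ξ 4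
      + Z t ξ 2 * (2 * S.D.coef (Z t) ξ * S.D.trunc ξ (Z t ξ))
      - ((if S.D.Broken ξ (Z t ξ) then 0 else S.D.rhsAt (Z t) ξ 3) * S.D.trunc ξ (Z t ξ)
        + S.D.trunc ξ (Z t ξ) * (if S.D.Broken ξ (Z t ξ) then 0 else S.D.rhsAt (Z t) ξ 3)
        + (-(S.D.k * S.D.trunc ξ (Z t ξ)) * Z t ξ 5
          + Z t ξ 5 * -(S.D.k * S.D.trunc ξ (Z t ξ)))) = 0
    by_cases hb : S.D.Broken ξ (Z t ξ)
    · rw [trunc_of_broken hb]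
      ring
    · rw [if_neg hb, rhsAt_three]
      ring
  have h0 : S.D.trunc ξ (S.z₀ ξ) = S.z₀ ξ 3 := by
    by_cases hξ : ξ ∈ S.D.N
    · have : S.z₀ ξ 3 ≤ 0 := by
        rw [S.N_eq] at hξ
        exact hξ.2.1
      simp [Params.trunc, hξ, this]
    · simp [Params.trunc, hξ]
  intro t ht
  have h1 := h t ht
  simp only [hZ.init, h0] at h1
  have := S.identity ξ
  linarith

/-- `y_ξ` is nonnegative and vanishes exactly after breaking. -/
lemma p_pos_iff (ξ : ℝ) : ∀ t ∈ Icc 0 S.T, 0 ≤ Z t ξ 2 ∧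
    (0 < Z t ξ 2 ↔ ¬ S.D.Broken ξ (Z t ξ)) := by
  intro t ht
  by_cases hξ : ξ ∈ S.D.N
  · have hξ' := hξ
    rw [S.N_eq] at hξ'
    have hc := conserved hZ hfix ξ t ht
    rw [hξ'.2.2] at hc
    have hr : Z t ξ 5 = -(S.D.k * Z t ξ 2) := by linarith
    have hid := identity_of_fixed hZ hfix ξ t ht
    rw [hr] at hid
    have d2 := abs_le.1 ((abs_sub_le_norm _ _ 2).trans (hZ.norm_sub_init_le t ξ))
    have d4 := abs_le.1 ((abs_sub_le_norm _ _ 4).trans (hZ.norm_sub_init_le t ξ))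
    obtain ⟨hs1, hs2⟩ := S.ρ_le_κ
    have hpos : 0 < Z t ξ 4 - S.D.k ^ 2 * Z t ξ 2 := by
      have h1 : Z t ξ 2 ≤ S.ε + S.ρ := by linarith [hξ'.1]
      have h2 : S.D.k ^ 2 * Z t ξ 2 ≤ S.D.k ^ 2 * (S.ε + S.ρ) :=
        mul_le_mul_of_nonneg_left h1 (sq_nonneg _)
      have h3 : S.D.k ^ 2 = |S.D.k| * |S.D.k| := by rw [abs_mul_abs_self]; ring
      have h4 := S.denom ξ
      have h5 : 0 ≤ |S.D.k| * (S.ε + S.ρ) :=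
        mul_nonneg (abs_nonneg _) (add_nonneg S.ε_pos.le S.ρ_nonneg)
      have := S.κ_pos
      nlinarith [hξ'.1]
    have hprod : Z t ξ 2 * (Z t ξ 4 - S.D.k ^ 2 * Z t ξ 2) = S.D.trunc ξ (Z t ξ) ^ 2 := by
      linarith
    have hnn : 0 ≤ Z t ξ 2 := by
      by_contra hneg
      have := mul_neg_of_neg_of_pos (not_le.1 hneg) hpos
      linarith [sq_nonneg (S.D.trunc ξ (Z t ξ))]
    refine ⟨hnn, fun hp hb => ?_, fun hb => lt_of_le_of_ne hnn fun h0 => ?_⟩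
    · rw [trunc_of_broken hb] at hprod
      have := mul_pos hp hpos
      linarith
    · rw [← h0, zero_mul] at hprod
      have h1 : S.D.trunc ξ (Z t ξ) = 0 := pow_eq_zero_iff two_ne_zero |>.1 hprod.symm
      have h2 : Z t ξ 3 < 0 := by
        by_contra h
        exact hb ⟨hξ, not_lt.1 h⟩
      simp only [Params.trunc, hξ, if_true, min_eq_left h2.le] at h1
      linarith
  · have htr : ∀ s, S.D.trunc ξ (Z s ξ) = Z s ξ 3 := fun s => by simp [Params.trunc, hξ]
    have h := S.p_pos_of_notMem hξ (hZ.init ξ) (fun t _ => hZ.norm_sub_init_le t ξ)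
      (fun t ht => by rw [← htr]; exact identity_of_fixed hZ hfix ξ t ht)
      (fun t ht => by rw [conserved hZ hfix ξ t ht, hZ.init])
      (solves hZ hfix ξ 2) (solves hZ hfix ξ 3)
      (fun t _ h => by
        change 0 ≤ S.D.trunc ξ (Z t ξ)
        rwa [htr])
      (fun h1 h2 t _ => by
        rw [rhsAt_three]
        exact S.δ_pos.le.trans (δ_le h1 h2 (hZ.norm_sub_init_le t ξ)
          (S.rhs_norm (hZ.profile t) (hZ.norm_le t ξ)).2)) t ht
    exact ⟨h.le, fun _ hb => hξ hb.1, fun _ => h⟩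

omit hfix in
lemma half_κ_le (t ξ : ℝ) : S.κ / 2 ≤ Z t ξ 2 + Z t ξ 4 := by
  have d2 := abs_le.1 ((abs_sub_le_norm _ _ 2).trans (hZ.norm_sub_init_le t ξ))
  have d4 := abs_le.1 ((abs_sub_le_norm _ _ 4).trans (hZ.norm_sub_init_le t ξ))
  linarith [S.denom ξ, S.ρ_le_κ.2, S.ε_pos]

lemma h_nonneg_of_fixed (ξ : ℝ) : ∀ t ∈ Icc 0 S.T, 0 ≤ Z t ξ 4 := by
  intro t ht
  have h1 := (p_pos_iff hZ hfix ξ t ht).1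
  have h2 := identity_of_fixed hZ hfix ξ t ht
  have h3 := half_κ_le hZ t ξ
  have h4 := S.κ_pos
  by_contra hneg
  have h5 : 0 < Z t ξ 2 := by linarith
  have := mul_neg_of_pos_of_neg h5 (not_le.1 hneg)
  nlinarith [sq_nonneg (S.D.trunc ξ (Z t ξ)), sq_nonneg (Z t ξ 5)]

end Setting

/-- The state with given values of the Lagrangian variables. -/
def Params.toState (D : Params) (f : ℝ → Vals) : State where
  zeta ξ := f ξ 0
  Ubar ξ := D.ub ξ (f ξ)
  c := D.c
  zetaXi ξ := f ξ 2 - 1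
  UXi ξ := D.trunc ξ (f ξ)
  h ξ := f ξ 4
  rbar ξ := f ξ 5
  k := D.k

@[simp] lemma Params.toState_yXi (D : Params) (f : ℝ → Vals) (ξ : ℝ) :
    (D.toState f).yXi ξ = f ξ 2 := by
  simp [State.yXi, toState]

@[simp] lemma Params.toState_U (D : Params) (f : ℝ → Vals) (ξ : ℝ) :
    (D.toState f).U D.χ ξ = f ξ 1 := by
  simp [State.U, toState, ub, State.y]

namespace Setting

variable {S : Setting} {Z : ℝ → ℝ → Vals} (hZ : S.Traj Z) (hfix : S.Phi Z = Z)

include hZ hfix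

lemma mem_unbroken_toState_iff {t : ℝ} (ht : t ∈ Icc 0 S.T) (ξ : ℝ) :
    ξ ∈ unbroken S.T (fun t => S.D.toState (Z t)) t ↔ ¬ S.D.Broken ξ (Z t ξ) := by
  rw [mem_unbroken_iff ht]
  · simp only [Params.toState_yXi]
    rw [← (p_pos_iff hZ hfix ξ t ht).2]
    refine ⟨fun h => h t ⟨ht.1, le_rfl⟩, fun h s hs => ?_⟩
    have hs' : s ∈ Icc 0 S.T := ⟨hs.1, hs.2.trans ht.2⟩
    rw [(p_pos_iff hZ hfix ξ s hs').2]
    rw [(p_pos_iff hZ hfix ξ t ht).2] at h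
    intro hb
    exact h ⟨hb.1, hb.2.trans ((strictMonoOn_q hZ hb.1).monotoneOn hs' ht hs.2)⟩
  · simp only [Params.toState_yXi]
    exact ((continuous_apply 2).comp (hZ.continuous_time ξ)).continuousOn

end Setting

/-! ### Derivative of the nonlocal terms -/

namespace Params

variable {D : Params} {M K : ℝ} {f : ℝ → Vals}

lemma Profile.integrable_ker_tot (hχ : IsPartitionFunction D.χ) (hf : D.Profile M K f)
    {κ : ℝ → ℝ} (hκ : IsWeight κ) (ξ : ℝ) :
    Integrable fun η => κ (ξ - η) * ker f ξ η * D.tot η (f η) := by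
  obtain ⟨A, -, hA⟩ := exists_abs_tot_le hχ M
  refine hf.integrable_of_envelope hκ (Envelope.const (B := 1) zero_le_one) (A := A) ?_ ξ
  filter_upwards [hf.bdd] with η hη
  rw [mul_one]
  exact hA D.N η _ hη

lemma pos_hasDerivAE (hf : D.Profile M K f) : HasDerivAE (pos f) fun x => f x 2 := fun a b =>
  ⟨hf.int_p a b, by
    unfold pos
    exact intervalIntegral.integral_interval_sub_left (hf.int_p _ _) (hf.int_p _ _)⟩

/-- The derivative of the nonlocal term with the sign weight. -/
lemma nonloc_sign_hasDerivAE (hχ : IsPartitionFunction D.χ) (hf : D.Profile M K f)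
    (hp : ∀ ξ, 0 ≤ f ξ 2) :
    HasDerivAE (D.nonloc Real.sign f)
      fun ξ => D.tot ξ (f ξ) - f ξ 2 * D.nonloc (fun _ => 1) f ξ := by
  set w := pos f with hw
  set G := fun η => D.tot η (f η) with hG
  have hwd : HasDerivAE w fun x => f x 2 := pos_hasDerivAE hf
  have hmono : Monotone w := fun a b hab => by
    have := (hwd a b).2
    have h2 := intervalIntegral.integral_nonneg (μ := volume) hab fun x _ => hp x
    linarith
  have hI := fun ξ => hf.integrable_ker_tot hχ isWeight_one ξ
  have hS := fun ξ => hf.integrable_ker_tot hχ isWeight_sign ξ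
  have kl : ∀ ξ, ∀ η ∈ Iic ξ, ker f ξ η = Real.exp (-w ξ) * Real.exp (w η) := fun ξ η hη => by
    rw [← Real.exp_add, ker, abs_of_nonneg (sub_nonneg.2 (hmono hη))]
    ring_nf
  have kr : ∀ ξ, ∀ η ∈ Ioi ξ, ker f ξ η = Real.exp (w ξ) * Real.exp (-w η) := fun ξ η hη => by
    rw [← Real.exp_add, ker, abs_of_nonpos (sub_nonpos.2 (hmono (le_of_lt hη)))]
    ring_nf
  have il : ∀ ξ, IntegrableOn (fun η => Real.exp (w η) * G η) (Iic ξ) := fun ξ => by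
    have h : IntegrableOn (fun η => Real.exp (w ξ) * (1 * ker f ξ η * D.tot η (f η))) (Iic ξ) :=
      ((hI ξ).integrableOn).const_mul _
    refine h.congr_fun (fun η hη => ?_) measurableSet_Iic
    simp only [kl ξ η hη, one_mul, hG]
    rw [← mul_assoc, ← mul_assoc, ← Real.exp_add]
    simp
  have ir : ∀ ξ, IntegrableOn (fun η => Real.exp (-w η) * G η) (Ioi ξ) := fun ξ => by
    have h : IntegrableOn (fun η => Real.exp (-w ξ) * (1 * ker f ξ η * D.tot η (f η))) (Ioi ξ) :=
      ((hI ξ).integrableOn).const_mul _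
    refine h.congr_fun (fun η hη => ?_) measurableSet_Ioi
    simp only [kr ξ η hη, one_mul, hG]
    rw [← mul_assoc, ← mul_assoc, ← Real.exp_add]
    simp
  set ML := fun ξ => ∫ η in Iic ξ, Real.exp (w η) * G η with hML
  set MR := fun ξ => ∫ η in Ioi ξ, Real.exp (-w η) * G η with hMR
  have hMLd : HasDerivAE ML fun η => Real.exp (w η) * G η := fun a b =>
    ⟨⟨(il b).mono_set Ioc_subset_Iic_self, (il a).mono_set Ioc_subset_Iic_self⟩,
      intervalIntegral.integral_Iic_sub_Iic (il a) (il b)⟩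
  have hMRd : HasDerivAE MR fun η => -(Real.exp (-w η) * G η) := fun a b => by
    refine ⟨IntervalIntegrable.neg ⟨(ir a).mono_set Ioc_subset_Ioi_self,
      (ir b).mono_set Ioc_subset_Ioi_self⟩, ?_⟩
    rw [intervalIntegral.integral_neg, ← intervalIntegral.integral_Ioi_sub_Ioi' (ir a) (ir b)]
    simp only [hMR]
    ring
  have hexp : HasDerivAE (fun x => Real.exp (w x)) fun x => Real.exp (w x) * f x 2 := by
    simpa using hwd.comp (φ := Real.exp) Real.contDiff_exp
  have hexpn : HasDerivAE (fun x => Real.exp (-w x)) fun x => -(Real.exp (-w x) * f x 2) := by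
    have := (hwd.const_mul (-1)).comp (φ := Real.exp) Real.contDiff_exp
    simpa using this
  have hne : ∀ ξ : ℝ, ∀ᵐ x : ℝ, x ≠ ξ := fun ξ => by simp [ae_iff, measure_singleton]
  have e1 : ∀ ξ, D.nonloc (fun _ => 1) f ξ
      = 1 / 2 * (Real.exp (-w ξ) * ML ξ + Real.exp (w ξ) * MR ξ) := fun ξ => by
    unfold nonloc
    rw [← intervalIntegral.integral_Iic_add_Ioi ((hI ξ).integrableOn) ((hI ξ).integrableOn)]
    congr 2
    · simp only [hML]
      rw [← integral_const_mul]
      refine setIntegral_congr_fun measurableSet_Iic fun η hη => ?_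
      simp only [kl ξ η hη, hG]
      ring
    · simp only [hMR]
      rw [← integral_const_mul]
      refine setIntegral_congr_fun measurableSet_Ioi fun η hη => ?_
      simp only [kr ξ η hη, hG]
      ring
  have e2 : ∀ ξ, D.nonloc Real.sign f ξ
      = 1 / 2 * (Real.exp (-w ξ) * ML ξ - Real.exp (w ξ) * MR ξ) := fun ξ => by
    unfold nonloc
    rw [← intervalIntegral.integral_Iic_add_Ioi ((hS ξ).integrableOn) ((hS ξ).integrableOn),
      sub_eq_add_neg]
    congr 2
    · simp only [hML]
      rw [← integral_const_mul]
      refine setIntegral_congr_ae measurableSet_Iic ?_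
      filter_upwards [hne ξ] with η hη hηξ
      rw [kl ξ η hηξ, Real.sign_of_pos (sub_pos.2 (lt_of_le_of_ne hηξ hη))]
      ring
    · simp only [hMR]
      rw [← integral_const_mul, ← integral_neg]
      refine setIntegral_congr_fun measurableSet_Ioi fun η hη => ?_
      simp only [kr ξ η hη, hG, Real.sign_of_neg (sub_neg.2 (mem_Ioi.1 hη))]
      ring
  refine (((hexpn.mul hMLd).sub (hexp.mul hMRd)).const_mul (1 / 2)).congr (fun x => (e2 x).symm)
    (Eventually.of_forall fun x => ?_)
  simp only
  rw [e1]
  have h1 : Real.exp (-w x) * Real.exp (w x) = 1 := by rw [← Real.exp_add]; simp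
  change _ = G x - _
  linear_combination (G x) * h1

end Params

/-! ### The functions `y_ξ` and `U_ξ` are derivatives -/

lemma isFiniteMeasure_restrict_uIoc (a b : ℝ) :
    IsFiniteMeasure ((volume : Measure ℝ).restrict (uIoc a b)) :=
  ⟨by rw [Measure.restrict_apply_univ, uIoc]; exact measure_Ioc_lt_top⟩

section Swap

variable {g : ℝ → ℝ → ℝ} (hg : Measurable (Function.uncurry g)) {C : ℝ} (hC : ∀ s x, |g s x| ≤ C)

include hg hC

/-- Interchanging the order of two interval integrals of a bounded function. -/
lemma integral_swap_of_bounded (a b c d : ℝ) :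
    ∫ x in a..b, ∫ s in c..d, g s x = ∫ s in c..d, ∫ x in a..b, g s x := by
  have h1 := isFiniteMeasure_restrict_uIoc a b
  have h2 := isFiniteMeasure_restrict_uIoc c d
  refine intervalIntegral_intervalIntegral_swap (F := fun x s => g s x) ?_
  rw [IntegrableOn, Measure.volume_eq_prod, ← Measure.prod_restrict]
  refine (integrable_const C).mono' (hg.comp measurable_swap).aestronglyMeasurable
    (Eventually.of_forall fun p => hC _ _)

lemma intervalIntegrable_of_bounded (s a b : ℝ) : IntervalIntegrable (g s) volume a b :=
  (intervalIntegrable_const (c := C)).mono_fun'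
    (hg.comp (measurable_const.prodMk measurable_id)).aestronglyMeasurable
    (Eventually.of_forall fun x => hC s x)

lemma intervalIntegrable_integral_of_bounded (a b c d : ℝ) :
    IntervalIntegrable (fun s => ∫ x in a..b, g s x) volume c d := by
  refine (intervalIntegrable_const (c := C * |b - a|)).mono_fun' ?_
    (Eventually.of_forall fun s => ?_)
  · have h := hg.stronglyMeasurable
    unfold intervalIntegral
    exact (h.integral_prod_right.sub h.integral_prod_right).aestronglyMeasurable
  · exact intervalIntegral.norm_integral_le_of_norm_le_const fun x _ => hC s x

end Swap

/-- Integrated exponential bounds. -/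
lemma abs_integral_le_exp {f : ℝ → ℝ} {d l t : ℝ} (hd : 0 ≤ d) (hl : 0 < l)
    (ht : 0 ≤ t) (h : ∀ s ∈ Icc 0 t, |f s| ≤ d * Real.exp (l * s)) :
    |∫ s in (0 : ℝ)..t, f s| ≤ d / l * Real.exp (l * t) := by
  have hF : ∀ s ∈ uIcc 0 t, HasDerivAt (fun s => d / l * Real.exp (l * s))
      (d * Real.exp (l * s)) s := fun s _ => by
    have := (((hasDerivAt_id s).const_mul l).exp).const_mul (d / l)
    refine this.congr_deriv ?_
    simp only [id]
    field_simp
  have hc : IntervalIntegrable (fun s => d * Real.exp (l * s)) volume 0 t :=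
    Continuous.intervalIntegrable (by fun_prop) _ _
  rw [← Real.norm_eq_abs]
  refine (intervalIntegral.norm_integral_le_of_norm_le (f := f) ht (Eventually.of_forall fun s hs =>
    h s ⟨hs.1.le, hs.2⟩) hc).trans ?_
  rw [intervalIntegral.integral_eq_sub_of_hasDerivAt hF hc]
  have : 0 ≤ d / l * Real.exp (l * 0) := by positivity
  linarith

namespace Setting

variable {S : Setting} {Z : ℝ → ℝ → Vals} (hZ : S.Traj Z) (hfix : S.Phi Z = Z)

lemma measurable_trunc : Measurable fun p : ℝ × Vals => S.D.trunc p.1 p.2 := by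
  have h3 : Measurable fun p : ℝ × Vals => p.2 3 := (measurable_pi_apply 3).comp measurable_snd
  unfold Params.trunc
  exact Measurable.ite (measurable_fst S.meas_N) (h3.min measurable_const) h3

include hZ in
lemma measurable_trunc_traj : Measurable (Function.uncurry fun s x => S.D.trunc x (Z s x)) :=
  measurable_trunc.comp (measurable_snd.prodMk hZ.measurable_uncurry)

include hZ in
lemma abs_trunc_traj_le (s x : ℝ) : |S.D.trunc x (Z s x)| ≤ S.M :=
  (Params.abs_trunc_le x _).trans ((abs_le_norm _ 3).trans (hZ.norm_le s x))

lemma trunc_init (ξ : ℝ) : S.D.trunc ξ (S.z₀ ξ) = S.z₀ ξ 3 := by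
  by_cases hξ : ξ ∈ S.D.N
  · have : S.z₀ ξ 3 ≤ 0 := by
      rw [S.N_eq] at hξ
      exact hξ.2.1
    simp [Params.trunc, hξ, this]
  · simp [Params.trunc, hξ]

include hZ hfix

lemma rhs_trunc_eq (t ξ : ℝ) (ht : t ∈ Icc 0 S.T) [Decidable (S.D.Broken ξ (Z t ξ))] :
    (if S.D.Broken ξ (Z t ξ) then 0 else S.D.rhsAt (Z t) ξ 3)
      = S.D.tot ξ (Z t ξ) - Z t ξ 2 * S.D.nonloc (fun _ => 1) (Z t) ξ - S.D.srcA ξ (Z t ξ) := by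
  unfold Params.tot
  by_cases hb : S.D.Broken ξ (Z t ξ)
  · have h0 : Z t ξ 2 = 0 := by
      have := p_pos_iff hZ hfix ξ t ht
      by_contra hne
      exact this.2.1 (lt_of_le_of_ne this.1 (Ne.symm hne)) hb
    simp [hb, h0]
  · simp only [hb, if_false]
    rw [rhsAt_three]
    unfold Params.src Params.coef
    ring

omit hfix in
open Classical in
lemma measurable_rhs_trunc : Measurable (Function.uncurry fun s x =>
    if S.D.Broken x (Z s x) then 0 else S.D.rhsAt (Z s) x 3) := by
  refine Measurable.ite ?_ measurable_const ((measurable_pi_apply 3).comp hZ.measurable_rhsAt)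
  exact (measurable_snd.prodMk hZ.measurable_uncurry) (Params.measurable_broken S.meas_N)

omit hfix in
open Classical in
lemma abs_rhs_trunc_le (s x : ℝ) :
    |if S.D.Broken x (Z s x) then 0 else S.D.rhsAt (Z s) x 3| ≤ S.Λ := by
  split_ifs
  · rw [abs_zero]; exact S.Λ_nonneg
  · exact (abs_le_norm _ 3).trans (S.rhs_norm (hZ.profile s) (hZ.norm_le s x)).1

/-- The failure of `y_ξ` to be the derivative of `y` is the time integral of that of `U_ξ`. -/
lemma defect_y_eq (h0 : HasDerivAE (fun ξ => S.z₀ ξ 0) fun ξ => S.z₀ ξ 2 - 1) {t : ℝ}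
    (ht : t ∈ Icc 0 S.T) (a x : ℝ) :
    (x + Z t x 0) - (a + Z t a 0) - ∫ η in a..x, Z t η 2
      = ∫ s in (0 : ℝ)..t, (Z s x 1 - Z s a 1 - ∫ η in a..x, S.D.trunc η (Z s η)) := by
  have hm := measurable_trunc_traj hZ
  have hb := abs_trunc_traj_le hZ
  have c : ∀ ξ, IntervalIntegrable (fun s => Z s ξ 1) volume 0 t :=
    fun ξ => ((continuous_apply 1).comp (hZ.continuous_time ξ)).intervalIntegrable _ _
  rw [intervalIntegral.integral_sub ((c x).sub (c a))
    (intervalIntegrable_integral_of_bounded hm hb a x 0 t),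
    intervalIntegral.integral_sub (c x) (c a), ← integral_swap_of_bounded hm hb]
  have e0 : ∀ ξ, Z t ξ 0 = S.z₀ ξ 0 + ∫ s in (0 : ℝ)..t, Z s ξ 1 := fun ξ => by
    rw [← hZ.init]
    exact (solves hZ hfix ξ 0 t ht).2
  have e2 : ∀ ξ, Z t ξ 2 = (S.z₀ ξ 2 - 1) + 1 + ∫ s in (0 : ℝ)..t, S.D.trunc ξ (Z s ξ) := fun ξ => by
    rw [← hZ.init, sub_add_cancel]
    exact (solves hZ hfix ξ 2 t ht).2
  have h1 : ∫ η in a..x, Z t η 2 = (∫ η in a..x, ((S.z₀ η 2 - 1) + 1))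
      + ∫ η in a..x, ∫ s in (0 : ℝ)..t, S.D.trunc η (Z s η) := by
    rw [← intervalIntegral.integral_add]
    · exact intervalIntegral.integral_congr fun η _ => e2 η
    · exact (h0 a x).1.add intervalIntegrable_const
    · exact intervalIntegrable_integral_of_bounded (g := fun η s => S.D.trunc η (Z s η))
        (hm.comp measurable_swap) (fun s x => hb x s) _ _ _ _
  rw [h1, e0, e0, intervalIntegral.integral_add (h0 a x).1 intervalIntegrable_const, ← (h0 a x).2,
    intervalIntegral.integral_const]
  simp only [smul_eq_mul, mul_one]
  ring

open Classical in
lemma defect_U_eq (h1 : HasDerivAE (fun ξ => S.z₀ ξ 1) fun ξ => S.z₀ ξ 3) {t : ℝ}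
    (ht : t ∈ Icc 0 S.T) (a x : ℝ) :
    Z t x 1 - Z t a 1 - ∫ η in a..x, S.D.trunc η (Z t η)
      = ∫ s in (0 : ℝ)..t, ((∫ η in a..x, S.D.srcA η (Z s η))
        - (S.D.flux x (Z s x) - S.D.flux a (Z s a))) := by
  have hm := measurable_rhs_trunc hZ
  have hb := abs_rhs_trunc_le hZ
  have c : ∀ ξ, IntervalIntegrable (fun s => S.D.rhsAt (Z s) ξ 1) volume 0 t :=
    fun ξ => intervalIntegrable_eval (hZ.intervalIntegrable_rhsAt ξ 0 t) 1
  have e1 : ∀ ξ, Z t ξ 1 = S.z₀ ξ 1 + ∫ s in (0 : ℝ)..t, S.D.rhsAt (Z s) ξ 1 := fun ξ => by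
    rw [← hZ.init]
    exact (solves hZ hfix ξ 1 t ht).2
  have e3 : ∀ ξ, S.D.trunc ξ (Z t ξ) = S.z₀ ξ 3 + ∫ s in (0 : ℝ)..t,
      if S.D.Broken ξ (Z s ξ) then 0 else S.D.rhsAt (Z s) ξ 3 := fun ξ => by
    rw [← trunc_init (S := S), ← hZ.init]
    exact (solves_trunc hZ hfix ξ t ht).2
  have h2 : ∫ η in a..x, S.D.trunc η (Z t η) = (∫ η in a..x, S.z₀ η 3)
      + ∫ s in (0 : ℝ)..t, ∫ η in a..x,
        if S.D.Broken η (Z s η) then 0 else S.D.rhsAt (Z s) η 3 := by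
    rw [← integral_swap_of_bounded hm hb, ← intervalIntegral.integral_add (h1 a x).1]
    · exact intervalIntegral.integral_congr fun η _ => e3 η
    · exact intervalIntegrable_integral_of_bounded
        (g := fun η s => if S.D.Broken η (Z s η) then 0 else S.D.rhsAt (Z s) η 3)
        (hm.comp measurable_swap) (fun s x => hb x s) _ _ _ _
  have h3 : Z t x 1 - Z t a 1 - ∫ η in a..x, S.D.trunc η (Z t η)
      = ∫ s in (0 : ℝ)..t, (S.D.rhsAt (Z s) x 1 - S.D.rhsAt (Z s) a 1 - ∫ η in a..x,
        if S.D.Broken η (Z s η) then 0 else S.D.rhsAt (Z s) η 3) := by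
    rw [intervalIntegral.integral_sub ((c x).sub (c a))
      (intervalIntegrable_integral_of_bounded hm hb a x 0 t),
      intervalIntegral.integral_sub (c x) (c a), h2, e1, e1, ← (h1 a x).2]
    ring
  rw [h3]
  refine intervalIntegral.integral_congr fun s hs => ?_
  rw [uIcc_of_le ht.1] at hs
  have hs' : s ∈ Icc 0 S.T := ⟨hs.1, hs.2.trans ht.2⟩
  have hnl := Params.nonloc_sign_hasDerivAE S.hχ (hZ.profile s)
    (fun ξ => (p_pos_iff hZ hfix ξ s hs').1) a x
  have hsA : IntervalIntegrable (fun η => S.D.srcA η (Z s η)) volume a x := by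
    obtain ⟨A, -, hA, -⟩ := Params.locLip_srcA S.hχ S.M
    refine (intervalIntegrable_const (c := A)).mono_fun' ?_
      (Eventually.of_forall fun η => hA η _ (hZ.norm_le s η))
    refine Measurable.aestronglyMeasurable ?_
    exact (measurable_const.mul (S.hχ.contDiff_deriv_flux.continuous.measurable.comp
      (measurable_id.add ((measurable_pi_apply 0).comp (hZ.meas s))))).mul
      ((measurable_pi_apply 2).comp (hZ.meas s))
  have e : ∫ η in a..x, (if S.D.Broken η (Z s η) then 0 else S.D.rhsAt (Z s) η 3)
      = (S.D.nonloc Real.sign (Z s) x - S.D.nonloc Real.sign (Z s) a)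
        - ∫ η in a..x, S.D.srcA η (Z s η) := by
    rw [hnl.2, ← intervalIntegral.integral_sub hnl.1 hsA]
    exact intervalIntegral.integral_congr fun η _ => rhs_trunc_eq hZ hfix s η hs'
  rw [e]
  change (-S.D.flux x (Z s x) + S.D.nonloc Real.sign (Z s) x)
    - (-S.D.flux a (Z s a) + S.D.nonloc Real.sign (Z s) a) - _ = _
  ring

omit hfix in
/-- Estimate of the defect of the chain rule for the flux. -/
lemma exists_flux_defect_le {a b : ℝ} (hab : a ≤ b) : ∃ C, 0 ≤ C ∧ ∀ s e, ∀ x ∈ Icc a b,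
    (∀ η ∈ Icc a b, |(η + Z s η 0) - (a + Z s a 0) - ∫ η in a..η, Z s η 2| ≤ e) →
    |(∫ η in a..x, S.D.srcA η (Z s η)) - (S.D.flux x (Z s x) - S.D.flux a (Z s a))| ≤ C * e := by
  obtain ⟨C1, hC1, -, hl1⟩ := S.hχ.bddLip_flux
  obtain ⟨C2, hC2, hb2, hl2⟩ := S.hχ.bddLip_deriv_flux
  have hc : 0 ≤ 2 * S.D.c ^ 2 := by positivity
  have hM : 0 ≤ S.M := zero_le_one.trans S.M_ge
  refine ⟨2 * S.D.c ^ 2 * (C1 + C2 * S.M * (b - a)),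
    mul_nonneg hc (add_nonneg hC1 (mul_nonneg (mul_nonneg hC2 hM) (sub_nonneg.2 hab))),
    fun s e x hx he => ?_⟩
  have hp := (hZ.profile s).int_p
  set v : ℝ → ℝ := fun η => (a + Z s a 0) + ∫ η in a..η, Z s η 2 with hv
  have hvd : HasDerivAE v fun η => Z s η 2 := fun x y => ⟨hp x y, by
    rw [hv]
    simp only [add_sub_add_left_eq_sub]
    exact intervalIntegral.integral_interval_sub_left (hp _ _) (hp _ _)⟩
  have hve : ∀ η ∈ Icc a b, |(η + Z s η 0) - v η| ≤ e := fun η hη => by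
    have := he η hη
    rwa [sub_sub] at this
  have hva : v a = a + Z s a 0 := by simp [hv]
  have hcomp := hvd.comp S.hχ.contDiff_flux a x
  simp only [S.hχ.deriv_flux] at hcomp
  set ψ : ℝ → ℝ := fun x => deriv S.D.χ x ^ 2 + S.D.χ x * deriv (deriv S.D.χ) x with hψ
  have hsA : IntervalIntegrable (fun η => ψ (η + Z s η 0) * Z s η 2) volume a x := by
    refine (intervalIntegrable_const (c := C2 * S.M)).mono_fun' ?_
      (Eventually.of_forall fun η => ?_)
    · exact ((S.hχ.contDiff_deriv_flux.continuous.measurable.comp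
        (measurable_id.add ((measurable_pi_apply 0).comp (hZ.meas s)))).mul
        ((measurable_pi_apply 2).comp (hZ.meas s))).aestronglyMeasurable
    · beta_reduce
      rw [Real.norm_eq_abs, abs_mul]
      exact mul_le_mul (hb2 _) ((abs_le_norm _ 2).trans (hZ.norm_le s η)) (abs_nonneg _) hC2
  have e1 : (∫ η in a..x, S.D.srcA η (Z s η)) - (S.D.flux x (Z s x) - S.D.flux a (Z s a))
      = 2 * S.D.c ^ 2 * ((∫ η in a..x, (ψ (η + Z s η 0) * Z s η 2 - ψ (v η) * Z s η 2))
        - (S.D.χ (x + Z s x 0) * deriv S.D.χ (x + Z s x 0) - S.D.χ (v x) * deriv S.D.χ (v x))) := by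
    rw [intervalIntegral.integral_sub hsA hcomp.1, ← hcomp.2, hva]
    have : ∫ η in a..x, S.D.srcA η (Z s η)
        = 2 * S.D.c ^ 2 * ∫ η in a..x, ψ (η + Z s η 0) * Z s η 2 := by
      rw [← intervalIntegral.integral_const_mul]
      refine intervalIntegral.integral_congr fun η _ => ?_
      simp only [Params.srcA, hψ]
      ring
    rw [this]
    unfold Params.flux
    ring
  have he0 : 0 ≤ e := (abs_nonneg _).trans (hve x hx)
  have e2 : |∫ η in a..x, (ψ (η + Z s η 0) * Z s η 2 - ψ (v η) * Z s η 2)|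
      ≤ C2 * e * S.M * (b - a) := by
    rw [← Real.norm_eq_abs]
    refine (intervalIntegral.norm_integral_le_of_norm_le_const (C := C2 * e * S.M)
      fun η hη => ?_).trans ?_
    · rw [uIoc_of_le hx.1] at hη
      rw [← sub_mul, Real.norm_eq_abs, abs_mul]
      refine mul_le_mul ((hl2 _ _).trans ?_) ((abs_le_norm _ 2).trans (hZ.norm_le s η))
        (abs_nonneg _) (mul_nonneg hC2 he0)
      exact mul_le_mul_of_nonneg_left (hve η ⟨hη.1.le, hη.2.trans hx.2⟩) hC2
    · rw [abs_of_nonneg (sub_nonneg.2 hx.1)]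
      exact mul_le_mul_of_nonneg_left (by linarith [hx.2])
        (mul_nonneg (mul_nonneg hC2 he0) hM)
  have e3 := (hl1 (x + Z s x 0) (v x)).trans (mul_le_mul_of_nonneg_left (hve x hx) hC1)
  rw [e1, abs_mul, abs_of_nonneg hc, mul_assoc (2 * S.D.c ^ 2)]
  refine mul_le_mul_of_nonneg_left ((abs_sub _ _).trans ((add_le_add e2 e3).trans ?_)) hc
  exact le_of_eq (by ring)

/-- One step of the Gronwall argument for the compatibility of the derivatives. -/
lemma compat_step {a b : ℝ} (hab : a ≤ b)
    (h0 : HasDerivAE (fun ξ => S.z₀ ξ 0) fun ξ => S.z₀ ξ 2 - 1)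
    (h1 : HasDerivAE (fun ξ => S.z₀ ξ 1) fun ξ => S.z₀ ξ 3) : ∃ l : ℝ, 0 < l ∧ ∀ d,
    (∀ t ∈ Icc 0 S.T, ∀ x ∈ Icc a b,
      |(x + Z t x 0) - (a + Z t a 0) - ∫ η in a..x, Z t η 2| ≤ d * Real.exp (l * t) ∧
      |Z t x 1 - Z t a 1 - ∫ η in a..x, S.D.trunc η (Z t η)| ≤ d * Real.exp (l * t)) →
    (∀ t ∈ Icc 0 S.T, ∀ x ∈ Icc a b,
      |(x + Z t x 0) - (a + Z t a 0) - ∫ η in a..x, Z t η 2| ≤ d / 2 * Real.exp (l * t) ∧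
      |Z t x 1 - Z t a 1 - ∫ η in a..x, S.D.trunc η (Z t η)| ≤ d / 2 * Real.exp (l * t)) := by
  obtain ⟨C, hC, hF⟩ := exists_flux_defect_le hZ hab
  refine ⟨2 + 2 * C, by positivity, fun d hd t ht x hx => ?_⟩
  have hl : 0 < 2 + 2 * C := by positivity
  have hd0 : 0 ≤ d := by
    have := (abs_nonneg _).trans (hd 0 ⟨le_rfl, S.T_pos.le⟩ x hx).1
    simpa using this
  have hsub : ∀ s ∈ Icc 0 t, s ∈ Icc 0 S.T := fun s hs => ⟨hs.1, hs.2.trans ht.2⟩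
  constructor
  · rw [defect_y_eq hZ hfix h0 ht]
    refine (abs_integral_le_exp hd0 hl ht.1 fun s hs => (hd s (hsub s hs) x hx).2).trans ?_
    refine mul_le_mul_of_nonneg_right ?_ (Real.exp_pos _).le
    exact div_le_div_of_nonneg_left hd0 two_pos (by linarith)
  · rw [defect_U_eq hZ hfix h1 ht]
    refine (abs_integral_le_exp (d := C * d) (mul_nonneg hC hd0) hl ht.1 fun s hs => ?_).trans ?_
    · rw [mul_assoc]
      exact hF s _ x hx fun η hη => (hd s (hsub s hs) η hη).1
    · refine mul_le_mul_of_nonneg_right ?_ (Real.exp_pos _).le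
      rw [div_le_div_iff₀ hl two_pos]
      nlinarith

variable (h0 : HasDerivAE (fun ξ => S.z₀ ξ 0) fun ξ => S.z₀ ξ 2 - 1)
    (h1 : HasDerivAE (fun ξ => S.z₀ ξ 1) fun ξ => S.z₀ ξ 3)

include h0 h1

lemma compat_aux {t : ℝ} (ht : t ∈ Icc 0 S.T) {a b : ℝ} (hab : a ≤ b) :
    (b + Z t b 0) - (a + Z t a 0) = ∫ η in a..b, Z t η 2 ∧
    Z t b 1 - Z t a 1 = ∫ η in a..b, S.D.trunc η (Z t η) := by
  obtain ⟨l, hl, hstep⟩ := compat_step hZ hfix hab h0 h1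
  have hM : 0 ≤ S.M := zero_le_one.trans S.M_ge
  have hi : ∀ {u : ℝ → ℝ} (x : ℝ), x ∈ Icc a b → (∀ η, |u η| ≤ S.M) →
      |∫ η in a..x, u η| ≤ S.M * (b - a) := fun {u} x hx hu => by
    rw [← Real.norm_eq_abs]
    refine (intervalIntegral.norm_integral_le_of_norm_le_const (C := S.M) (f := u)
      fun η _ => hu η).trans ?_
    rw [abs_of_nonneg (sub_nonneg.2 hx.1)]
    exact mul_le_mul_of_nonneg_left (by linarith [hx.2]) hM
  have hc : ∀ s ξ i, |Z s ξ i| ≤ S.M := fun s ξ i => (abs_le_norm _ i).trans (hZ.norm_le s ξ)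
  have hbase : ∀ t ∈ Icc 0 S.T, ∀ x ∈ Icc a b,
      |(x + Z t x 0) - (a + Z t a 0) - ∫ η in a..x, Z t η 2|
        ≤ ((b - a) + 2 * S.M + S.M * (b - a)) * Real.exp (l * t) ∧
      |Z t x 1 - Z t a 1 - ∫ η in a..x, S.D.trunc η (Z t η)|
        ≤ ((b - a) + 2 * S.M + S.M * (b - a)) * Real.exp (l * t) := fun s hs x hx => by
    have he : 1 ≤ Real.exp (l * s) := Real.one_le_exp (mul_nonneg hl.le hs.1)
    have hba := sub_nonneg.2 hab
    have hD : 0 ≤ (b - a) + 2 * S.M + S.M * (b - a) := by positivity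
    have hD' := le_mul_of_one_le_right hD he
    have i1 := abs_le.1 (hi x hx fun η => hc s η 2)
    have i2 := abs_le.1 (hi x hx fun η => abs_trunc_traj_le hZ s η)
    have j1 := abs_le.1 (hc s x 0)
    have j2 := abs_le.1 (hc s a 0)
    have j3 := abs_le.1 (hc s x 1)
    have j4 := abs_le.1 (hc s a 1)
    constructor
    · refine le_trans (abs_le.2 ⟨?_, ?_⟩) hD' <;> linarith [hx.1, hx.2]
    · refine le_trans (abs_le.2 ⟨?_, ?_⟩) hD' <;> linarith [hx.1, hx.2]
  have key : ∀ u : ℝ, (∀ d, (∀ t ∈ Icc 0 S.T, ∀ x ∈ Icc a b,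
      |(x + Z t x 0) - (a + Z t a 0) - ∫ η in a..x, Z t η 2| ≤ d * Real.exp (l * t) ∧
      |Z t x 1 - Z t a 1 - ∫ η in a..x, S.D.trunc η (Z t η)| ≤ d * Real.exp (l * t)) →
      |u| ≤ d * Real.exp (l * t)) → u = 0 := fun u hu => by
    have h := le_zero_of_halving (x := |u| / Real.exp (l * t)) hbase hstep fun d hd => by
      rw [div_le_iff₀ (Real.exp_pos _)]
      exact hu d hd
    rw [div_le_iff₀ (Real.exp_pos _), zero_mul] at h
    exact abs_nonpos_iff.1 h
  exact ⟨sub_eq_zero.1 (key _ fun d hd => (hd t ht b ⟨hab, le_rfl⟩).1),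
    sub_eq_zero.1 (key _ fun d hd => (hd t ht b ⟨hab, le_rfl⟩).2)⟩

/-- `y_ξ` is the derivative of `y`. -/
lemma hasDerivAE_y {t : ℝ} (ht : t ∈ Icc 0 S.T) :
    HasDerivAE (fun ξ => ξ + Z t ξ 0) fun ξ => Z t ξ 2 := fun a b => by
  refine ⟨(hZ.profile t).int_p a b, ?_⟩
  rcases le_total a b with hab | hab
  · exact (compat_aux hZ hfix h0 h1 ht hab).1
  · rw [intervalIntegral.integral_symm, ← (compat_aux hZ hfix h0 h1 ht hab).1]
    ring

/-- The cut off `U_ξ` is the derivative of `U`. -/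
lemma hasDerivAE_U {t : ℝ} (ht : t ∈ Icc 0 S.T) :
    HasDerivAE (fun ξ => Z t ξ 1) fun ξ => S.D.trunc ξ (Z t ξ) := fun a b => by
  refine ⟨intervalIntegrable_of_bounded (measurable_trunc_traj hZ) (abs_trunc_traj_le hZ) t a b, ?_⟩
  rcases le_total a b with hab | hab
  · exact (compat_aux hZ hfix h0 h1 ht hab).2
  · rw [intervalIntegral.integral_symm, ← (compat_aux hZ hfix h0 h1 ht hab).2]
    ring

end Setting

/-! ### Representation of states by values of the Lagrangian variables -/

/-- The values `f` describe the state `X` with the set `A` of unbroken points. -/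
structure Params.Represents (D : Params) (A : Set ℝ) (X : State) (f : ℝ → Vals) : Prop where
  c : X.c = D.c
  k : X.k = D.k
  zeta : ∀ ξ, X.zeta ξ = f ξ 0
  U : ∀ ξ, X.U D.χ ξ = f ξ 1
  yXi : ∀ᵐ ξ, X.yXi ξ = f ξ 2
  h : ∀ᵐ ξ, X.h ξ = f ξ 4
  rbar : ∀ᵐ ξ, X.rbar ξ = f ξ 5
  mem_iff : ∀ᵐ ξ, ξ ∈ A ↔ ¬ D.Broken ξ (f ξ)
  deriv : HasDerivAE X.y fun ξ => f ξ 2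
  meas_mem : NullMeasurableSet A volume
  meas : ∀ i, i ≠ 3 → AEMeasurable (fun ξ => f ξ i) volume

namespace Params.Represents

variable {D : Params} {A : Set ℝ} {X : State} {f : ℝ → Vals} {M K : ℝ}

lemma y_eq (h : D.Represents A X f) (ξ : ℝ) : X.y ξ = ξ + f ξ 0 := by rw [State.y, h.zeta]

lemma Ubar_eq (h : D.Represents A X f) (ξ : ℝ) : X.Ubar ξ = D.ub ξ (f ξ) := by
  have := h.U ξ
  rw [State.U, h.c, h.y_eq] at this
  rw [Params.ub, ← this]
  ring

lemma ker_eq (h : D.Represents A X f) (ξ η : ℝ) : ker f ξ η = Real.exp (-|X.y ξ - X.y η|) := by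
  have h1 := (h.deriv η ξ).2
  rw [ker, pos, pos, intervalIntegral.integral_interval_sub_left (h.deriv _ _).1 (h.deriv _ _).1,
    ← h1]

lemma source_eq (h : D.Represents A X f) :
    (fun η => source D.χ X η) =ᵐ[volume] fun η => D.src η (f η) := by
  filter_upwards [h.yXi, h.h, h.rbar] with η h1 h2 h3
  rw [source, h1, h2, h3, h.c, h.k, h.Ubar_eq, h.y_eq]
  unfold Params.src Params.loc
  ring

lemma sourceAsymp_eq (h : D.Represents A X f) :
    (fun η => sourceAsymp D.χ X η) =ᵐ[volume] fun η => D.srcA η (f η) := by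
  filter_upwards [h.yXi] with η h1
  rw [sourceAsymp, h1, h.c, h.y_eq, Params.srcA]

lemma tot_eq (h : D.Represents A X f) : ∀ᵐ η, D.tot η (f η)
    = A.indicator (fun η => D.src η (f η)) η + D.srcA η (f η) := by
  filter_upwards [h.mem_iff] with η hη
  unfold Params.tot
  by_cases hb : D.Broken η (f η)
  · rw [if_pos hb, indicator_of_notMem fun hA => hη.1 hA hb]
  · rw [if_neg hb, indicator_of_mem (hη.2 hb)]

lemma aemeasurable_srcA (h : D.Represents A X f) (hχ : IsPartitionFunction D.χ) :
    AEMeasurable (fun η => D.srcA η (f η)) volume :=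
  (aemeasurable_const.mul (hχ.contDiff_deriv_flux.continuous.measurable.comp_aemeasurable
    (aemeasurable_id.add (h.meas 0 (by decide))))).mul (h.meas 2 (by decide))

lemma aemeasurable_src (h : D.Represents A X f) (hχ : IsPartitionFunction D.χ) :
    AEMeasurable (fun η => D.src η (f η)) volume := by
  have c0 : AEMeasurable (fun η => D.χ (η + f η 0)) volume :=
    hχ.smooth.continuous.measurable.comp_aemeasurable
      (aemeasurable_id.add (h.meas 0 (by decide)))
  have cu : AEMeasurable (fun η => D.ub η (f η)) volume :=
    (h.meas 1 (by decide)).sub (aemeasurable_const.mul c0)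
  exact ((((aemeasurable_const.mul c0).mul cu).add (cu.mul cu)).mul (h.meas 2 (by decide))).add
    (aemeasurable_const.mul (h.meas 4 (by decide))) |>.add
    (aemeasurable_const.mul (h.meas 5 (by decide)))

lemma profile (h : D.Represents A X f) (hχ : IsPartitionFunction D.χ) (hM : 2 * M ≤ K)
    (hb : ∀ᵐ η, ‖f η‖ ≤ M) (hz : ∀ η, |X.zeta η| ≤ M) : D.Profile M K f := by
  refine ⟨fun a b => (h.deriv a b).1, ?_, hb, fun ξ η => ?_⟩
  · refine AEMeasurable.aestronglyMeasurable ?_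
    refine (((h.aemeasurable_src hχ).indicator₀ h.meas_mem).add (h.aemeasurable_srcA hχ)).congr ?_
    filter_upwards [h.tot_eq] with η hη using hη.symm
  · have h1 : pos f ξ - pos f η = X.y ξ - X.y η := by
      rw [pos, pos, intervalIntegral.integral_interval_sub_left (h.deriv _ _).1 (h.deriv _ _).1,
        ← (h.deriv η ξ).2]
    rw [h1, State.y, State.y]
    have h2 := abs_le.1 (hz ξ)
    have h3 := abs_le.1 (hz η)
    have h4 := abs_nonneg (ξ - η)
    have h5 := abs_sub_abs_le_abs_sub (ξ - η) (X.zeta η - X.zeta ξ)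
    have h6 : |X.zeta η - X.zeta ξ| ≤ 2 * M := abs_le.2 ⟨by linarith, by linarith⟩
    have e : ξ + X.zeta ξ - (η + X.zeta η) = ξ - η - (X.zeta η - X.zeta ξ) := by ring
    rw [e]
    linarith

/-- The nonlocal term as a sum of an integral over the unbroken points and an integral over the
line. -/
lemma nonloc_eq (h : D.Represents A X f) (hχ : IsPartitionFunction D.χ)
    (hf : D.Profile M K f) {κ : ℝ → ℝ} (hκ : IsWeight κ) (ξ : ℝ) :
    D.nonloc κ f ξ
      = 1 / 2 * (∫ η in A, κ (ξ - η) * Real.exp (-|X.y ξ - X.y η|) * source D.χ X η)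
        + 1 / 2 * ∫ η, κ (ξ - η) * Real.exp (-|X.y ξ - X.y η|) * sourceAsymp D.χ X η := by
  have hI := hf.integrable_ker_tot hχ hκ ξ
  have hA : Integrable fun η => κ (ξ - η) * ker f ξ η * D.srcA η (f η) := by
    obtain ⟨a, -, ha, -⟩ := locLip_srcA hχ M
    refine ((integrable_exp_neg_mul_abs_sub (a := 1 / 2) (by norm_num) ξ).const_mul
      (Real.exp K * a)).mono' ?_ ?_
    · exact ((((hκ.measurable.comp (measurable_const.sub measurable_id)).mul
        (hf.measurable_ker ξ)).aemeasurable).mul (h.aemeasurable_srcA hχ)).aestronglyMeasurable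
    · filter_upwards [hf.bdd] with η hη
      rw [Real.norm_eq_abs, abs_mul, abs_mul, abs_of_pos (ker_pos f ξ η)]
      have h1 : |κ (ξ - η)| * ker f ξ η ≤ 1 * ker f ξ η :=
        mul_le_mul_of_nonneg_right (hκ.abs_le_one _) (ker_pos f ξ η).le
      rw [one_mul] at h1
      refine (mul_le_mul (h1.trans (hf.ker_le ξ η)) (ha η _ hη) (abs_nonneg _)
        (by positivity)).trans (le_of_eq (by ring))
  have e1 : ∀ᵐ η, κ (ξ - η) * ker f ξ η * D.tot η (f η)
      = A.indicator (fun η => κ (ξ - η) * ker f ξ η * D.src η (f η)) η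
        + κ (ξ - η) * ker f ξ η * D.srcA η (f η) := by
    filter_upwards [h.tot_eq] with η hη
    rw [hη, mul_add]
    by_cases hA : η ∈ A
    · rw [indicator_of_mem hA, indicator_of_mem hA]
    · rw [indicator_of_notMem hA, indicator_of_notMem hA, mul_zero]
  have hB : Integrable (A.indicator fun η => κ (ξ - η) * ker f ξ η * D.src η (f η)) := by
    refine (hI.sub hA).congr ?_
    filter_upwards [e1] with η hη
    simp only [Pi.sub_apply, hη]
    ring
  unfold Params.nonloc
  rw [integral_congr_ae e1, integral_add hB hA, integral_indicator₀ h.meas_mem, mul_add]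
  congr 2
  · refine integral_congr_ae (ae_restrict_of_ae ?_)
    filter_upwards [h.source_eq] with η hη
    rw [hη, h.ker_eq]
  · refine integral_congr_ae ?_
    filter_upwards [h.sourceAsymp_eq] with η hη
    rw [hη, h.ker_eq]

variable {T t : ℝ} {Y : ℝ → State}

lemma P_eq (h : D.Represents (unbroken T Y t) (Y t) f) (hχ : IsPartitionFunction D.χ)
    (hf : D.Profile M K f) (ξ : ℝ) :
    (Y t).U D.χ ξ ^ 2 + 1 / 2 * (Y t).k ^ 2 - P D.χ T Y t ξ = D.coef f ξ := by
  have h1 := h.nonloc_eq hχ hf isWeight_one ξ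
  simp only [one_mul] at h1
  rw [P, Params.coef, h1, Params.loc, ← h.Ubar_eq, ← h.y_eq, h.c]
  ring

lemma Q_eq (h : D.Represents (unbroken T Y t) (Y t) f) (hχ : IsPartitionFunction D.χ)
    (hf : D.Profile M K f) (ξ : ℝ) :
    -Q D.χ T Y t ξ = D.rhsAt f ξ 1 := by
  have h1 := h.nonloc_eq hχ hf isWeight_sign ξ
  change _ = -D.flux ξ (f ξ) + D.nonloc Real.sign f ξ
  rw [Q, h1, Params.flux, ← h.y_eq, h.c]
  ring

end Params.Represents

/-! ### The fixed point solves the system -/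

lemma normE_le {f m : ℝ → ℝ} {a : ℝ} (h : ∀ ξ, |f ξ| ≤ a * m ξ) (hm : ∀ ξ, 0 ≤ m ξ) :
    normE f ≤ ENNReal.ofReal a * normE m := by
  have hp : ∀ p, eLpNorm f p volume ≤ ENNReal.ofReal a * eLpNorm m p volume := fun p =>
    eLpNorm_le_mul_eLpNorm_of_ae_le_mul (Eventually.of_forall fun ξ => by
      rw [Real.norm_eq_abs, Real.norm_of_nonneg (hm ξ)]
      exact h ξ) p
  rw [normE, normE, mul_add]
  exact add_le_add (hp _) (hp _)

lemma memE_of_le {f m : ℝ → ℝ} {a : ℝ} (hf : AEStronglyMeasurable f volume) (hm : MemE m)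
    (h : ∀ᵐ ξ, |f ξ| ≤ a * m ξ) : MemE f :=
  ⟨(hm.1.const_mul a).mono' hf h, (hm.2.const_mul a).mono' hf h⟩

lemma MemE.normE_lt_top {f : ℝ → ℝ} (hf : MemE f) : normE f < ⊤ :=
  ENNReal.add_lt_top.2 ⟨hf.1.2, hf.2.2⟩

/-- The deviation of `g` from `1` is controlled by the components of the state. -/
lemma abs_g_sub_one_le (p q h r k : ℝ) :
    |g p q h r k - 1| ≤ 2 * |p - 1| + |q| + |h| + 2 * (|k| * |r|) := by
  have hk : 0 ≤ |k| * |r| := by positivity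
  have h1 := le_abs_self (p - 1)
  have h2 := neg_abs_le (p - 1)
  have h3 := le_abs_self h
  have h4 := neg_abs_le h
  have h5 := abs_nonneg q
  unfold g
  split_ifs with hO
  · have hO := hO.1
    have e : |r * k| = |k| * |r| := by rw [abs_mul, mul_comm]
    unfold g₁ g₂ at hO
    unfold g₁
    rw [e] at hO ⊢
    rw [abs_le]
    constructor <;> linarith
  · unfold g₂
    rw [abs_le]
    constructor <;> linarith

namespace Setting

variable {S : Setting} {Z : ℝ → ℝ → Vals} (hZ : S.Traj Z) (hfix : S.Phi Z = Z)

lemma memE_m : MemE S.m := by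
  refine ⟨S.memLp_m, memLp_top_of_bound S.memLp_m.1 S.B (Eventually.of_forall fun ξ => ?_)⟩
  rw [Real.norm_of_nonneg (S.env.nonneg ξ)]
  exact S.env.le_bound ξ

lemma measurable_ub : Measurable fun p : ℝ × Vals => S.D.ub p.1 p.2 :=
  ((measurable_pi_apply 1).comp measurable_snd).sub (measurable_const.mul
    (S.hχ.smooth.continuous.measurable.comp
      (measurable_fst.add ((measurable_pi_apply 0).comp measurable_snd))))

include hZ

lemma memVbar_toState (t : ℝ) : (S.D.toState (Z t)).MemVbar := by
  have c : ∀ i, Measurable fun ξ => Z t ξ i := fun i => (measurable_pi_apply i).comp (hZ.meas t)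
  have hE := fun ξ => hZ.envAt t ξ
  refine ⟨memLp_top_of_bound (c 0).aestronglyMeasurable S.M (Eventually.of_forall fun ξ =>
    (abs_le_norm _ 0).trans (hZ.norm_le t ξ)), ?_, ?_, ?_, ?_, ?_⟩
  · exact memE_of_le (measurable_ub.comp (measurable_id.prodMk (hZ.meas t))).aestronglyMeasurable
      memE_m (Eventually.of_forall fun ξ => (hE ξ).ub_le)
  · exact memE_of_le ((c 2).sub measurable_const).aestronglyMeasurable memE_m
      (Eventually.of_forall fun ξ => (hE ξ).p_le)
  · exact memE_of_le
      (measurable_trunc.comp (measurable_id.prodMk (hZ.meas t))).aestronglyMeasurable memE_m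
      (Eventually.of_forall fun ξ => (Params.abs_trunc_le ξ _).trans (hE ξ).q_le)
  · exact memE_of_le (c 4).aestronglyMeasurable memE_m (Eventually.of_forall fun ξ => (hE ξ).h_le)
  · exact memE_of_le (c 5).aestronglyMeasurable memE_m (Eventually.of_forall fun ξ => (hE ξ).r_le)

/-- The partition function along two trajectories differs only in a bounded set. -/
lemma exists_abs_chi_sub_le : ∃ C, 0 ≤ C ∧ ∀ s t ξ,
    |S.D.χ (ξ + Z s ξ 0) - S.D.χ (ξ + Z t ξ 0)| ≤ C * S.m ξ * |s - t| := by
  obtain ⟨C, hC, -, hl⟩ := S.hχ.bddLip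
  have hL := S.L_nonneg
  refine ⟨C * S.L, by positivity, fun s t ξ => ?_⟩
  have hm := S.env.nonneg ξ
  have n1 := abs_le.1 ((abs_le_norm (Z s ξ) 0).trans (hZ.norm_le s ξ))
  have n2 := abs_le.1 ((abs_le_norm (Z t ξ) 0).trans (hZ.norm_le t ξ))
  by_cases hξ : |ξ| ≤ S.M + 1
  · refine (hl _ _).trans ?_
    have h1 := hZ.lip t s ξ 0
    rw [show Params.wt S.m 0 ξ = 1 from if_pos rfl, mul_one] at h1
    rw [add_sub_add_left_eq_sub]
    calc C * |Z s ξ 0 - Z t ξ 0| ≤ C * (S.L * |s - t|) := mul_le_mul_of_nonneg_left h1 hC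
      _ = C * S.L * 1 * |s - t| := by ring
      _ ≤ _ := by gcongr; exact S.one_le_m ξ hξ
  · have : |S.D.χ (ξ + Z s ξ 0) - S.D.χ (ξ + Z t ξ 0)| = 0 := by
      rw [not_le, lt_abs] at hξ
      rcases hξ with hξ | hξ
      · rw [S.hχ.eq_one _ (by linarith), S.hχ.eq_one _ (by linarith), sub_self, abs_zero]
      · rw [S.hχ.eq_zero (by linarith), S.hχ.eq_zero (by linarith), sub_self, abs_zero]
    rw [this]
    positivity

lemma continuousCurve_toState : ContinuousCurve S.T fun t => S.D.toState (Z t) := by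
  refine ⟨fun t _ => memVbar_toState hZ t, fun t _ => ?_⟩
  obtain ⟨C, hC, hχ⟩ := exists_abs_chi_sub_le hZ
  have hL := S.L_nonneg
  set a := S.L + |S.D.c| * C with ha
  have hLa : S.L ≤ a := le_add_of_nonneg_right (mul_nonneg (abs_nonneg _) hC)
  have hlip : ∀ s ξ i, i ≠ 0 → |Z s ξ i - Z t ξ i| ≤ a * |s - t| * S.m ξ := fun s ξ i hi => by
    have h1 := hZ.lip t s ξ i
    rw [show Params.wt S.m i ξ = S.m ξ from if_neg hi] at h1
    have hm := S.env.nonneg ξ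
    calc _ ≤ _ := h1
      _ ≤ a * S.m ξ * |s - t| := by gcongr
      _ = _ := by ring
  have hn : ∀ (u : State → ℝ → ℝ), (∀ s ξ, |u (S.D.toState (Z s)) ξ - u (S.D.toState (Z t)) ξ|
      ≤ a * |s - t| * S.m ξ) → ∀ s, normE (u (S.D.toState (Z s)) - u (S.D.toState (Z t)))
        ≤ ENNReal.ofReal (a * |s - t|) * normE S.m := fun u hu s =>
    normE_le (fun ξ => hu s ξ) S.env.nonneg
  have h2 := hn State.Ubar fun s ξ => by
    change |S.D.ub ξ (Z s ξ) - S.D.ub ξ (Z t ξ)| ≤ _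
    have e : S.D.ub ξ (Z s ξ) - S.D.ub ξ (Z t ξ) = (Z s ξ 1 - Z t ξ 1)
        - S.D.c * (S.D.χ (ξ + Z s ξ 0) - S.D.χ (ξ + Z t ξ 0)) := by
      unfold Params.ub; ring
    rw [e]
    have h1 := hZ.lip t s ξ 1
    rw [show Params.wt S.m 1 ξ = S.m ξ from if_neg (by decide)] at h1
    refine (abs_sub _ _).trans ?_
    rw [abs_mul]
    calc _ ≤ S.L * S.m ξ * |s - t| + |S.D.c| * (C * S.m ξ * |s - t|) :=
          add_le_add h1 (mul_le_mul_of_nonneg_left (hχ s t ξ) (abs_nonneg _))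
      _ = _ := by rw [ha]; ring
  have h3 := hn State.zetaXi fun s ξ => by
    change |(Z s ξ 2 - 1) - (Z t ξ 2 - 1)| ≤ _
    rw [sub_sub_sub_cancel_right]
    exact hlip s ξ 2 (by decide)
  have h4 := hn State.UXi fun s ξ =>
    (Params.abs_trunc_sub_le ξ (Z s ξ) (Z t ξ)).trans (hlip s ξ 3 (by decide))
  have h5 := hn State.h fun s ξ => hlip s ξ 4 (by decide)
  have h6 := hn State.rbar fun s ξ => hlip s ξ 5 (by decide)
  have h1 : ∀ s, eLpNorm ((S.D.toState (Z s)).zeta - (S.D.toState (Z t)).zeta) ∞ volume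
      ≤ ENNReal.ofReal (a * |s - t|) := fun s => by
    refine (eLpNorm_le_of_ae_bound (C := a * |s - t|) (Eventually.of_forall fun ξ => ?_)).trans
      (by simp)
    have h1 := hZ.lip t s ξ 0
    rw [show Params.wt S.m 0 ξ = 1 from if_pos rfl, mul_one] at h1
    exact h1.trans (mul_le_mul_of_nonneg_right hLa (abs_nonneg _))
  have hle : ∀ s, (S.D.toState (Z s)).distVbar (S.D.toState (Z t))
      ≤ ENNReal.ofReal (a * |s - t|) * (1 + 5 * normE S.m) := fun s => by
    unfold State.distVbar
    have e1 : (S.D.toState (Z s)).c - (S.D.toState (Z t)).c = 0 := sub_self _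
    have e2 : (S.D.toState (Z s)).k - (S.D.toState (Z t)).k = 0 := sub_self _
    rw [e1, e2, abs_zero, ENNReal.ofReal_zero, add_zero, add_zero]
    refine (add_le_add (add_le_add (add_le_add (add_le_add (add_le_add (h1 s) (h2 s)) (h3 s))
      (h4 s)) (h5 s)) (h6 s)).trans (le_of_eq ?_)
    ring
  have hlim : Tendsto (fun s => ENNReal.ofReal (a * |s - t|) * (1 + 5 * normE S.m))
      (𝓝[Icc 0 S.T] t) (𝓝 0) := by
    have hc : Tendsto (fun s => ENNReal.ofReal (a * |s - t|)) (𝓝 t) (𝓝 0) := by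
      have : Continuous fun s => ENNReal.ofReal (a * |s - t|) :=
        ENNReal.continuous_ofReal.comp (by fun_prop)
      simpa using this.tendsto t
    have hfin : (1 + 5 * normE S.m) ≠ ⊤ :=
      ENNReal.add_ne_top.2 ⟨ENNReal.one_ne_top,
        ENNReal.mul_ne_top (by simp) memE_m.normE_lt_top.ne⟩
    have := ENNReal.Tendsto.mul_const (hc.mono_left (nhdsWithin_le_nhds (s := Icc 0 S.T)))
      (Or.inr hfin)
    simpa using this
  exact tendsto_of_tendsto_of_tendsto_of_le_of_le tendsto_const_nhds hlim (fun _ => zero_le) hle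

include hfix

variable (h0 : HasDerivAE (fun ξ => S.z₀ ξ 0) fun ξ => S.z₀ ξ 2 - 1)
    (h1 : HasDerivAE (fun ξ => S.z₀ ξ 1) fun ξ => S.z₀ ξ 3)

include h0 h1

lemma represents_toState {t : ℝ} (ht : t ∈ Icc 0 S.T) :
    S.D.Represents (unbroken S.T (fun t => S.D.toState (Z t)) t) (S.D.toState (Z t)) (Z t) where
  c := rfl
  k := rfl
  zeta _ := rfl
  U ξ := by simp
  yXi := Eventually.of_forall fun ξ => by simp
  h := Eventually.of_forall fun ξ => rfl
  rbar := Eventually.of_forall fun ξ => rfl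
  mem_iff := Eventually.of_forall fun ξ => mem_unbroken_toState_iff hZ hfix ht ξ
  deriv := hasDerivAE_y hZ hfix h0 h1 ht
  meas_mem := by
    have e : unbroken S.T (fun t => S.D.toState (Z t)) t = {ξ | ¬ S.D.Broken ξ (Z t ξ)} :=
      Set.ext fun ξ => mem_unbroken_toState_iff hZ hfix ht ξ
    rw [e]
    exact ((measurable_id.prodMk (hZ.meas t))
      (Params.measurable_broken S.meas_N)).compl.nullMeasurableSet
  meas i _ := ((measurable_pi_apply i).comp (hZ.meas t)).aemeasurable

lemma compatible_toState {t : ℝ} (ht : t ∈ Icc 0 S.T) :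
    (S.D.toState (Z t)).Compatible S.D.χ := by
  constructor
  · exact ((hasDerivAE_y hZ hfix h0 h1 ht).sub HasDerivAE.id_one).congr
      (fun ξ => by simp [Params.toState]) (Eventually.of_forall fun ξ => rfl)
  · exact (hasDerivAE_U hZ hfix h0 h1 ht).congr (fun ξ => by simp)
      (Eventually.of_forall fun ξ => rfl)

lemma isSolution_toState : IsSolution S.D.χ S.T fun t => S.D.toState (Z t) := by
  classical
  have hP := fun {t} ht ξ => (represents_toState hZ hfix h0 h1 (t := t) ht).P_eq S.hχ
    (hZ.profile t) ξ
  have hQ := fun {t} ht ξ => (represents_toState hZ hfix h0 h1 (t := t) ht).Q_eq S.hχ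
    (hZ.profile t) ξ
  have hmem := fun {t} ht ξ => mem_unbroken_toState_iff hZ hfix (t := t) ht ξ
  have hind : ∀ {t} (_ : t ∈ Icc 0 S.T) (ξ : ℝ) (u : ℝ → ℝ), (S.D.Broken ξ (Z t ξ) → u ξ = 0) →
      u ξ = (unbroken S.T (fun t => S.D.toState (Z t)) t).indicator u ξ := fun {t} ht ξ u hu => by
    by_cases hb : S.D.Broken ξ (Z t ξ)
    · rw [indicator_of_notMem (by rw [hmem ht]; exact not_not.2 hb), hu hb]
    · rw [indicator_of_mem (by rw [hmem ht]; exact hb)]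
  refine ⟨continuousCurve_toState hZ, fun t ht => compatible_toState hZ hfix h0 h1 ht, fun ξ => ?_,
    fun ξ => ?_, Eventually.of_forall fun ξ => ?_, Eventually.of_forall fun ξ => ?_,
    Eventually.of_forall fun ξ => ?_, Eventually.of_forall fun ξ => ?_, ?_, ?_⟩
  · have h : SolvesODE S.T (fun _ => ξ) fun _ => 0 := fun t _ =>
      ⟨intervalIntegrable_const, by simp⟩
    refine (h.add (solves hZ hfix ξ 0)).congr (fun t _ => rfl) fun t _ => ?_
    rw [Params.toState_U, zero_add]
    rfl
  · refine (solves hZ hfix ξ 1).congr (fun t _ => ?_) fun t ht => (hQ ht ξ).symm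
    rw [Params.toState_U]
  · refine (solves hZ hfix ξ 2).congr (fun t _ => ?_) fun t ht => ?_
    · rw [Params.toState_yXi]
    · exact hind ht ξ (fun ξ => S.D.trunc ξ (Z t ξ)) fun hb => trunc_of_broken hb
  · refine (solves_trunc hZ hfix ξ).congr (fun t _ => rfl) fun t ht => ?_
    by_cases hb : S.D.Broken ξ (Z t ξ)
    · rw [if_pos hb, indicator_of_notMem (by rw [hmem ht]; exact not_not.2 hb)]
    · rw [if_neg hb, indicator_of_mem (by rw [hmem ht]; exact hb), hP ht, rhsAt_three,
        Params.toState_yXi]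
      rfl
  · refine (solves hZ hfix ξ 4).congr (fun t _ => rfl) fun t ht => ?_
    rw [← hind ht ξ _ fun hb => by
      change _ * S.D.trunc ξ (Z t ξ) = 0
      rw [trunc_of_broken hb, mul_zero], hP ht]
    rfl
  · refine (solves hZ hfix ξ 5).congr (fun t _ => rfl) fun t ht => ?_
    exact hind ht ξ (fun ξ => -(S.D.k * S.D.trunc ξ (Z t ξ))) fun hb => by
      rw [trunc_of_broken hb, mul_zero, neg_zero]
  · exact fun t _ => ⟨intervalIntegrable_const, by simp [Params.toState]⟩
  · exact fun t _ => ⟨intervalIntegrable_const, by simp [Params.toState]⟩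

lemma tendsto_U {t : ℝ} (ht : t ∈ Icc 0 S.T) : Tendsto (fun ξ => Z t ξ 1) atBot (𝓝 0) := by
  obtain ⟨C, hC, -, hl⟩ := S.hχ.bddLip
  have hM : 0 < S.M := zero_lt_one.trans_le S.M_ge
  have hy := (hasDerivAE_y hZ hfix h0 h1 ht).abs_sub_le (C := S.M)
    (Eventually.of_forall fun ξ => (abs_le_norm _ 2).trans (hZ.norm_le t ξ))
  have hU := (hasDerivAE_U hZ hfix h0 h1 ht).abs_sub_le (C := S.M)
    (Eventually.of_forall fun ξ => abs_trunc_traj_le hZ t ξ)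
  have hub := tendsto_zero_atBot_of_lipschitz (f := fun ξ => S.D.ub ξ (Z t ξ))
    (C := S.M + |S.D.c| * (C * S.M)) (by positivity) (fun a b => by
      have e : S.D.ub b (Z t b) - S.D.ub a (Z t a) = (Z t b 1 - Z t a 1)
          - S.D.c * (S.D.χ (b + Z t b 0) - S.D.χ (a + Z t a 0)) := by
        unfold Params.ub; ring
      rw [e]
      refine (abs_sub _ _).trans ?_
      rw [abs_mul]
      have h2 := (hl (b + Z t b 0) (a + Z t a 0)).trans (mul_le_mul_of_nonneg_left (hy a b) hC)
      calc _ ≤ S.M * |b - a| + |S.D.c| * (C * (S.M * |b - a|)) :=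
            add_le_add (hU a b) (mul_le_mul_of_nonneg_left h2 (abs_nonneg _))
        _ = _ := by ring) (memVbar_toState hZ t).Ubar.1
  refine hub.congr' ?_
  filter_upwards [Iio_mem_atBot (-S.M)] with ξ hξ
  have n1 := abs_le.1 ((abs_le_norm (Z t ξ) 0).trans (hZ.norm_le t ξ))
  rw [Params.ub, S.hχ.eq_zero (by linarith [mem_Iio.1 hξ]), mul_zero, sub_zero]

lemma tendsto_zeta_of_fixed (hlim : Tendsto (fun ξ => S.z₀ ξ 0) atBot (𝓝 0)) {t : ℝ}
    (ht : t ∈ Icc 0 S.T) : Tendsto (fun ξ => Z t ξ 0) atBot (𝓝 0) := by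
  have e : ∀ ξ, S.z₀ ξ 0 + ∫ s in (0 : ℝ)..t, Z s ξ 1 = Z t ξ 0 := fun ξ => by
    rw [← hZ.init]
    exact (solves hZ hfix ξ 0 t ht).2.symm
  refine Tendsto.congr e ?_
  have hint : Tendsto (fun ξ => ∫ s in (0 : ℝ)..t, Z s ξ 1) atBot
      (𝓝 (∫ _ in (0 : ℝ)..t, (0 : ℝ))) := by
    refine intervalIntegral.tendsto_integral_filter_of_dominated_convergence (fun _ => S.M)
      (Eventually.of_forall fun ξ => ?_) (Eventually.of_forall fun ξ => ?_)
      intervalIntegrable_const (Eventually.of_forall fun s hs => ?_)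
    · exact ((continuous_apply 1).comp (hZ.continuous_time ξ)).aestronglyMeasurable
    · exact Eventually.of_forall fun s _ => (abs_le_norm _ 1).trans (hZ.norm_le s ξ)
    · rw [uIoc_of_le ht.1] at hs
      exact tendsto_U hZ hfix h0 h1 ⟨hs.1.le, hs.2.trans ht.2⟩
  simpa using hlim.add hint

lemma memG_toState (hlim : Tendsto (fun ξ => S.z₀ ξ 0) atBot (𝓝 0)) {t : ℝ}
    (ht : t ∈ Icc 0 S.T) : MemG S.D.χ (S.D.toState (Z t)) := by
  have c : ∀ i, Measurable fun ξ => Z t ξ i := fun i => (measurable_pi_apply i).comp (hZ.meas t)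
  have hκ := S.κ_pos
  refine ⟨memVbar_toState hZ t, compatible_toState hZ hfix h0 h1 ht, ?_,
    Eventually.of_forall fun ξ => ?_, Eventually.of_forall fun ξ => ?_,
    tendsto_zeta_of_fixed hZ hfix h0 h1 hlim ht,
    Eventually.of_forall fun ξ => ?_, ?_, Eventually.of_forall fun ξ => ?_⟩
  · have hE := fun ξ => hZ.envAt t ξ
    refine memE_of_le (a := (4 + 2 * |S.D.k|) * (2 + |S.D.c|)) ?_ (memE_m (S := S))
      (Eventually.of_forall fun ξ => ?_)
    · have hq : Measurable fun ξ => S.D.trunc ξ (Z t ξ) :=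
        measurable_trunc.comp (measurable_id.prodMk (hZ.meas t))
      refine Measurable.aestronglyMeasurable (Measurable.sub ?_ measurable_const)
      have m1 : Measurable fun ξ => g₁ (Z t ξ 2) (S.D.trunc ξ (Z t ξ)) (Z t ξ 5) S.D.k :=
        (hq.norm.add (((c 5).mul_const _).norm.const_mul 2)).add ((c 2).const_mul 2)
      have m2 : Measurable fun ξ => g₂ (Z t ξ 2) (Z t ξ 4) := (c 2).add (c 4)
      simp only [Params.toState_yXi]
      refine Measurable.ite ?_ m1 m2
      exact (measurableSet_le m1 m2).inter ((measurableSet_le hq measurable_const).inter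
        (measurableSet_eq_fun ((c 5).add ((c 2).const_mul _)) measurable_const))
    · refine (abs_g_sub_one_le _ _ _ _ _).trans ?_
      rw [Params.toState_yXi]
      have b1 := (hE ξ).p_le
      have b2 := (Params.abs_trunc_le (D := S.D) ξ (Z t ξ)).trans (hE ξ).q_le
      have b3 := (hE ξ).h_le
      have b4 := mul_le_mul_of_nonneg_left (hE ξ).r_le (abs_nonneg S.D.k)
      change 2 * |Z t ξ 2 - 1| + |S.D.trunc ξ (Z t ξ)| + |Z t ξ 4|
        + 2 * (|S.D.k| * |Z t ξ 5|) ≤ _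
      linarith
  · rw [Params.toState_yXi]
    exact (p_pos_iff hZ hfix ξ t ht).1
  · exact h_nonneg_of_fixed hZ hfix ξ t ht
  · rw [Params.toState_yXi]
    have := half_κ_le hZ t ξ
    change Z t ξ 2 + Z t ξ 4 ≠ 0
    linarith
  · simp only [Params.toState_yXi]
    refine memLp_top_of_bound (measurable_const.div ((c 2).add (c 4))).aestronglyMeasurable (2 / S.κ)
      (Eventually.of_forall fun ξ => ?_)
    have := half_κ_le hZ t ξ
    change ‖1 / (Z t ξ 2 + Z t ξ 4)‖ ≤ _
    rw [Real.norm_eq_abs, abs_of_pos (by apply one_div_pos.2; linarith),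
      div_le_div_iff₀ (by linarith) hκ]
    linarith
  · rw [Params.toState_yXi]
    exact identity_of_fixed hZ hfix ξ t ht

end Setting

/-! ### Construction of the setting from initial data -/

lemma le_of_ae_le_of_continuous {f : ℝ → ℝ} (hf : Continuous f) {C : ℝ} (h : ∀ᵐ x, f x ≤ C)
    (x : ℝ) : f x ≤ C := by
  have hd : Dense {x | f x ≤ C} := Measure.dense_of_ae h
  have hc : IsClosed {x | f x ≤ C} := isClosed_le hf continuous_const
  have := hd.closure_eq
  rw [hc.closure_eq] at this
  exact this.ge (mem_univ x)

lemma exists_ae_bound {f : ℝ → ℝ} (hf : MemLp f ∞ volume) : ∃ C, 0 ≤ C ∧ ∀ᵐ x, |f x| ≤ C :=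
  ⟨(eLpNormEssSup f volume).toReal, ENNReal.toReal_nonneg, by
    have h : eLpNormEssSup f volume < ⊤ := by simpa using hf.2
    filter_upwards [ae_le_eLpNormEssSup (f := f) (μ := volume)] with x hx
    have := ENNReal.toReal_mono h.ne hx
    simpa using this⟩

lemma exists_bound_of_continuous {f : ℝ → ℝ} (hc : Continuous f) (hf : MemLp f ∞ volume) :
    ∃ C, 0 ≤ C ∧ ∀ x, |f x| ≤ C := by
  obtain ⟨C, hC, h⟩ := exists_ae_bound hf
  exact ⟨C, hC, le_of_ae_le_of_continuous hc.abs h⟩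

namespace State.Compatible

variable {χ : ℝ → ℝ} {X : State}

lemma hasDerivAE_y (h : X.Compatible χ) : HasDerivAE X.y X.yXi :=
  HasDerivAE.id_one.add h.zeta

lemma continuous_Ubar (hχ : IsPartitionFunction χ) (h : X.Compatible χ) : Continuous X.Ubar := by
  have e : X.Ubar = fun ξ => X.U χ ξ - X.c * χ (X.y ξ) := by
    funext ξ
    simp [State.U]
  rw [e]
  exact h.U.continuous.sub
    (continuous_const.mul (hχ.smooth.continuous.comp h.hasDerivAE_y.continuous))

end State.Compatible

/-- Everywhere defined values that represent an element of `𝒢`. -/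
structure Representative (χ : ℝ → ℝ) (X : State) (z : ℝ → Vals) (κ C : ℝ) : Prop where
  meas : Measurable z
  zeta : ∀ ξ, z ξ 0 = X.zeta ξ
  U : ∀ ξ, z ξ 1 = X.U χ ξ
  yXi : ∀ᵐ ξ, z ξ 2 = X.yXi ξ
  UXi : ∀ᵐ ξ, z ξ 3 = X.UXi ξ
  h : ∀ᵐ ξ, z ξ 4 = X.h ξ
  rbar : ∀ᵐ ξ, z ξ 5 = X.rbar ξ
  norm_le : ∀ ξ, ‖z ξ‖ ≤ C
  Ubar_le : ∀ ξ, |X.Ubar ξ| ≤ C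
  p_nonneg : ∀ ξ, 0 ≤ z ξ 2
  identity : ∀ ξ, z ξ 2 * z ξ 4 = z ξ 3 ^ 2 + z ξ 5 ^ 2
  κ_pos : 0 < κ
  denom : ∀ ξ, κ ≤ z ξ 2 + z ξ 4

lemma MemG.exists_representative {χ : ℝ → ℝ} (hχ : IsPartitionFunction χ) {X : State}
    (hX : MemG χ X) : ∃ z κ C, Representative χ X z κ C := by
  obtain ⟨C0, hC0, b0⟩ := exists_bound_of_continuous hX.compatible.zeta.continuous hX.mem_Vbar.zeta
  have hUc := hX.compatible.continuous_Ubar hχ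
  obtain ⟨C1, hC1, b1⟩ := exists_bound_of_continuous hUc hX.mem_Vbar.Ubar.2
  obtain ⟨C2, hC2, b2⟩ := exists_ae_bound hX.mem_Vbar.zetaXi.2
  obtain ⟨C3, hC3, b3⟩ := exists_ae_bound hX.mem_Vbar.UXi.2
  obtain ⟨C4, hC4, b4⟩ := exists_ae_bound hX.mem_Vbar.h.2
  obtain ⟨C5, hC5, b5⟩ := exists_ae_bound hX.mem_Vbar.rbar.2
  obtain ⟨C6, hC6, b6⟩ := exists_ae_bound hX.inv_bounded
  have hc := abs_nonneg X.c
  set C := 1 + C0 + (C1 + |X.c|) + C2 + C3 + C4 + C5 with hC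
  set κ := 1 / (1 + C6) with hκ
  have hκ0 : 0 < κ := by positivity
  have hκ1 : κ ≤ 1 := by
    rw [hκ, div_le_one (by positivity)]
    linarith
  set t : Set Vals := {z | (∀ i, |z i| ≤ C) ∧ 0 ≤ z 2 ∧ 0 ≤ z 4 ∧ z 2 * z 4 = z 3 ^ 2 + z 5 ^ 2 ∧
    κ ≤ z 2 + z 4} with ht
  set f : ℝ → Vals := fun ξ => ![0, 0, X.yXi ξ, X.UXi ξ, X.h ξ, X.rbar ξ] with hf
  have hC' : 1 ≤ C := by rw [hC]; linarith
  have hfm : AEMeasurable f volume := by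
    refine aemeasurable_pi_lambda _ fun i => ?_
    have a2 : AEMeasurable X.yXi volume :=
      aemeasurable_const.add hX.mem_Vbar.zetaXi.1.1.aemeasurable
    have a3 := hX.mem_Vbar.UXi.1.1.aemeasurable
    have a4 := hX.mem_Vbar.h.1.1.aemeasurable
    have a5 := hX.mem_Vbar.rbar.1.1.aemeasurable
    fin_cases i
    · exact aemeasurable_const
    · exact aemeasurable_const
    · exact a2
    · exact a3
    · exact a4
    · exact a5
  have hft : ∀ᵐ ξ, f ξ ∈ t := by
    filter_upwards [b2, b3, b4, b5, b6, hX.yXi_nonneg, hX.h_nonneg, hX.denom_ne_zero, hX.identity]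
      with ξ b2 b3 b4 b5 b6 hp hh hd hid
    refine ⟨fun i => ?_, hp, hh, hid, ?_⟩
    · fin_cases i
      · change |(0 : ℝ)| ≤ C
        rw [abs_zero]; linarith
      · change |(0 : ℝ)| ≤ C
        rw [abs_zero]; linarith
      · change |1 + X.zetaXi ξ| ≤ C
        refine (abs_add_le _ _).trans ?_
        rw [abs_one]
        linarith
      · change |X.UXi ξ| ≤ C
        linarith
      · change |X.h ξ| ≤ C
        linarith
      · change |X.rbar ξ| ≤ C
        linarith
    · change κ ≤ X.yXi ξ + X.h ξ
      have hpos : 0 < X.yXi ξ + X.h ξ := lt_of_le_of_ne (add_nonneg hp hh) (Ne.symm hd)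
      rw [abs_of_pos (one_div_pos.2 hpos), div_le_iff₀ hpos] at b6
      rw [hκ, div_le_iff₀ (by positivity)]
      linarith
  have hne : t.Nonempty := by
    refine ⟨![0, 0, 1, 0, 0, 0], fun i => ?_, ?_, ?_, ?_, ?_⟩
    · fin_cases i <;> simp <;> linarith
    · simp
    · simp
    · simp
    · simpa using hκ1
  obtain ⟨g, hgm, hgt, hfg⟩ := hfm.exists_ae_eq_range_subset hft hne
  have hg := fun ξ => hgt (mem_range_self ξ)
  have c : ∀ i, Measurable fun ξ => g ξ i := fun i => (measurable_pi_apply i).comp hgm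
  refine ⟨fun ξ => ![X.zeta ξ, X.U χ ξ, g ξ 2, g ξ 3, g ξ 4, g ξ 5], κ, C,
    ?_, fun ξ => rfl, fun ξ => rfl, ?_, ?_, ?_, ?_, fun ξ => ?_, fun ξ => ?_,
    fun ξ => (hg ξ).2.1, fun ξ => (hg ξ).2.2.2.1, hκ0,
    fun ξ => (hg ξ).2.2.2.2⟩
  · refine measurable_pi_lambda _ fun i => ?_
    fin_cases i
    · exact hX.compatible.zeta.continuous.measurable
    · exact hX.compatible.U.continuous.measurable
    · exact c 2
    · exact c 3
    · exact c 4
    · exact c 5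
  · filter_upwards [hfg] with ξ hξ using (congrFun hξ 2).symm
  · filter_upwards [hfg] with ξ hξ using (congrFun hξ 3).symm
  · filter_upwards [hfg] with ξ hξ using (congrFun hξ 4).symm
  · filter_upwards [hfg] with ξ hξ using (congrFun hξ 5).symm
  · rw [pi_norm_le_iff_of_nonneg (zero_le_one.trans hC')]
    intro i
    fin_cases i
    · change |X.zeta ξ| ≤ C
      linarith [b0 ξ]
    · change |X.Ubar ξ + X.c * χ (X.y ξ)| ≤ C
      refine (abs_add_le _ _).trans ?_
      rw [abs_mul, abs_of_nonneg (hχ.nonneg _)]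
      have := mul_le_mul_of_nonneg_left (hχ.le_one (X.y ξ)) hc
      linarith [b1 ξ]
    · exact (hg ξ).1 2
    · exact (hg ξ).1 3
    · exact (hg ξ).1 4
    · exact (hg ξ).1 5
  · linarith [b1 ξ]

lemma Params.envAt_withN {D : Params} {N : Set ℝ} {M a : ℝ} {m : ℝ → ℝ} {ξ : ℝ} {z : Vals} :
    (D.withN N).EnvAt M a m ξ z ↔ D.EnvAt M a m ξ z :=
  ⟨fun h => ⟨h.norm_le, h.p_le, h.q_le, h.h_le, h.r_le, h.ub_le⟩,
    fun h => ⟨h.norm_le, h.p_le, h.q_le, h.h_le, h.r_le, h.ub_le⟩⟩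

namespace Representative

variable {χ : ℝ → ℝ} {X : State} {z : ℝ → Vals} {κ C : ℝ}

/-- An envelope of the initial data. -/
lemma exists_envelope (h : Representative χ X z κ C) (hχ : IsPartitionFunction χ) (hX : MemG χ X)
    (M : ℝ) (hM : C ≤ M) (N : Set ℝ) : ∃ m B Cm, Envelope m B Cm ∧ MemLp m 2 volume ∧
      (∀ ξ, |ξ| ≤ M + 1 → 1 ≤ m ξ) ∧
      ∀ ξ, (Params.mk χ X.c X.k N).EnvAt M 1 m ξ (z ξ) := by
  have c : ∀ i, Measurable fun ξ => z ξ i := fun i => (measurable_pi_apply i).comp h.meas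
  have hUc := (hX.compatible.continuous_Ubar hχ).measurable
  set J := Icc (-(M + 1)) (M + 1) with hJ
  set m₀ : ℝ → ℝ := fun ξ => |X.Ubar ξ| + |z ξ 2 - 1| + |z ξ 3| + |z ξ 4| + |z ξ 5|
    + J.indicator (fun _ => (1 : ℝ)) ξ with hm₀
  have hJ0 : ∀ ξ, 0 ≤ J.indicator (fun _ => (1 : ℝ)) ξ := fun ξ =>
    indicator_nonneg (fun _ _ => zero_le_one) ξ
  have hi : Measurable (J.indicator fun _ : ℝ => (1 : ℝ)) :=
    measurable_const.indicator measurableSet_Icc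
  have hb := fun ξ i => (abs_le_norm (z ξ) i).trans (h.norm_le ξ)
  obtain ⟨m, B, Cm, hm, hle, h2⟩ := TwoCH.exists_envelope (m₀ := m₀) (B := 5 * C + 1 + 1)
    (((((hUc.norm.add ((c 2).sub measurable_const).norm).add (c 3).norm).add (c 4).norm).add
      (c 5).norm).add hi)
    (fun ξ => add_nonneg (by positivity) (hJ0 ξ))
    (fun ξ => by
      have h1 : J.indicator (fun _ => (1 : ℝ)) ξ ≤ 1 := indicator_le_self' (by simp) ξ
      have h2 : |z ξ 2 - 1| ≤ C + 1 := by
        refine (abs_sub _ _).trans ?_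
        rw [abs_one]
        linarith [hb ξ 2]
      simp only [hm₀]
      linarith [h.Ubar_le ξ, hb ξ 3, hb ξ 4, hb ξ 5])
    (by
      have e2 : MemLp (fun ξ => z ξ 2 - 1) 2 volume := hX.mem_Vbar.zetaXi.1.ae_eq (by
        filter_upwards [h.yXi] with ξ hξ
        rw [hξ, State.yXi]
        ring)
      have e3 : MemLp (fun ξ => z ξ 3) 2 volume := hX.mem_Vbar.UXi.1.ae_eq (by
        filter_upwards [h.UXi] with ξ hξ using hξ.symm)
      have e4 : MemLp (fun ξ => z ξ 4) 2 volume := hX.mem_Vbar.h.1.ae_eq (by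
        filter_upwards [h.h] with ξ hξ using hξ.symm)
      have e5 : MemLp (fun ξ => z ξ 5) 2 volume := hX.mem_Vbar.rbar.1.ae_eq (by
        filter_upwards [h.rbar] with ξ hξ using hξ.symm)
      have e6 : MemLp (J.indicator fun _ : ℝ => (1 : ℝ)) 2 volume :=
        memLp_indicator_const 2 measurableSet_Icc 1 (Or.inr measure_Icc_lt_top.ne)
      exact ((((hX.mem_Vbar.Ubar.1.norm.add e2.norm).add e3.norm).add e4.norm).add e5.norm).add e6)
  have hle' : ∀ ξ, |X.Ubar ξ| + |z ξ 2 - 1| + |z ξ 3| + |z ξ 4| + |z ξ 5|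
    + J.indicator (fun _ => (1 : ℝ)) ξ ≤ m ξ := hle
  refine ⟨m, B, Cm, hm, h2, fun ξ hξ => ?_, fun ξ => ?_⟩
  · have h1 : J.indicator (fun _ => (1 : ℝ)) ξ = 1 :=
      indicator_of_mem (show ξ ∈ Icc (-(M + 1)) (M + 1) from abs_le.1 hξ) _
    have := hle' ξ
    rw [h1] at this
    refine le_trans ?_ this
    have : 0 ≤ |X.Ubar ξ| + |z ξ 2 - 1| + |z ξ 3| + |z ξ 4| + |z ξ 5| := by positivity
    linarith
  · have g1 := abs_nonneg (X.Ubar ξ)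
    have g2 := abs_nonneg (z ξ 2 - 1)
    have g3 := abs_nonneg (z ξ 3)
    have g4 := abs_nonneg (z ξ 4)
    have g5 := abs_nonneg (z ξ 5)
    have g6 := hJ0 ξ
    have g7 := hle' ξ
    refine ⟨(h.norm_le ξ).trans hM, by linarith, by linarith, by linarith, by linarith, ?_⟩
    have e : (Params.mk χ X.c X.k N).ub ξ (z ξ) = X.Ubar ξ := by
      rw [Params.ub, h.U, h.zeta, State.U, State.y]
      ring
    rw [e]
    linarith

/-- The set of points where wave breaking is imminent is small. -/
lemma exists_small (h : Representative χ X z κ C) (hX : MemG χ X) {a : ℝ} (ha : 0 < a) :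
    ∃ ε > 0, ∀ ε' ≤ ε, volume {ξ | 0 < z ξ 2 ∧ z ξ 2 < ε'} ≤ ENNReal.ofReal a := by
  have c : ∀ i, Measurable fun ξ => z ξ i := fun i => (measurable_pi_apply i).comp h.meas
  have hκ := h.κ_pos
  have e4 : MemLp (fun ξ => z ξ 4) 2 volume := hX.mem_Vbar.h.1.ae_eq (by
    filter_upwards [h.h] with ξ hξ using hξ.symm)
  have hfin : volume {ξ | κ / 2 ≤ z ξ 4} < ⊤ := by
    have h1 := e4.meas_ge_lt_top (by norm_num) (by norm_num) (ε := (κ / 2).toNNReal) (by simpa using hκ)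
    refine lt_of_le_of_lt (measure_mono fun ξ hξ => ?_) h1
    change (κ / 2).toNNReal ≤ ‖z ξ 4‖₊
    rw [← NNReal.coe_le_coe, Real.coe_toNNReal _ (by positivity), coe_nnnorm, Real.norm_eq_abs]
    exact (show κ / 2 ≤ z ξ 4 from hξ).trans (le_abs_self _)
  set s : ℕ → Set ℝ := fun n => {ξ | 0 < z ξ 2 ∧ z ξ 2 < κ / 2 * (1 / ((n : ℝ) + 1))} with hs
  have hsub : ∀ n, s n ⊆ {ξ | κ / 2 ≤ z ξ 4} := fun n ξ hξ => by
    have h1 : 1 / ((n : ℝ) + 1) ≤ 1 := by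
      rw [div_le_one (by positivity)]
      linarith [(Nat.cast_nonneg n : (0 : ℝ) ≤ n)]
    have h2 : κ / 2 * (1 / ((n : ℝ) + 1)) ≤ κ / 2 :=
      mul_le_of_le_one_right (by positivity) h1
    have := h.denom ξ
    have := hξ.2
    change κ / 2 ≤ z ξ 4
    linarith
  have hanti : Antitone s := fun n m hnm ξ hξ => by
    refine ⟨hξ.1, hξ.2.trans_le ?_⟩
    have : (n : ℝ) ≤ m := by exact_mod_cast hnm
    gcongr
  have hinter : ⋂ n, s n = ∅ := by
    rw [eq_empty_iff_forall_notMem]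
    intro ξ hξ
    rw [mem_iInter] at hξ
    have hp := (hξ 0).1
    obtain ⟨n, hn⟩ := exists_nat_one_div_lt (show 0 < z ξ 2 / (κ / 2) by positivity)
    rw [lt_div_iff₀ (by positivity)] at hn
    have := (hξ n).2
    linarith [mul_comm (κ / 2) (1 / ((n : ℝ) + 1))]
  have hlim := tendsto_measure_iInter_atTop (μ := volume) (s := s) (fun n =>
    ((measurableSet_lt measurable_const (c 2)).inter
      (measurableSet_lt (c 2) measurable_const)).nullMeasurableSet) hanti
    ⟨0, ((measure_mono (hsub 0)).trans_lt hfin).ne⟩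
  rw [hinter, measure_empty] at hlim
  obtain ⟨n, hn⟩ := (hlim.eventually (gt_mem_nhds (ENNReal.ofReal_pos.2 ha))).exists
  refine ⟨κ / 2 * (1 / ((n : ℝ) + 1)), by positivity, fun ε' hε' => ?_⟩
  have hss : {ξ | 0 < z ξ 2 ∧ z ξ 2 < ε'} ⊆ s n := fun ξ hξ => ⟨hξ.1, hξ.2.trans_le hε'⟩
  exact (measure_mono hss).trans hn.le

/-- The setting for given initial data. -/
lemma exists_setting {C₀ : ℝ} (h : Representative χ X z κ C₀) (hχ : IsPartitionFunction χ) (hX : MemG χ X) :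
    ∃ S : Setting, S.D.χ = χ ∧ S.D.c = X.c ∧ S.D.k = X.k ∧ S.z₀ = z := by
  set M := C₀ + 1 with hM
  have c : ∀ i, Measurable fun ξ => z ξ i := fun i => (measurable_pi_apply i).comp h.meas
  set D : Params := ⟨χ, X.c, X.k, ∅⟩ with hD
  have hχD : IsPartitionFunction D.χ := hχ
  obtain ⟨m, B, Cm, hm, hm2, hm1, hmE⟩ := h.exists_envelope hχ hX M (by linarith) ∅
  set K := max (2 * ∫ x, m x ^ 2) (2 * M) with hK
  obtain ⟨L, hL, hL'⟩ := Params.exists_rhsAt_le_envelope hχD M K (2 + |D.c|) B Cm (by positivity)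
    m hm hm1
  obtain ⟨Λ, hΛ, hΛ'⟩ := Params.exists_norm_rhsAt_le hχD M K
  obtain ⟨C, hC, hC'⟩ := Params.exists_rhsAt_sub_le hχD M K
  have hB : 0 ≤ B := (hm.nonneg 0).trans (hm.le_bound 0)
  have hκ := h.κ_pos
  have hk := abs_nonneg X.k
  set L' := max L 1 with hLd
  have hL1 : 1 ≤ L' := le_max_right _ _
  set w := 1 + Λ + |X.k| * (|X.k| + 1) with hw
  have hw0 : 0 < w := by positivity
  obtain ⟨ε₁, hε₁, hvol⟩ := h.exists_small hX (a := κ / (32 * (C + 1))) (by positivity)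
  set ε := min ε₁ (κ / (8 * w)) with hε
  have hε0 : 0 < ε := lt_min hε₁ (by positivity)
  have hεw : ε * w ≤ κ / 8 := by
    have := mul_le_mul_of_nonneg_right (min_le_right ε₁ (κ / (8 * w))) hw0.le
    refine this.trans (le_of_eq ?_)
    field_simp
  set N : Set ℝ := {ξ | z ξ 2 < ε ∧ z ξ 3 ≤ 0 ∧ z ξ 5 + X.k * z ξ 2 = 0} with hN
  set N' : Set ℝ := N ∩ {ξ | 0 < z ξ 2} with hN'
  have hNm : MeasurableSet N' :=
    ((measurableSet_lt (c 2) measurable_const).inter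
      ((measurableSet_le (c 3) measurable_const).inter
        (measurableSet_eq_fun ((c 5).add ((c 2).const_mul _)) measurable_const))).inter
      (measurableSet_lt measurable_const (c 2))
  have hNv : volume N' ≤ ENNReal.ofReal (κ / (32 * (C + 1))) :=
    (measure_mono (show N' ⊆ {ξ | 0 < z ξ 2 ∧ z ξ 2 < ε} from
      fun ξ hξ => ⟨hξ.2, hξ.1.1⟩)).trans (hvol ε (min_le_left _ _))
  have hNt : volume N' ≠ ⊤ := (hNv.trans_lt ENNReal.ofReal_lt_top).ne
  have hNr : (volume N').toReal ≤ κ / (32 * (C + 1)) :=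
    ENNReal.toReal_le_of_le_ofReal (by positivity) hNv
  set ρ := min (1 / 2) (ε / 2) with hρ
  have hρ0 : 0 < ρ := lt_min (by norm_num) (by positivity)
  have hρ1 : ρ ≤ 1 / 2 := min_le_left _ _
  have hρ2 : ρ ≤ ε / 2 := min_le_right _ _
  set Θ := L' + L' * (1 + B) + Λ + 4 * C + 1 with hΘ
  have hL0 : 0 ≤ L' := zero_le_one.trans hL1
  have hLB : 0 ≤ L' * (1 + B) := by positivity
  have hΘ0 : 0 < Θ := by positivity
  set T := ρ / Θ with hT
  have hT0 : 0 < T := by positivity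
  have hle : ∀ {x : ℝ}, x ≤ Θ → x * T ≤ ρ := fun {x} hx => by
    refine (mul_le_mul_of_nonneg_right hx hT0.le).trans (le_of_eq ?_)
    rw [hT]
    field_simp
  refine ⟨{
    D := D.withN N
    z₀ := z
    m := m
    B := B
    Cm := Cm
    κ := κ
    M := M
    K := K
    L := L'
    Λ := Λ
    C := C
    ρ := ρ
    ε := ε
    T := T
    hχ := hχ
    meas_z₀ := h.meas
    norm_z₀ := fun ξ => (h.norm_le ξ).trans (by linarith)
    env := hm
    memLp_m := hm2
    one_le_m := hm1
    env_z₀ := fun ξ => Params.envAt_withN.2 (hmE ξ)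
    p_nonneg := h.p_nonneg
    identity := h.identity
    κ_pos := hκ
    denom := h.denom
    N_eq := rfl
    vol_N := hNt
    K_ge := le_max_left _ _
    K_ge' := le_max_right _ _
    one_le_L := hL1
    rhs_env := fun f hf hE ξ hξ => by
      obtain ⟨h1, h2⟩ := hL' N f hf (hE.mono fun η hη => Params.envAt_withN.1 hη) ξ
        (Params.envAt_withN.1 hξ)
      have hm0 := hm.nonneg ξ
      refine ⟨fun i => (h1 i).trans (mul_le_mul_of_nonneg_right (le_max_left _ _) ?_),
        h2.trans (mul_le_mul_of_nonneg_right (le_max_left _ _) hm0)⟩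
      unfold Params.wt
      split_ifs
      · exact zero_le_one
      · exact hm0
    Λ_nonneg := hΛ
    rhs_norm_withN := fun N f hf ξ hξ => ⟨(hΛ' N f hf ξ hξ).1, (hΛ' N f hf ξ hξ).2.1⟩
    C_nonneg := hC
    rhs_lip := fun f g d hf hg hd hae hmf hsgn ξ h1 h2 h3 =>
      hC' N f g d N' hf hg hd hae hNm hNt hmf hsgn ξ h1 h2 h3
    T_pos := hT0
    ε_pos := hε0
    LT_le := (hle (by linarith)).trans (by linarith)
    LBT_le := hle (by linarith)
    ΛT_le := hle (by linarith)
    ρ_le := hρ1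
    ρ_lt := hρ2
    small := by
      have : ρ * w ≤ ε / 2 * w := mul_le_mul_of_nonneg_right hρ2 hw0.le
      change (ε + ρ) * w ≤ κ / 4
      linarith
    contr := by
      have h1 : 4 * C * T ≤ ρ := hle (by linarith)
      have h2 : C * ((volume N').toReal * (2 / (κ / 4))) ≤ 1 / 4 := by
        calc C * ((volume N').toReal * (2 / (κ / 4)))
            ≤ (C + 1) * (κ / (32 * (C + 1)) * (2 / (κ / 4))) := by
              gcongr
              linarith
          _ = 1 / 4 := by
              field_simp
              norm_num
      change C * (T + (volume N').toReal * (2 / (κ / 4))) ≤ 1 / 2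
      linarith }, rfl, rfl, rfl, rfl⟩

end Representative

/-! ### The dissipative system at a single point -/

/-- The equations of the dissipative system at a single point, with the set `u` of times before
wave breaking and `A = U² + k²/2 - P`. -/
structure Path (T k : ℝ) (u : Set ℝ) (A p q h r : ℝ → ℝ) : Prop where
  mem_iff : ∀ t ∈ Icc 0 T, t ∈ u ↔ ∀ s ∈ Icc 0 t, 0 < p s
  p_eq : SolvesODE T p (u.indicator q)
  q_eq : SolvesODE T q (u.indicator fun t => 1 / 2 * h t + A t * p t + k * r t)
  h_eq : SolvesODE T h (u.indicator fun t => 2 * A t * q t)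
  r_eq : SolvesODE T r (u.indicator fun t => -(k * q t))
  p_zero : 0 ≤ p 0
  identity_zero : p 0 * h 0 = q 0 ^ 2 + r 0 ^ 2

namespace Path

variable {T k : ℝ} {u : Set ℝ} {A p q h r : ℝ → ℝ} (H : Path T k u A p q h r)

include H

lemma identity : ∀ t ∈ Icc 0 T, p t * h t = q t ^ 2 + r t ^ 2 := fun t ht => by
  have h1 := ((H.p_eq.mul H.h_eq).sub ((H.q_eq.mul H.q_eq).add (H.r_eq.mul H.r_eq))).const_of_zero
    fun t _ => by
      by_cases hu : t ∈ u
      · simp only [indicator_of_mem hu]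
        ring
      · simp only [indicator_of_notMem hu]
        ring
  have h2 := h1 t ht
  have h3 := H.identity_zero
  linarith

lemma conserved : ∀ t ∈ Icc 0 T, r t + k * p t = r 0 + k * p 0 :=
  (H.r_eq.add (H.p_eq.const_mul k)).const_of_zero fun t _ => by
    by_cases hu : t ∈ u
    · simp only [indicator_of_mem hu]
      ring
    · simp only [indicator_of_notMem hu]
      ring

lemma p_eq_zero_of_notMem {t : ℝ} (ht : t ∈ Icc 0 T) (hu : t ∉ u) : p t = 0 := by
  rw [H.mem_iff t ht] at hu
  push Not at hu
  obtain ⟨s, hs, hps⟩ := hu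
  have hs' : s ∈ Icc 0 T := ⟨hs.1, hs.2.trans ht.2⟩
  obtain ⟨x, hx, hx0⟩ := intermediate_value_Icc' hs.1
    (H.p_eq.continuousOn.mono (Icc_subset_Icc_right hs'.2)) ⟨hps, H.p_zero⟩
  have hx' : x ∈ Icc 0 T := ⟨hx.1, hx.2.trans hs'.2⟩
  rw [H.p_eq.eq_of_zero hx' ht (hx.2.trans hs.2) fun y hy => ?_, hx0]
  refine indicator_of_notMem (fun hyu => ?_) _
  have hy' : y ∈ Icc 0 T := ⟨hx.1.trans hy.1.le, hy.2.trans ht.2⟩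
  exact ((H.mem_iff y hy').1 hyu x ⟨hx.1, hy.1.le⟩).ne' hx0

lemma mem_iff_pos {t : ℝ} (ht : t ∈ Icc 0 T) : t ∈ u ↔ 0 < p t := by
  refine ⟨fun hu => (H.mem_iff t ht).1 hu t ⟨ht.1, le_rfl⟩, fun hp => ?_⟩
  by_contra hu
  exact hp.ne' (H.p_eq_zero_of_notMem ht hu)

lemma p_nonneg {t : ℝ} (ht : t ∈ Icc 0 T) : 0 ≤ p t := by
  by_cases hu : t ∈ u
  · exact ((H.mem_iff_pos ht).1 hu).le
  · exact (H.p_eq_zero_of_notMem ht hu).ge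

lemma eq_zero_of_p_eq_zero {t : ℝ} (ht : t ∈ Icc 0 T) (hp : p t = 0) : q t = 0 ∧ r t = 0 := by
  have h1 := H.identity t ht
  rw [hp, zero_mul] at h1
  constructor
  · exact pow_eq_zero_iff two_ne_zero |>.1 (by nlinarith [sq_nonneg (q t), sq_nonneg (r t)])
  · exact pow_eq_zero_iff two_ne_zero |>.1 (by nlinarith [sq_nonneg (q t), sq_nonneg (r t)])

omit H in
/-- The continuation of `U_ξ` beyond wave breaking. -/
def _root_.TwoCH.virtual (k : ℝ) (A p q h r : ℝ → ℝ) (t : ℝ) : ℝ :=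
  q 0 + ∫ s in (0 : ℝ)..t, (1 / 2 * h s + A s * p s + k * r s)

lemma sub_indicator {t : ℝ} (ht : t ∈ Icc 0 T) :
    (1 / 2 * h t + A t * p t + k * r t)
      = u.indicator (fun t => 1 / 2 * h t + A t * p t + k * r t) t
        + {s ∈ Icc 0 T | p s = 0}.indicator (fun t => 1 / 2 * h t) t := by
  by_cases hu : t ∈ u
  · rw [indicator_of_mem hu, indicator_of_notMem, add_zero]
    exact fun h => ((H.mem_iff_pos ht).1 hu).ne' h.2
  · have hp := H.p_eq_zero_of_notMem ht hu
    rw [indicator_of_notMem hu, indicator_of_mem (show t ∈ {s ∈ Icc 0 T | p s = 0} from ⟨ht, hp⟩),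
      hp, (H.eq_zero_of_p_eq_zero ht hp).2]
    ring

lemma integrable_indicator {t : ℝ} (ht : t ∈ Icc 0 T) :
    IntervalIntegrable ({s ∈ Icc 0 T | p s = 0}.indicator fun t => 1 / 2 * h t) volume 0 t := by
  have hcl : IsClosed {s ∈ Icc 0 T | p s = 0} :=
    H.p_eq.continuousOn.preimage_isClosed_of_isClosed isClosed_Icc (isClosed_singleton (x := 0))
  have h1 : IntervalIntegrable (fun t => 1 / 2 * h t) volume 0 t := by
    refine ContinuousOn.intervalIntegrable ?_
    rw [uIcc_of_le ht.1]
    exact continuousOn_const.mul (H.h_eq.continuousOn.mono (Icc_subset_Icc_right ht.2))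
  exact ⟨h1.1.indicator hcl.measurableSet, h1.2.indicator hcl.measurableSet⟩

lemma virtual_eq : SolvesODE T (virtual k A p q h r)
    fun t => 1 / 2 * h t + A t * p t + k * r t := fun t ht => by
  constructor
  · refine ((H.q_eq t ht).1.add (H.integrable_indicator ht)).congr fun s hs => ?_
    rw [uIoc_of_le ht.1] at hs
    exact (H.sub_indicator ⟨hs.1.le, hs.2.trans ht.2⟩).symm
  · simp [virtual]

lemma virtual_sub_eq {t : ℝ} (ht : t ∈ Icc 0 T) : virtual k A p q h r t - q t
    = ∫ s in (0 : ℝ)..t, {s ∈ Icc 0 T | p s = 0}.indicator (fun t => 1 / 2 * h t) s := by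
  have h1 : ∫ s in (0 : ℝ)..t, (1 / 2 * h s + A s * p s + k * r s)
      = ∫ s in (0 : ℝ)..t, (u.indicator (fun t => 1 / 2 * h t + A t * p t + k * r t) s
        + {s ∈ Icc 0 T | p s = 0}.indicator (fun t => 1 / 2 * h t) s) := by
    refine intervalIntegral.integral_congr fun s hs => ?_
    rw [uIcc_of_le ht.1] at hs
    exact H.sub_indicator ⟨hs.1, hs.2.trans ht.2⟩
  rw [virtual, h1, intervalIntegral.integral_add (H.q_eq t ht).1 (H.integrable_indicator ht),
    (H.q_eq t ht).2]
  ring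

lemma virtual_of_pos {t : ℝ} (ht : t ∈ Icc 0 T) (hp : 0 < p t) :
    virtual k A p q h r t = q t := by
  have hu := (H.mem_iff t ht).1 ((H.mem_iff_pos ht).2 hp)
  have h1 := H.virtual_sub_eq ht
  rw [intervalIntegral.integral_congr (g := fun _ => 0) fun s hs => ?_] at h1
  · simp at h1
    linarith
  · rw [uIcc_of_le ht.1] at hs
    exact indicator_of_notMem (fun h => (hu s hs).ne' h.2) _

lemma virtual_nonneg (hh : ∀ s ∈ Icc 0 T, p s = 0 → 0 ≤ h s) {t : ℝ} (ht : t ∈ Icc 0 T)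
    (hp : p t = 0) : 0 ≤ virtual k A p q h r t := by
  have h1 := H.virtual_sub_eq ht
  rw [(H.eq_zero_of_p_eq_zero ht hp).1, sub_zero] at h1
  rw [h1]
  refine intervalIntegral.integral_nonneg ht.1 fun s hs => ?_
  refine indicator_nonneg (fun x hx => ?_) s
  have := hh x hx.1 hx.2
  positivity

/-- Before wave breaking at a breaking candidate, `U_ξ` is negative. -/
lemma q_neg (hq : q 0 ≤ 0) (hr : r 0 + k * p 0 = 0)
    (hpos : ∀ t ∈ Icc 0 T, 0 < h t - k ^ 2 * p t) {t : ℝ} (ht : t ∈ Icc 0 T) (hp : 0 < p t) :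
    q t < 0 := by
  have hu := (H.mem_iff t ht).1 ((H.mem_iff_pos ht).2 hp)
  by_contra hqt
  obtain ⟨s, hs, hs0⟩ := intermediate_value_Icc ht.1
    (H.q_eq.continuousOn.mono (Icc_subset_Icc_right ht.2)) ⟨hq, not_lt.1 hqt⟩
  have hs' : s ∈ Icc 0 T := ⟨hs.1, hs.2.trans ht.2⟩
  have h1 := H.identity s hs'
  have h2 := H.conserved s hs'
  rw [hr] at h2
  rw [hs0, show r s = -(k * p s) by linarith] at h1
  have := mul_pos (hu s hs) (hpos s hs')
  nlinarith

end Path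

lemma SolvesODE.abs_sub_le {T : ℝ} {f F : ℝ → ℝ} (hf : SolvesODE T f F) {s t C : ℝ}
    (hs : s ∈ Icc 0 T) (ht : t ∈ Icc 0 T) (hst : s ≤ t) (hC : ∀ x ∈ Icc s t, |F x| ≤ C) :
    |f t - f s| ≤ C * (t - s) := by
  rw [hf.sub_eq hs ht, ← Real.norm_eq_abs]
  refine (intervalIntegral.norm_integral_le_of_norm_le_const (C := C) fun x hx => ?_).trans ?_
  · rw [uIoc_of_le hst] at hx
    exact hC x ⟨hx.1.le, hx.2⟩
  · rw [abs_of_nonneg (sub_nonneg.2 hst)]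

/-- A bound that holds almost everywhere at each time holds almost everywhere at all times. -/
lemma ae_forall_of_forall_ae {a b C : ℝ} {w : ℝ → ℝ → ℝ}
    (hc : ∀ᵐ ξ, ContinuousOn (fun t => w t ξ) (Icc a b))
    (h : ∀ t ∈ Icc a b, ∀ᵐ ξ, w t ξ ≤ C) : ∀ᵐ ξ, ∀ t ∈ Icc a b, w t ξ ≤ C := by
  obtain ⟨s, hs, hd⟩ := TopologicalSpace.exists_countable_dense (Icc a b)
  have h1 : ∀ᵐ ξ, ∀ t ∈ s, w t ξ ≤ C := (ae_ball_iff hs).2 fun t _ => h t t.2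
  filter_upwards [hc, h1] with ξ hc h1 t ht
  have hcl : IsClosed {x : Icc a b | w x ξ ≤ C} :=
    isClosed_le (continuousOn_iff_continuous_domRestrict.1 hc) continuous_const
  have := (hcl.closure_subset_iff (s := s)).2 h1
  rw [hd.closure_eq] at this
  exact this (mem_univ ⟨t, ht⟩)

/-! ### A priori bounds for solutions -/

/-- The values of the Lagrangian variables of a state. -/
def State.vals (χ : ℝ → ℝ) (X : State) (ξ : ℝ) : Vals :=
  ![X.zeta ξ, X.U χ ξ, X.yXi ξ, X.UXi ξ, X.h ξ, X.rbar ξ]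

/-- The coefficient `U² + k²/2 - P` along a curve. -/
def acoef (χ : ℝ → ℝ) (T : ℝ) (Y : ℝ → State) (t ξ : ℝ) : ℝ :=
  (Y t).U χ ξ ^ 2 + 1 / 2 * (Y t).k ^ 2 - P χ T Y t ξ

/-- The right-hand side of the dissipative system. -/
def solRhs (χ : ℝ → ℝ) (T k : ℝ) (Y : ℝ → State) (t ξ : ℝ) : Vals :=
  ![(Y t).U χ ξ, -Q χ T Y t ξ, {s | ξ ∈ unbroken T Y s}.indicator (fun t => (Y t).UXi ξ) t,
    {s | ξ ∈ unbroken T Y s}.indicator (fun t => 1 / 2 * (Y t).h ξ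
      + acoef χ T Y t ξ * (Y t).yXi ξ + k * (Y t).rbar ξ) t,
    {s | ξ ∈ unbroken T Y s}.indicator (fun t => 2 * acoef χ T Y t ξ * (Y t).UXi ξ) t,
    {s | ξ ∈ unbroken T Y s}.indicator (fun t => -(k * (Y t).UXi ξ)) t]

namespace Setting

variable {S : Setting} {Y : ℝ → State}

/-- The initial data of the setting represent the state `X`. -/
structure Starts (S : Setting) (X : State) : Prop where
  c : X.c = S.D.c
  k : X.k = S.D.k
  vals : ∀ᵐ ξ, X.vals S.D.χ ξ = S.z₀ ξ

/-- Points at which a solution satisfies the equations pointwise. -/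
structure GoodPoint (S : Setting) (Y : ℝ → State) (ξ : ℝ) : Prop where
  solves : ∀ i, SolvesODE S.T (fun t => (Y t).vals S.D.χ ξ i)
    fun t => solRhs S.D.χ S.T S.D.k Y t ξ i
  init : (Y 0).vals S.D.χ ξ = S.z₀ ξ
  path : Path S.T S.D.k {t | ξ ∈ unbroken S.T Y t} (fun t => acoef S.D.χ S.T Y t ξ)
    (fun t => (Y t).yXi ξ) (fun t => (Y t).UXi ξ) (fun t => (Y t).h ξ) (fun t => (Y t).rbar ξ)

variable (hY : IsSolution S.D.χ S.T Y) (h0 : S.Starts (Y 0))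

include hY h0

lemma c_eq {t : ℝ} (ht : t ∈ Icc 0 S.T) : (Y t).c = S.D.c :=
  (hY.c_eq.const_of_zero (fun _ _ => rfl) t ht).trans h0.c

lemma k_eq {t : ℝ} (ht : t ∈ Icc 0 S.T) : (Y t).k = S.D.k :=
  (hY.k_eq.const_of_zero (fun _ _ => rfl) t ht).trans h0.k

lemma ae_goodPoint : ∀ᵐ ξ, S.GoodPoint Y ξ := by
  filter_upwards [h0.vals, hY.yXi_eq, hY.UXi_eq, hY.h_eq, hY.rbar_eq] with ξ hv hp hq hh hr
  have hk := fun {t} ht => k_eq hY h0 (t := t) ht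
  have hind : ∀ (u : ℝ → ℝ → ℝ) (t : ℝ), (unbroken S.T Y t).indicator (u t) ξ
      = {s | ξ ∈ unbroken S.T Y s}.indicator (fun t => u t ξ) t := fun u t => rfl
  have hz : SolvesODE S.T (fun t => (Y t).zeta ξ) fun t => (Y t).U S.D.χ ξ := by
    have h : SolvesODE S.T (fun _ => -ξ) fun _ => 0 := fun t _ =>
      ⟨intervalIntegrable_const, by simp⟩
    refine (h.add (hY.y_eq ξ)).congr (fun t _ => ?_) fun t _ => zero_add _
    rw [State.y]
    ring
  have hq' : SolvesODE S.T (fun t => (Y t).UXi ξ) ({s | ξ ∈ unbroken S.T Y s}.indicator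
      fun t => 1 / 2 * (Y t).h ξ + acoef S.D.χ S.T Y t ξ * (Y t).yXi ξ + S.D.k * (Y t).rbar ξ) := by
    refine hq.congr (fun _ _ => rfl) fun t ht => ?_
    rw [← hk ht]
    exact hind (fun t ξ => 1 / 2 * (Y t).h ξ + acoef S.D.χ S.T Y t ξ * (Y t).yXi ξ
      + (Y t).k * (Y t).rbar ξ) t
  have hr' : SolvesODE S.T (fun t => (Y t).rbar ξ) ({s | ξ ∈ unbroken S.T Y s}.indicator
      fun t => -(S.D.k * (Y t).UXi ξ)) := by
    refine hr.congr (fun _ _ => rfl) fun t ht => ?_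
    rw [← hk ht]
    exact hind (fun t ξ => -((Y t).k * (Y t).UXi ξ)) t
  refine ⟨fun i => ?_, hv, ?_⟩
  · fin_cases i
    · exact hz
    · exact hY.U_eq ξ
    · exact hp
    · exact hq'
    · exact hh
    · exact hr'
  · have e2 : (Y 0).yXi ξ = S.z₀ ξ 2 := congrFun hv 2
    have e3 : (Y 0).UXi ξ = S.z₀ ξ 3 := congrFun hv 3
    have e4 : (Y 0).h ξ = S.z₀ ξ 4 := congrFun hv 4
    have e5 : (Y 0).rbar ξ = S.z₀ ξ 5 := congrFun hv 5
    refine ⟨fun t ht => mem_unbroken_iff ht hp.continuousOn, hp, hq', hh, hr', ?_, ?_⟩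
    · simp only [e2]
      exact S.p_nonneg ξ
    · simp only [e2, e3, e4, e5]
      exact S.identity ξ

omit hY h0 in
lemma GoodPoint.continuousOn {ξ : ℝ} (h : S.GoodPoint Y ξ) :
    ContinuousOn (fun t => (Y t).vals S.D.χ ξ) (Icc 0 S.T) :=
  continuousOn_pi.2 fun i => (h.solves i).continuousOn

omit h0 in
lemma aemeasurable_vals {t : ℝ} (ht : t ∈ Icc 0 S.T) (i : Fin 6) :
    AEMeasurable (fun ξ => (Y t).vals S.D.χ ξ i) volume := by
  have hc := hY.compatible t ht
  have hV := hY.curve.mem_Vbar t ht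
  fin_cases i
  · exact hc.zeta.continuous.measurable.aemeasurable
  · exact hc.U.continuous.measurable.aemeasurable
  · exact aemeasurable_const.add hV.zetaXi.1.1.aemeasurable
  · exact hV.UXi.1.1.aemeasurable
  · exact hV.h.1.1.aemeasurable
  · exact hV.rbar.1.1.aemeasurable

lemma nullMeasurableSet_unbroken {t : ℝ} (ht : t ∈ Icc 0 S.T) :
    NullMeasurableSet (unbroken S.T Y t) volume := by
  have h1 : NullMeasurableSet {ξ | 0 < (Y t).yXi ξ} volume :=
    nullMeasurableSet_lt aemeasurable_const (aemeasurable_vals hY ht 2)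
  refine h1.congr ?_
  filter_upwards [ae_goodPoint hY h0] with ξ hξ
  exact propext (hξ.path.mem_iff_pos ht).symm

/-- A solution is represented by its values when exactly the points with `y_ξ ≤ 0` are taken to be
breaking candidates. -/
lemma represents_vals {t : ℝ} (ht : t ∈ Icc 0 S.T) :
    (S.D.withN {ξ | (Y t).yXi ξ ≤ 0}).Represents (unbroken S.T Y t) (Y t)
      ((Y t).vals S.D.χ) where
  c := c_eq hY h0 ht
  k := k_eq hY h0 ht
  zeta _ := rfl
  U _ := rfl
  yXi := Eventually.of_forall fun _ => rfl
  h := Eventually.of_forall fun _ => rfl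
  rbar := Eventually.of_forall fun _ => rfl
  mem_iff := by
    filter_upwards [ae_goodPoint hY h0] with ξ hξ
    refine (hξ.path.mem_iff_pos ht).trans ⟨fun h hb => absurd hb.1 (not_le.2 h), fun h => ?_⟩
    by_contra hp
    refine h ⟨not_lt.1 hp, ?_⟩
    have hz := le_antisymm (not_lt.1 hp) (hξ.path.p_nonneg ht)
    exact (hξ.path.eq_zero_of_p_eq_zero ht hz).1.ge
  deriv := (hY.compatible t ht).hasDerivAE_y
  meas_mem := nullMeasurableSet_unbroken hY h0 ht
  meas i _ := aemeasurable_vals hY ht i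

lemma profile_vals {t : ℝ} (ht : t ∈ Icc 0 S.T) (hb : ∀ᵐ ξ, ‖(Y t).vals S.D.χ ξ‖ ≤ S.M) :
    (S.D.withN {ξ | (Y t).yXi ξ ≤ 0}).Profile S.M S.K ((Y t).vals S.D.χ) := by
  refine (represents_vals hY h0 ht).profile S.hχ S.K_ge' hb fun ξ => ?_
  refine le_of_ae_le_of_continuous (hY.compatible t ht).zeta.continuous.abs ?_ ξ
  filter_upwards [hb] with ξ hξ using (abs_le_norm _ 0).trans hξ

lemma abs_acoef_le {t ξ : ℝ} (ht : t ∈ Icc 0 S.T) (hb : ∀ᵐ ξ, ‖(Y t).vals S.D.χ ξ‖ ≤ S.M)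
    (hξ : ‖(Y t).vals S.D.χ ξ‖ ≤ S.M) : |acoef S.D.χ S.T Y t ξ| ≤ S.Λ ∧
      |1 / 2 * (Y t).h ξ + acoef S.D.χ S.T Y t ξ * (Y t).yXi ξ + S.D.k * (Y t).rbar ξ| ≤ S.Λ := by
  have hp := profile_vals hY h0 ht hb
  have e : acoef S.D.χ S.T Y t ξ = _ := (represents_vals hY h0 ht).P_eq S.hχ hp ξ
  have h1 := S.rhs_norm_withN _ _ hp ξ hξ
  rw [e]
  exact ⟨h1.2, (abs_le_norm _ 3).trans h1.1⟩

lemma abs_solRhs_le {t ξ : ℝ} (ht : t ∈ Icc 0 S.T) (hb : ∀ᵐ ξ, ‖(Y t).vals S.D.χ ξ‖ ≤ S.M)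
    (hg : S.GoodPoint Y ξ) (hξ : ‖(Y t).vals S.D.χ ξ‖ ≤ S.M) (i : Fin 6) :
    |solRhs S.D.χ S.T S.D.k Y t ξ i| ≤ S.Λ := by
  have hp := profile_vals hY h0 ht hb
  have hr := represents_vals hY h0 ht
  have e : acoef S.D.χ S.T Y t ξ = _ := hr.P_eq S.hχ hp ξ
  have h1 := (S.rhs_norm_withN _ _ hp ξ hξ).1
  have htr : (S.D.withN {ξ | (Y t).yXi ξ ≤ 0}).trunc ξ ((Y t).vals S.D.χ ξ) = (Y t).UXi ξ := by
    unfold Params.trunc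
    split_ifs with h
    · have hz := le_antisymm h (hg.path.p_nonneg ht)
      have : (Y t).UXi ξ = 0 := (hg.path.eq_zero_of_p_eq_zero ht hz).1
      change min ((Y t).UXi ξ) 0 = _
      rw [this, min_self]
    · rfl
  have hind : ∀ (u : ℝ → ℝ), |u t| ≤ S.Λ →
      |{s | ξ ∈ unbroken S.T Y s}.indicator u t| ≤ S.Λ := fun u hu => by
    by_cases h : t ∈ {s | ξ ∈ unbroken S.T Y s}
    · rwa [indicator_of_mem h]
    · rw [indicator_of_notMem h, abs_zero]
      exact S.Λ_nonneg
  have hn := fun i => (abs_le_norm _ i).trans h1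
  fin_cases i
  · exact hn 0
  · have := hn 1
    rwa [← hr.Q_eq S.hχ hp] at this
  · refine hind (fun t => (Y t).UXi ξ) ?_
    have : |(S.D.withN {ξ | (Y t).yXi ξ ≤ 0}).trunc ξ ((Y t).vals S.D.χ ξ)| ≤ S.Λ := hn 2
    rwa [htr] at this
  · refine hind (fun t => 1 / 2 * (Y t).h ξ
      + acoef S.D.χ S.T Y t ξ * (Y t).yXi ξ + S.D.k * (Y t).rbar ξ) ?_
    have := hn 3
    simp only [e]
    exact this
  · refine hind (fun t => 2 * acoef S.D.χ S.T Y t ξ * (Y t).UXi ξ) ?_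
    have : |2 * (S.D.withN {ξ | (Y t).yXi ξ ≤ 0}).coef ((Y t).vals S.D.χ) ξ
      * (S.D.withN {ξ | (Y t).yXi ξ ≤ 0}).trunc ξ ((Y t).vals S.D.χ ξ)| ≤ S.Λ := hn 4
    rw [htr, ← e] at this
    exact this
  · refine hind (fun t => -(S.D.k * (Y t).UXi ξ)) ?_
    have : |-(S.D.k * (S.D.withN {ξ | (Y t).yXi ξ ≤ 0}).trunc ξ ((Y t).vals S.D.χ ξ))| ≤ S.Λ :=
      hn 5
    rwa [htr] at this

/-- Values of the solution at nearby times are close almost everywhere. -/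
lemma eventually_vals_close {t : ℝ} (ht : t ∈ Icc 0 S.T) :
    ∀ᶠ s in 𝓝[Icc 0 S.T] t, ∀ᵐ ξ, ‖(Y s).vals S.D.χ ξ - (Y t).vals S.D.χ ξ‖ ≤ 1 / 2 := by
  obtain ⟨C, hC, -, hl⟩ := S.hχ.bddLip
  set a := 1 / (2 * (1 + |S.D.c| * C)) with ha
  have hcC : 0 ≤ |S.D.c| * C := mul_nonneg (abs_nonneg _) hC
  have ha0 : 0 < a := by positivity
  have ha1 : a + |S.D.c| * C * a = 1 / 2 := by
    rw [ha]
    field_simp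
  have hev := (hY.curve.continuous t ht).eventually
    (gt_mem_nhds (ENNReal.ofReal_pos.2 ha0))
  filter_upwards [hev, self_mem_nhdsWithin] with s hs hsT
  have hle : ∀ {u : ℝ → ℝ}, eLpNorm u ∞ volume ≤ (Y s).distVbar (Y t) → ∀ᵐ ξ, |u ξ| ≤ a :=
    fun {u} hu => by
      have h1 : eLpNormEssSup u volume ≤ ENNReal.ofReal a := by
        rw [← eLpNorm_exponent_top]
        exact hu.trans hs.le
      filter_upwards [ae_le_eLpNormEssSup (f := u) (μ := volume)] with x hx
      have h2 := hx.trans h1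
      rwa [Real.enorm_eq_ofReal_abs, ENNReal.ofReal_le_ofReal_iff ha0.le] at h2
  have b : ∀ u : ℝ → ℝ, eLpNorm u ∞ volume ≤ normE u := fun u => le_add_self
  have i0 : eLpNorm ((Y s).zeta - (Y t).zeta) ∞ volume ≤ (Y s).distVbar (Y t) := by
    unfold State.distVbar
    simp only [add_assoc]
    exact le_self_add
  have i1 : normE ((Y s).Ubar - (Y t).Ubar) ≤ (Y s).distVbar (Y t) := by
    unfold State.distVbar
    simp only [add_assoc]
    exact le_add_left le_self_add
  have i2 : normE ((Y s).zetaXi - (Y t).zetaXi) ≤ (Y s).distVbar (Y t) := by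
    unfold State.distVbar
    simp only [add_assoc]
    exact le_add_left (le_add_left (le_add_left le_self_add))
  have i3 : normE ((Y s).UXi - (Y t).UXi) ≤ (Y s).distVbar (Y t) := by
    unfold State.distVbar
    simp only [add_assoc]
    exact le_add_left (le_add_left (le_add_left (le_add_left le_self_add)))
  have i4 : normE ((Y s).h - (Y t).h) ≤ (Y s).distVbar (Y t) := by
    unfold State.distVbar
    simp only [add_assoc]
    exact le_add_left (le_add_left (le_add_left (le_add_left (le_add_left le_self_add))))
  have i5 : normE ((Y s).rbar - (Y t).rbar) ≤ (Y s).distVbar (Y t) := by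
    unfold State.distVbar
    simp only [add_assoc]
    exact le_add_left (le_add_left (le_add_left (le_add_left (le_add_left
      (le_add_left le_self_add)))))
  have hax : a ≤ 1 / 2 := by
    rw [← ha1]
    exact le_add_of_nonneg_right (by positivity)
  filter_upwards [hle i0, hle ((b _).trans i1), hle ((b _).trans i2), hle ((b _).trans i3),
    hle ((b _).trans i4), hle ((b _).trans i5)] with ξ j0 j1 j2 j3 j4 j5
  rw [pi_norm_le_iff_of_nonneg (by norm_num)]
  intro i
  fin_cases i
  · exact j0.trans hax
  · have e : (Y s).U S.D.χ ξ - (Y t).U S.D.χ ξ = ((Y s).Ubar ξ - (Y t).Ubar ξ)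
        + S.D.c * (S.D.χ ((Y s).y ξ) - S.D.χ ((Y t).y ξ)) := by
      rw [State.U, State.U, c_eq hY h0 ht, c_eq hY h0 hsT]
      ring
    change |(Y s).U S.D.χ ξ - (Y t).U S.D.χ ξ| ≤ _
    have h2 : |(Y s).y ξ - (Y t).y ξ| ≤ a := by
      rw [State.y, State.y, add_sub_add_left_eq_sub]
      exact j0
    have h3 := mul_le_mul_of_nonneg_left ((hl _ _).trans (mul_le_mul_of_nonneg_left h2 hC))
      (abs_nonneg S.D.c)
    rw [e, ← ha1]
    refine (abs_add_le _ _).trans (add_le_add j1 ?_)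
    rw [abs_mul, mul_assoc]
    exact h3
  · change |(1 + (Y s).zetaXi ξ) - (1 + (Y t).zetaXi ξ)| ≤ _
    rw [add_sub_add_left_eq_sub]
    exact le_trans j2 hax
  · exact le_trans j3 hax
  · exact le_trans j4 hax
  · exact le_trans j5 hax

/-- Solutions move with speed at most `Λ`. -/
lemma ae_norm_vals_sub_le : ∀ t ∈ Icc 0 S.T, ∀ᵐ ξ, ‖(Y t).vals S.D.χ ξ - S.z₀ ξ‖ ≤ S.Λ * t := by
  have hg := ae_goodPoint hY h0
  have hT := S.T_pos.le
  set s : Set ℝ := {t | ∀ᵐ ξ, ‖(Y t).vals S.D.χ ξ - S.z₀ ξ‖ ≤ S.Λ * t} with hs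
  have hcl : IsClosed (s ∩ Icc 0 S.T) := by
    refine IsSeqClosed.isClosed fun u t hu hut => ?_
    have ht : t ∈ Icc 0 S.T := isClosed_Icc.mem_of_tendsto hut (Eventually.of_forall fun n => (hu n).2)
    refine ⟨?_, ht⟩
    have h1 : ∀ᵐ ξ, ∀ n, ‖(Y (u n)).vals S.D.χ ξ - S.z₀ ξ‖ ≤ S.Λ * u n :=
      ae_all_iff.2 fun n => (hu n).1
    change ∀ᵐ ξ, _
    filter_upwards [hg, h1] with ξ hξ h1
    have hc := (hξ.continuousOn t ht).tendsto
    have hu' : Tendsto u atTop (𝓝[Icc 0 S.T] t) :=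
      tendsto_nhdsWithin_iff.2 ⟨hut, Eventually.of_forall fun n => (hu n).2⟩
    exact le_of_tendsto_of_tendsto' (((hc.comp hu').sub_const _).norm) (hut.const_mul _) h1
  have h0s : (0 : ℝ) ∈ s := by
    change ∀ᵐ ξ, _
    filter_upwards [h0.vals] with ξ hξ
    rw [hξ, sub_self, norm_zero, mul_zero]
  refine fun t ht => hcl.Icc_subset_of_forall_exists_gt h0s (fun t ht y hy => ?_) ht
  have htT : t ∈ Icc 0 S.T := Ico_subset_Icc_self ht.2
  have hts : ∀ᵐ ξ, ‖(Y t).vals S.D.χ ξ - S.z₀ ξ‖ ≤ S.Λ * t := ht.1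
  obtain ⟨e, he, hball⟩ := Metric.mem_nhdsWithin_iff.1 (eventually_vals_close hY h0 htT)
  set t' := min (min y S.T) (t + e / 2) with ht'
  have htt' : t < t' := lt_min (lt_min hy ht.2.2) (by linarith)
  have ht'T : t' ≤ S.T := (min_le_left _ _).trans (min_le_right _ _)
  have ht'e : t' ≤ t + e / 2 := min_le_right _ _
  have hIcc : ∀ x ∈ Icc t t', x ∈ Icc 0 S.T := fun x hx => ⟨htT.1.trans hx.1, hx.2.trans ht'T⟩
  refine ⟨t', ?_, htt', (min_le_left _ _).trans (min_le_left _ _)⟩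
  have hM : ∀ x ∈ Icc t t', ∀ᵐ ξ, ‖(Y x).vals S.D.χ ξ‖ ≤ S.M := fun x hx => by
    have h1 : ∀ᵐ ξ, ‖(Y x).vals S.D.χ ξ - (Y t).vals S.D.χ ξ‖ ≤ 1 / 2 := by
      refine hball ⟨?_, hIcc x hx⟩
      rw [Metric.mem_ball, Real.dist_eq, abs_of_nonneg (sub_nonneg.2 hx.1)]
      linarith [hx.2]
    filter_upwards [h1, hts] with ξ h1 h2
    have h3 := S.norm_z₀ ξ
    have h4 := norm_add₃_le (a := (Y x).vals S.D.χ ξ - (Y t).vals S.D.χ ξ)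
      (b := (Y t).vals S.D.χ ξ - S.z₀ ξ) (c := S.z₀ ξ)
    have h5 : S.Λ * t ≤ S.Λ * S.T := mul_le_mul_of_nonneg_left htT.2 S.Λ_nonneg
    rw [sub_add_sub_cancel, sub_add_cancel] at h4
    linarith [S.ΛT_le, S.ρ_le]
  have hM' : ∀ᵐ ξ, ∀ x ∈ Icc t t', ‖(Y x).vals S.D.χ ξ‖ ≤ S.M := by
    refine ae_forall_of_forall_ae ?_ hM
    filter_upwards [hg] with ξ hξ
    exact (hξ.continuousOn.mono hIcc).norm
  change ∀ᵐ ξ, _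
  filter_upwards [hg, hM', hts] with ξ hξ hMξ htξ
  have h1 : ‖(Y t').vals S.D.χ ξ - (Y t).vals S.D.χ ξ‖ ≤ S.Λ * (t' - t) := by
    rw [pi_norm_le_iff_of_nonneg (mul_nonneg S.Λ_nonneg (by linarith))]
    intro i
    exact (hξ.solves i).abs_sub_le htT (hIcc t' ⟨htt'.le, le_rfl⟩) htt'.le fun x hx =>
      abs_solRhs_le hY h0 (hIcc x hx) (hM x hx) hξ (hMξ x hx) i
  calc ‖(Y t').vals S.D.χ ξ - S.z₀ ξ‖
      = ‖((Y t').vals S.D.χ ξ - (Y t).vals S.D.χ ξ) + ((Y t).vals S.D.χ ξ - S.z₀ ξ)‖ := by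
        rw [sub_add_sub_cancel]
    _ ≤ S.Λ * (t' - t) + S.Λ * t := (norm_add_le _ _).trans (add_le_add h1 htξ)
    _ = S.Λ * t' := by ring

lemma ae_norm_vals_sub_le_ρ :
    ∀ᵐ ξ, ∀ t ∈ Icc 0 S.T, ‖(Y t).vals S.D.χ ξ - S.z₀ ξ‖ ≤ S.ρ := by
  refine ae_forall_of_forall_ae ?_ fun t ht => ?_
  · filter_upwards [ae_goodPoint hY h0] with ξ hξ
    exact (hξ.continuousOn.sub continuousOn_const).norm
  · filter_upwards [ae_norm_vals_sub_le hY h0 t ht] with ξ hξ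
    exact hξ.trans ((mul_le_mul_of_nonneg_left ht.2 S.Λ_nonneg).trans S.ΛT_le)

omit hY h0 in
lemma norm_le_of_sub_le {z : Vals} {ξ : ℝ} (h : ‖z - S.z₀ ξ‖ ≤ S.ρ) : ‖z‖ ≤ S.M := by
  have h2 := S.norm_z₀ ξ
  have h3 := norm_le_norm_add_norm_sub' z (S.z₀ ξ)
  linarith [S.ρ_le]

end Setting

/-! ### Uniqueness -/

/-- The values of a curve with `U_ξ` continued beyond wave breaking. -/
def virtualVals (χ : ℝ → ℝ) (T k : ℝ) (Y : ℝ → State) (t ξ : ℝ) : Vals :=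
  ![(Y t).zeta ξ, (Y t).U χ ξ, (Y t).yXi ξ,
    virtual k (fun t => acoef χ T Y t ξ) (fun t => (Y t).yXi ξ) (fun t => (Y t).UXi ξ)
      (fun t => (Y t).h ξ) (fun t => (Y t).rbar ξ) t, (Y t).h ξ, (Y t).rbar ξ]

namespace Setting

variable {S : Setting} {Y : ℝ → State}

/-- Points at which a solution satisfies the equations pointwise and stays close to the initial
data. -/
structure NearPoint (S : Setting) (Y : ℝ → State) (ξ : ℝ) : Prop extends S.GoodPoint Y ξ where
  near : ∀ t ∈ Icc 0 S.T, ‖(Y t).vals S.D.χ ξ - S.z₀ ξ‖ ≤ S.ρ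

variable (hY : IsSolution S.D.χ S.T Y) (h0 : S.Starts (Y 0))

include hY h0

lemma ae_nearPoint : ∀ᵐ ξ, S.NearPoint Y ξ := by
  filter_upwards [ae_goodPoint hY h0, ae_norm_vals_sub_le_ρ hY h0] with ξ h1 h2 using ⟨h1, h2⟩

lemma ae_norm_vals_le {t : ℝ} (ht : t ∈ Icc 0 S.T) : ∀ᵐ ξ, ‖(Y t).vals S.D.χ ξ‖ ≤ S.M := by
  filter_upwards [ae_nearPoint hY h0] with ξ hξ using norm_le_of_sub_le (hξ.near t ht)

namespace NearPoint

variable {ξ t : ℝ} (H : S.NearPoint Y ξ) (ht : t ∈ Icc 0 S.T)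

include H ht

lemma abs_acoef_le : |acoef S.D.χ S.T Y t ξ| ≤ S.Λ ∧
    |1 / 2 * (Y t).h ξ + acoef S.D.χ S.T Y t ξ * (Y t).yXi ξ + S.D.k * (Y t).rbar ξ| ≤ S.Λ :=
  Setting.abs_acoef_le hY h0 ht (ae_norm_vals_le hY h0 ht) (norm_le_of_sub_le (H.near t ht))

omit hY h0 in
lemma half_κ_le : S.κ / 2 ≤ (Y t).yXi ξ + (Y t).h ξ := by
  have d2 : |(Y t).yXi ξ - S.z₀ ξ 2| ≤ S.ρ := (abs_sub_le_norm _ _ 2).trans (H.near t ht)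
  have d4 : |(Y t).h ξ - S.z₀ ξ 4| ≤ S.ρ := (abs_sub_le_norm _ _ 4).trans (H.near t ht)
  have := abs_le.1 d2
  have := abs_le.1 d4
  linarith [S.denom ξ, S.ρ_le_κ.2, S.ε_pos]

lemma δ_le (h1 : S.z₀ ξ 2 < S.ε) (h2 : S.z₀ ξ 5 + S.D.k * S.z₀ ξ 2 = 0) :
    S.δ ≤ 1 / 2 * (Y t).h ξ + acoef S.D.χ S.T Y t ξ * (Y t).yXi ξ + S.D.k * (Y t).rbar ξ :=
  Setting.δ_le h1 h2 (H.near t ht) (H.abs_acoef_le hY h0 ht).1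

lemma p_pos (hξ : ξ ∉ S.D.N) : 0 < (Y t).yXi ξ := by
  refine S.p_pos_of_notMem hξ (z := fun t => (Y t).vals S.D.χ ξ) H.init H.near
    H.path.identity H.path.conserved (H.solves 2) (H.solves 3) (fun s hs hq => ?_)
    (fun h1 h2 s hs => ?_) t ht
  · exact indicator_apply_nonneg (s := {s | ξ ∈ unbroken S.T Y s})
      (f := fun t => (Y t).UXi ξ) fun _ => hq
  · exact indicator_apply_nonneg (s := {s | ξ ∈ unbroken S.T Y s}) (f := fun t =>
      1 / 2 * (Y t).h ξ + acoef S.D.χ S.T Y t ξ * (Y t).yXi ξ + S.D.k * (Y t).rbar ξ)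
      fun _ => S.δ_pos.le.trans (H.δ_le hY h0 hs h1 h2)

omit ht in
lemma virtual_strictMono (hξ : ξ ∈ S.D.N) {s t : ℝ} (hs : s ∈ Icc 0 S.T) (ht : t ∈ Icc 0 S.T)
    (hst : s ≤ t) : virtualVals S.D.χ S.T S.D.k Y s ξ 3 ≤ virtualVals S.D.χ S.T S.D.k Y t ξ 3 := by
  rw [S.N_eq] at hξ
  have h1 := H.path.virtual_eq.sub_eq hs ht
  have h2 := intervalIntegral.integral_nonneg (μ := volume) hst fun x hx =>
    S.δ_pos.le.trans (H.δ_le hY h0 ⟨hs.1.trans hx.1, hx.2.trans ht.2⟩ hξ.1 hξ.2.2)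
  exact sub_nonneg.1 (h2.trans h1.ge)

lemma broken_iff : (ξ ∈ unbroken S.T Y t ↔ ¬ S.D.Broken ξ (virtualVals S.D.χ S.T S.D.k Y t ξ)) ∧
    S.D.trunc ξ (virtualVals S.D.χ S.T S.D.k Y t ξ) = (Y t).UXi ξ := by
  have hmem : ξ ∈ unbroken S.T Y t ↔ 0 < (Y t).yXi ξ := H.path.mem_iff_pos ht
  rw [hmem]
  by_cases hξ : ξ ∈ S.D.N
  · have hξ' := hξ
    rw [S.N_eq] at hξ'
    have e := H.init
    have e2 : (Y 0).yXi ξ = S.z₀ ξ 2 := congrFun e 2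
    have e3 : (Y 0).UXi ξ = S.z₀ ξ 3 := congrFun e 3
    have e5 : (Y 0).rbar ξ = S.z₀ ξ 5 := congrFun e 5
    by_cases hp : 0 < (Y t).yXi ξ
    · have hq : (Y t).UXi ξ < 0 := by
        refine H.path.q_neg ?_ ?_ (fun s hs => ?_) ht hp
        · rw [e3]; exact hξ'.2.1
        · rw [e5, e2]; exact hξ'.2.2
        · have hs2 := H.half_κ_le hs
          have hsp : 0 ≤ (Y s).yXi ξ := H.path.p_nonneg hs
          have d2 : |(Y s).yXi ξ - S.z₀ ξ 2| ≤ S.ρ := (abs_sub_le_norm _ _ 2).trans (H.near s hs)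
          have h1 : (Y s).yXi ξ ≤ S.ε + S.ρ := by linarith [hξ'.1, (abs_le.1 d2).2]
          obtain ⟨hs1, -⟩ := S.ρ_le_κ
          have h2 : S.D.k ^ 2 * (Y s).yXi ξ ≤ S.D.k ^ 2 * (S.ε + S.ρ) :=
            mul_le_mul_of_nonneg_left h1 (sq_nonneg _)
          have h3 : S.D.k ^ 2 = |S.D.k| * |S.D.k| := by rw [abs_mul_abs_self]; ring
          have h5 : 0 ≤ |S.D.k| * (S.ε + S.ρ) :=
            mul_nonneg (abs_nonneg _) (add_nonneg S.ε_pos.le S.ρ_nonneg)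
          have := S.κ_pos
          nlinarith
      have hv : virtualVals S.D.χ S.T S.D.k Y t ξ 3 = (Y t).UXi ξ := H.path.virtual_of_pos ht hp
      refine ⟨⟨fun _ hb => ?_, fun _ => hp⟩, ?_⟩
      · have := hb.2
        rw [hv] at this
        linarith
      · rw [Params.trunc, if_pos hξ, hv, min_eq_left hq.le]
    · have hz : (Y t).yXi ξ = 0 := le_antisymm (not_lt.1 hp) (H.path.p_nonneg ht)
      have hv : 0 ≤ virtualVals S.D.χ S.T S.D.k Y t ξ 3 :=
        H.path.virtual_nonneg (fun s hs hs0 => by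
          have := H.half_κ_le hs
          rw [hs0, zero_add] at this
          linarith [S.κ_pos]) ht hz
      refine ⟨⟨fun h => absurd h hp, fun hb => absurd ⟨hξ, hv⟩ hb⟩, ?_⟩
      rw [trunc_of_broken ⟨hξ, hv⟩]
      exact (H.path.eq_zero_of_p_eq_zero ht hz).1.symm
  · have hp := H.p_pos hY h0 ht hξ
    have hv : virtualVals S.D.χ S.T S.D.k Y t ξ 3 = (Y t).UXi ξ := H.path.virtual_of_pos ht hp
    exact ⟨⟨fun _ hb => hξ hb.1, fun _ => hp⟩, by rw [Params.trunc, if_neg hξ, hv]⟩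

lemma norm_virtualVals_sub_le : ‖virtualVals S.D.χ S.T S.D.k Y t ξ - S.z₀ ξ‖ ≤ S.ρ := by
  have hn : ∀ i, |((Y t).vals S.D.χ ξ - S.z₀ ξ) i| ≤ S.ρ := fun i =>
    (abs_le_norm _ i).trans (H.near t ht)
  rw [pi_norm_le_iff_of_nonneg S.ρ_nonneg]
  intro i
  fin_cases i
  · exact hn 0
  · exact hn 1
  · exact hn 2
  · have h1 := H.path.virtual_eq.abs_sub_le (C := S.Λ) ⟨le_rfl, S.T_pos.le⟩ ht ht.1 fun x hx =>
      (H.abs_acoef_le hY h0 ⟨hx.1, hx.2.trans ht.2⟩).2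
    have e3 : (Y 0).UXi ξ = S.z₀ ξ 3 := congrFun H.init 3
    have h2 : S.Λ * (t - 0) ≤ S.ρ := by
      rw [sub_zero]
      exact (mul_le_mul_of_nonneg_left ht.2 S.Λ_nonneg).trans S.ΛT_le
    have e0 : ∀ A p q h r, virtual S.D.k A p q h r 0 = q 0 := fun A p q h r => by simp [virtual]
    rw [e0, e3] at h1
    exact h1.trans h2
  · exact hn 4
  · exact hn 5

end NearPoint

lemma represents_virtualVals {t : ℝ} (ht : t ∈ Icc 0 S.T) :
    S.D.Represents (unbroken S.T Y t) (Y t) (virtualVals S.D.χ S.T S.D.k Y t) where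
  c := c_eq hY h0 ht
  k := k_eq hY h0 ht
  zeta _ := rfl
  U _ := rfl
  yXi := Eventually.of_forall fun _ => rfl
  h := Eventually.of_forall fun _ => rfl
  rbar := Eventually.of_forall fun _ => rfl
  mem_iff := by
    filter_upwards [ae_nearPoint hY h0] with ξ hξ using (hξ.broken_iff hY h0 ht).1
  deriv := (hY.compatible t ht).hasDerivAE_y
  meas_mem := nullMeasurableSet_unbroken hY h0 ht
  meas i hi := by
    have := aemeasurable_vals hY ht i
    fin_cases i
    · exact this
    · exact this
    · exact this
    · exact absurd rfl hi
    · exact this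
    · exact this

lemma profile_virtualVals {t : ℝ} (ht : t ∈ Icc 0 S.T) :
    S.D.Profile S.M S.K (virtualVals S.D.χ S.T S.D.k Y t) := by
  refine (represents_virtualVals hY h0 ht).profile S.hχ S.K_ge' ?_ fun ξ => ?_
  · filter_upwards [ae_nearPoint hY h0] with ξ hξ
    exact norm_le_of_sub_le (hξ.norm_virtualVals_sub_le hY h0 ht)
  · refine le_of_ae_le_of_continuous (hY.compatible t ht).zeta.continuous.abs ?_ ξ
    filter_upwards [ae_norm_vals_le hY h0 ht] with ξ hξ using (abs_le_norm _ 0).trans hξ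

lemma solves_virtualVals {ξ : ℝ} (H : S.NearPoint Y ξ) (i : Fin 6) :
    SolvesODE S.T (fun t => virtualVals S.D.χ S.T S.D.k Y t ξ i)
      fun t => S.D.rhsAt (virtualVals S.D.χ S.T S.D.k Y t) ξ i := by
  have hA : ∀ t ∈ Icc 0 S.T, acoef S.D.χ S.T Y t ξ
      = S.D.coef (virtualVals S.D.χ S.T S.D.k Y t) ξ := fun t ht =>
    (represents_virtualVals hY h0 ht).P_eq S.hχ (profile_virtualVals hY h0 ht) ξ
  have hind : ∀ t ∈ Icc 0 S.T, ∀ u : ℝ → ℝ, ((Y t).UXi ξ = 0 → u t = 0) →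
      {s | ξ ∈ unbroken S.T Y s}.indicator u t = u t := fun t ht u hu => by
    by_cases h : t ∈ {s | ξ ∈ unbroken S.T Y s}
    · rw [indicator_of_mem h]
    · rw [indicator_of_notMem h, hu]
      exact (H.path.eq_zero_of_p_eq_zero ht (H.path.p_eq_zero_of_notMem ht h)).1
  have htr := fun t ht => (H.broken_iff hY h0 (t := t) ht).2
  fin_cases i
  · exact H.solves 0
  · exact (H.solves 1).congr (fun _ _ => rfl) fun t ht =>
      (represents_virtualVals hY h0 ht).Q_eq S.hχ (profile_virtualVals hY h0 ht) ξ
  · refine (H.solves 2).congr (fun _ _ => rfl) fun t ht => ?_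
    refine (hind t ht (fun t => (Y t).UXi ξ) id).trans ?_
    exact (htr t ht).symm
  · refine H.path.virtual_eq.congr (fun _ _ => rfl) fun t ht => ?_
    beta_reduce
    rw [hA t ht]
    rfl
  · refine (H.solves 4).congr (fun _ _ => rfl) fun t ht => ?_
    refine (hind t ht (fun t => 2 * acoef S.D.χ S.T Y t ξ * (Y t).UXi ξ) fun h => ?_).trans ?_
    · rw [h, mul_zero]
    · rw [hA t ht, ← htr t ht]
      rfl
  · refine (H.solves 5).congr (fun _ _ => rfl) fun t ht => ?_
    refine (hind t ht (fun t => -(S.D.k * (Y t).UXi ξ)) fun h => ?_).trans ?_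
    · rw [h, mul_zero, neg_zero]
    · rw [← htr t ht]
      rfl

variable {Z : ℝ → ℝ → Vals} (hZ : S.Traj Z) (hfix : S.Phi Z = Z)

include hZ hfix

lemma ae_norm_sub_halve {d : ℝ}
    (hd : ∀ᵐ ξ, ∀ t ∈ Icc 0 S.T, ‖Z t ξ - virtualVals S.D.χ S.T S.D.k Y t ξ‖ ≤ d) :
    ∀ᵐ ξ, ∀ t ∈ Icc 0 S.T, ‖Z t ξ - virtualVals S.D.χ S.T S.D.k Y t ξ‖ ≤ d / 2 := by
  have hT : (0 : ℝ) ∈ Icc 0 S.T := ⟨le_rfl, S.T_pos.le⟩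
  have hW3 : ∀ᵐ η, η ∈ S.D.N → η ∉ S.N' →
      ∀ t ∈ Icc 0 S.T, 0 ≤ virtualVals S.D.χ S.T S.D.k Y t η 3 := by
    filter_upwards [ae_nearPoint hY h0] with η H h1 h2 t ht
    refine le_trans ?_ (H.virtual_strictMono hY h0 h1 hT ht ht.1)
    have e0 : virtualVals S.D.χ S.T S.D.k Y 0 η 3 = (Y 0).UXi η := by
      simp [virtualVals, virtual]
    rw [e0, show (Y 0).UXi η = S.z₀ η 3 from congrFun H.init 3, (q_eq_zero_of_mem h1 h2).2.1]
  filter_upwards [ae_nearPoint hY h0, hd] with ξ H hξ t ht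
  have hint : IntervalIntegrable
      (fun s => S.D.rhsAt (virtualVals S.D.χ S.T S.D.k Y s) ξ) volume 0 t := by
    have hi := fun i => (solves_virtualVals hY h0 H i t ht).1
    exact ⟨Integrable.of_eval fun i => (hi i).1, Integrable.of_eval fun i => (hi i).2⟩
  have h1 := hZ.norm_integral_sub_le ((norm_nonneg _).trans (hξ 0 hT))
    (fun s hs => profile_virtualVals hY h0 hs) hd hW3
    (fun s hs => norm_le_of_sub_le (H.norm_virtualVals_sub_le hY h0 hs)) hξ ht hint
  have e : ∀ i, Z t ξ i - virtualVals S.D.χ S.T S.D.k Y t ξ i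
      = ((∫ s in (0 : ℝ)..t, S.D.rhsAt (Z s) ξ)
        - ∫ s in (0 : ℝ)..t, S.D.rhsAt (virtualVals S.D.χ S.T S.D.k Y s) ξ) i := fun i => by
    have e1 : Z t ξ i = Z 0 ξ i + _ := (solves hZ hfix ξ i t ht).2
    have e2 : virtualVals S.D.χ S.T S.D.k Y t ξ i = virtualVals S.D.χ S.T S.D.k Y 0 ξ i + _ :=
      (solves_virtualVals hY h0 H i t ht).2
    have e3 : virtualVals S.D.χ S.T S.D.k Y 0 ξ i = S.z₀ ξ i := by
      have := congrFun H.init i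
      fin_cases i
      · exact this
      · exact this
      · exact this
      · refine Eq.trans ?_ this
        simp [virtualVals, virtual, State.vals]
      · exact this
      · exact this
    rw [Pi.sub_apply, eval_intervalIntegral (hZ.intervalIntegrable_rhsAt ξ 0 t),
      eval_intervalIntegral hint, e1, e2, e3, hZ.init]
    ring
  have e' : Z t ξ - virtualVals S.D.χ S.T S.D.k Y t ξ = _ := funext e
  rw [e']
  exact h1

lemma ae_eq_virtualVals :
    ∀ᵐ ξ, ∀ t ∈ Icc 0 S.T, Z t ξ = virtualVals S.D.χ S.T S.D.k Y t ξ := by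
  have hn : ∀ n : ℕ, ∀ᵐ ξ, ∀ t ∈ Icc 0 S.T,
      ‖Z t ξ - virtualVals S.D.χ S.T S.D.k Y t ξ‖ ≤ 2 * S.M * (1 / 2) ^ n := fun n => by
    induction n with
    | zero =>
      filter_upwards [ae_nearPoint hY h0] with ξ H t ht
      have h1 := hZ.norm_le t ξ
      have h2 := norm_le_of_sub_le (H.norm_virtualVals_sub_le hY h0 ht)
      have h3 := norm_sub_le (Z t ξ) (virtualVals S.D.χ S.T S.D.k Y t ξ)
      simp only [pow_zero, mul_one]
      linarith
    | succ n ih =>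
      filter_upwards [ae_norm_sub_halve hY h0 hZ hfix ih] with ξ hξ t ht
      refine (hξ t ht).trans (le_of_eq ?_)
      ring
  filter_upwards [ae_all_iff.2 hn] with ξ hξ t ht
  have hlim : Tendsto (fun n : ℕ => 2 * S.M * (1 / 2 : ℝ) ^ n) atTop (𝓝 (2 * S.M * 0)) :=
    (tendsto_pow_atTop_nhds_zero_of_lt_one (by norm_num) (by norm_num)).const_mul _
  have h1 := ge_of_tendsto' hlim fun n => hξ n t ht
  rw [mul_zero] at h1
  exact sub_eq_zero.1 (norm_le_zero_iff.1 h1)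

/-- Any solution with the same initial data agrees with the constructed one. -/
lemma same_toState (h1 : HasDerivAE (fun ξ => S.z₀ ξ 0) fun ξ => S.z₀ ξ 2 - 1)
    (h2 : HasDerivAE (fun ξ => S.z₀ ξ 1) fun ξ => S.z₀ ξ 3) {t : ℝ} (ht : t ∈ Icc 0 S.T) :
    (Y t).Same (S.D.toState (Z t)) := by
  have hae : ∀ᵐ ξ, Z t ξ = virtualVals S.D.χ S.T S.D.k Y t ξ := by
    filter_upwards [ae_eq_virtualVals hY h0 hZ hfix] with ξ hξ using hξ t ht
  have hc := compatible_toState hZ hfix h1 h2 ht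
  have hcY := hY.compatible t ht
  refine ⟨?_, ?_, c_eq hY h0 ht, ?_, ?_, ?_, ?_, k_eq hY h0 ht⟩
  · refine (hcY.zeta.continuous.ae_eq_iff_eq volume hc.zeta.continuous).1 ?_
    filter_upwards [hae] with ξ hξ
    exact (congrFun hξ 0).symm
  · refine ((hcY.continuous_Ubar S.hχ).ae_eq_iff_eq volume (hc.continuous_Ubar S.hχ)).1 ?_
    filter_upwards [hae] with ξ hξ
    change _ = S.D.ub ξ (Z t ξ)
    rw [hξ]
    exact (represents_virtualVals hY h0 ht).Ubar_eq ξ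
  · filter_upwards [hae] with ξ hξ
    have : Z t ξ 2 = 1 + (Y t).zetaXi ξ := congrFun hξ 2
    change _ = Z t ξ 2 - 1
    rw [this]
    ring
  · filter_upwards [hae, ae_nearPoint hY h0] with ξ hξ H
    change _ = S.D.trunc ξ (Z t ξ)
    rw [hξ]
    exact (H.broken_iff hY h0 ht).2.symm
  · filter_upwards [hae] with ξ hξ using (congrFun hξ 4).symm
  · filter_upwards [hae] with ξ hξ using (congrFun hξ 5).symm

end Setting

end TwoCH

end

theorem mainTheorem3 (χ : ℝ → ℝ) (hχ : TwoCH.IsPartitionFunction χ)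
    (X₀ : TwoCH.State) (hX₀ : X₀ ∈ TwoCH.G χ) :
    ∃ T : ℝ, 0 < T ∧ ∃ X : ℝ → TwoCH.State,
      TwoCH.IsSolution χ T X ∧ (X 0).Same X₀ ∧
      (∀ t ∈ Set.Icc 0 T, X t ∈ TwoCH.G χ) ∧
      ∀ Y : ℝ → TwoCH.State, TwoCH.IsSolution χ T Y → (Y 0).Same X₀ →
        ∀ t ∈ Set.Icc 0 T, (Y t).Same (X t) := by
  have hG : TwoCH.MemG χ X₀ := hX₀
  obtain ⟨z, κ, C, hz⟩ := hG.exists_representative hχ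
  obtain ⟨S, rfl, hc, hk, rfl⟩ := hz.exists_setting hχ hG
  obtain ⟨Z, hZ, hfix⟩ := S.exists_fixed
  have h0 : TwoCH.HasDerivAE (fun ξ => S.z₀ ξ 0) fun ξ => S.z₀ ξ 2 - 1 :=
    hG.compatible.zeta.congr (fun ξ => (hz.zeta ξ).symm) (by
      filter_upwards [hz.yXi] with ξ hξ
      rw [hξ, TwoCH.State.yXi]
      ring)
  have h1 : TwoCH.HasDerivAE (fun ξ => S.z₀ ξ 1) fun ξ => S.z₀ ξ 3 :=
    hG.compatible.U.congr (fun ξ => (hz.U ξ).symm) (by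
      filter_upwards [hz.UXi] with ξ hξ using hξ.symm)
  have hlim : Filter.Tendsto (fun ξ => S.z₀ ξ 0) Filter.atBot (nhds 0) := by
    simpa only [hz.zeta] using hG.tendsto_zeta
  have hstart : ∀ Y : TwoCH.State, Y.Same X₀ → S.Starts Y := fun Y hY => by
    have hU : ∀ ξ, Y.U S.D.χ ξ = X₀.U S.D.χ ξ := fun ξ => by
      simp only [TwoCH.State.U, TwoCH.State.y, hY.zeta, hY.Ubar, hY.c]
    refine ⟨hY.c.trans hc.symm, hY.k.trans hk.symm, ?_⟩
    filter_upwards [hY.zetaXi, hY.UXi, hY.h, hY.rbar, hz.yXi, hz.UXi, hz.h, hz.rbar]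
      with ξ a2 a3 a4 a5 b2 b3 b4 b5
    funext i
    fin_cases i
    · exact (congrFun hY.zeta ξ).trans (hz.zeta ξ).symm
    · exact (hU ξ).trans (hz.U ξ).symm
    · exact (congrArg (1 + ·) a2).trans b2.symm
    · exact a3.trans b3.symm
    · exact a4.trans b4.symm
    · exact a5.trans b5.symm
  have hsame : (S.D.toState (Z 0)).Same X₀ := by
    have hi := hZ.init
    refine ⟨funext fun ξ => ?_, funext fun ξ => ?_, hc, ?_, ?_, ?_, ?_, hk⟩
    · exact (congrFun (hi ξ) 0).trans (hz.zeta ξ)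
    · change S.D.ub ξ (Z 0 ξ) = _
      rw [hi, TwoCH.Params.ub, hz.U, hz.zeta, hc, TwoCH.State.U, TwoCH.State.y]
      ring
    · filter_upwards [hz.yXi] with ξ hξ
      change Z 0 ξ 2 - 1 = _
      rw [hi, hξ, TwoCH.State.yXi]
      ring
    · filter_upwards [hz.UXi] with ξ hξ
      change S.D.trunc ξ (Z 0 ξ) = _
      rw [hi, TwoCH.Setting.trunc_init, hξ]
    · filter_upwards [hz.h] with ξ hξ
      exact (congrFun (hi ξ) 4).trans hξ
    · filter_upwards [hz.rbar] with ξ hξ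
      exact (congrFun (hi ξ) 5).trans hξ
  exact ⟨S.T, S.T_pos, fun t => S.D.toState (Z t),
    TwoCH.Setting.isSolution_toState hZ hfix h0 h1, hsame,
    fun t ht => TwoCH.Setting.memG_toState hZ hfix h0 h1 hlim ht,
    fun Y hY hY0 t ht => TwoCH.Setting.same_toState hY (hstart _ hY0) hZ hfix h0 h1 ht⟩
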